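/- Let $k$ be an algebraically closed field (of any characteristic), $S$ a scheme of finite type over $k$, $\mathcal H$ a vector bundle of rank $d$ on $S$, and $\mathcal P_1^\bullet,\dots,\mathcal P_\ell^\bullet$ complete flags of subbundles of $\mathcal H$, where $\mathcal P_i^a$ has corank $a$ for $0\le a\le d$. Let $\mathrm{Fl}(d)$ be the variety of complete flags in $k^d$, let $\mathrm{Fr}(\mathcal H)\to S$ be the frame bundle, and let $p\colon \mathrm{Fr}(\mathcal H)\to \mathrm{Fl}(d)^\ell$ be the morphism induced by the flags. The flags are called versal if $p$ is a smooth morphism, and versal at a point $x$ if their restrictions to some open neighborhood of $x$ in $S$ are versal. For complete flags $P_1^\bullet,\dots,P_\ell^\bullet$ in a vector space $H$ let $\mathrm{Fix}\,P_i^\bullet=\{\varphi\in\mathrm{End}\,H:\varphi(P_i^a)\subseteq P_i^a\text{ for all }a\}$ and $$M(H;P_1^\bullet,\dots,P_\ell^\bullet)=\mathrm{coker}\Big(\mathrm{End}\,H\xrightarrow{\ \Delta\ }\prod_{i=1}^{\ell}\mathrm{End}\,H/\mathrm{Fix}\,P_i^\bullet\Big),$$ where $\Delta$ is the diagonal map.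 For a closed point $x\in S$, let $\delta_x\colon T_xS\to M(\mathcal H_x;(\mathcal P_1^\bullet)_x,\dots,(\mathcal P_\ell^\bullet)_x)$ be the linear map obtained as follows: choose a section $s$ of $\mathrm{Fr}(\mathcal H)$ on a neighborhood of $x$, take the differential $T_xS\to T_{p(s(x))}\mathrm{Fl}(d)^\ell$ of $p\circ s$ at $x$, identify the target with $\prod_{i}\mathrm{End}\,\mathcal H_x/\mathrm{Fix}\,(\mathcal P_i^\bullet)_x$ by means of $s(x)$, and project to $M$; the result does not depend on $s$. Then for every closed point $x\in S$, the flags $\mathcal P_1^\bullet,\dots,\mathcal P_\ell^\bullet$ are versal at $x$ if and only if $S$ is smooth over $k$ at $x$ and $\delta_x$ is surjective. -/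

import Mathlib

open CategoryTheory AlgebraicGeometry TensorProduct Opposite

universe u

noncomputable section

namespace RelFlag

/-! ### Flags and first-order deformations: linear algebra -/

section LinearAlgebra

variable {d : ℕ}

/-- `Fix P`: the endomorphisms `φ` of `V` with `φ (P a) ⊆ P a` for all `a`. -/
def fixFlag {K V : Type*} [Field K] [AddCommGroup V] [Module K V]
    (P : Fin (d + 1) → Submodule K V) : Submodule K (Module.End K V) where
  carrier := {φ | ∀ a, ∀ w ∈ P a, φ w ∈ P a}
  add_mem' := fun hφ hψ a w hw => (P a).add_mem (hφ a w hw) (hψ a w hw)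
  zero_mem' := fun a _ _ => (P a).zero_mem
  smul_mem' := fun c _ hφ a w hw => (P a).smul_mem c (hφ a w hw)

/-- The quotient `End V / Fix P`, the tangent space of the flag variety of `V` at `P`. -/
abbrev FlagTangent {K V : Type*} [Field K] [AddCommGroup V] [Module K V]
    (P : Fin (d + 1) → Submodule K V) : Type _ :=
  Module.End K V ⧸ fixFlag P

/-- The class of an endomorphism in `End V / Fix P`. -/
def FlagTangent.mk {K V : Type*} [Field K] [AddCommGroup V] [Module K V]
    (P : Fin (d + 1) → Submodule K V) : Module.End K V →ₗ[K] FlagTangent P :=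
  (fixFlag P).mkQ

theorem FlagTangent.mk_eq {K V : Type*} [Field K] [AddCommGroup V] [Module K V]
    (P : Fin (d + 1) → Submodule K V) {φ ψ : Module.End K V} (h : φ - ψ ∈ fixFlag P) :
    FlagTangent.mk P φ = FlagTangent.mk P ψ :=
  (Submodule.Quotient.eq _).mpr h

/-- The diagonal map `Δ : End V → ∏ i, End V / Fix (P i)`. -/
def diagonalMap {K V : Type*} [Field K] [AddCommGroup V] [Module K V] {l : ℕ}
    (P : Fin l → Fin (d + 1) → Submodule K V) :
    Module.End K V →ₗ[K] ((i : Fin l) → FlagTangent (P i)) :=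
  LinearMap.pi fun i => FlagTangent.mk (P i)

/-- `M(V; P_1, …, P_l) = coker (Δ : End V → ∏ i, End V / Fix (P i))`, the space of relative
first-order deformations of the flags. -/
abbrev RelDefSpace {K V : Type*} [Field K] [AddCommGroup V] [Module K V] {l : ℕ}
    (P : Fin l → Fin (d + 1) → Submodule K V) : Type _ :=
  ((i : Fin l) → FlagTangent (P i)) ⧸ LinearMap.range (diagonalMap P)

/-- Base change of a chain of submodules of `R ^ d` along a ring homomorphism: the submodules of
`R' ^ d` spanned by the images.  For complete flags of subbundles this is the pullback. -/
def mapFlag {R R' : Type*} [CommRing R] [CommRing R'] (f : R →+* R')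
    (F : Fin (d + 1) → Submodule R (Fin d → R)) : Fin (d + 1) → Submodule R' (Fin d → R') :=
  fun a => Submodule.span R' ((fun (w : Fin d → R) (j : Fin d) => f (w j)) '' (F a : Set _))

/-- The chain of submodules spanned by the tails `g_a, …, g_{d-1}` of a family of vectors; if `g` is
a basis this is a complete flag, indexed by codimension. -/
def tailFlag {R N : Type*} [CommRing R] [AddCommGroup N] [Module R N] (g : Fin d → N) :
    Fin (d + 1) → Submodule R N :=
  fun a => Submodule.span R (g '' {j | (a : ℕ) ≤ (j : ℕ)})

theorem mapFlag_span {R R' : Type*} [CommRing R] [CommRing R'] (f : R →+* R')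
    (F : Fin (d + 1) → Submodule R (Fin d → R)) (a : Fin (d + 1)) (s : Set (Fin d → R))
    (h : F a = Submodule.span R s) :
    mapFlag f F a =
      Submodule.span R' ((fun (w : Fin d → R) (j : Fin d) => f (w j)) '' s) := by
  unfold mapFlag
  rw [h]
  apply le_antisymm
  · rw [Submodule.span_le]
    rintro _ ⟨w, hw, rfl⟩
    induction hw using Submodule.span_induction with
    | mem w hw => exact Submodule.subset_span ⟨w, hw, rfl⟩
    | zero =>
      have : (fun j : Fin d => f ((0 : Fin d → R) j)) = 0 := by ext; simp
      simp only [this]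
      exact Submodule.zero_mem _
    | add x y _ _ hx hy =>
      have : (fun j : Fin d => f ((x + y) j)) = (fun j => f (x j)) + fun j => f (y j) := by
        ext; simp
      simp only [this]
      exact Submodule.add_mem _ hx hy
    | smul c x _ hx =>
      have : (fun j : Fin d => f ((c • x) j)) = f c • fun j => f (x j) := by
        ext; simp
      simp only [this]
      exact Submodule.smul_mem _ _ hx
  · apply Submodule.span_mono
    apply Set.image_mono
    exact Submodule.subset_span

theorem mapFlag_id {R : Type*} [CommRing R]
    (F : Fin (d + 1) → Submodule R (Fin d → R)) : mapFlag (RingHom.id R) F = F := by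
  funext a
  simp [mapFlag]

theorem mapFlag_comp {R R' R'' : Type*} [CommRing R] [CommRing R'] [CommRing R'']
    (f : R →+* R') (g : R' →+* R'') (F : Fin (d + 1) → Submodule R (Fin d → R)) :
    mapFlag (g.comp f) F = mapFlag g (mapFlag f F) := by
  funext a
  rw [mapFlag_span g (mapFlag f F) a _ rfl, Set.image_image]
  rfl

end LinearAlgebra

/-! ### The derivative of a flag along a tangent vector -/

section Derivative

variable {d : ℕ} {R : Type*} [CommRing R] [IsLocalRing R] {N : Type*} [AddCommGroup N] [Module R N]

local notation "κ" => IsLocalRing.ResidueField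

/-- The homomorphism `R → κ[ε]`, `r ↦ r(x) + ε D(r)`, attached to a derivation `D : R → κ`. -/
def dualNumberHom (D : Derivation ℤ R (κ R)) : R →+* DualNumber (κ R) where
  toFun r := TrivSqZeroExt.inl (IsLocalRing.residue R r) + TrivSqZeroExt.inr (D r)
  map_one' := by ext <;> simp
  map_mul' r s := by
    ext
    · simp
    · have h1 : ∀ (a : R) (b : κ R), a • b = IsLocalRing.residue R a * b := fun a b =>
        Algebra.smul_def a b
      simp [h1, -algebraMap_smul]
      ring
  map_zero' := by ext <;> simp
  map_add' r s := by ext <;> simp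

/-- The flag in the fibre `κ ⊗ N` induced by a flag in `N`. -/
def fibreFlag (Q : Fin (d + 1) → Submodule R N) : Fin (d + 1) → Submodule (κ R) (κ R ⊗[R] N) :=
  fun a => (Q a).baseChange (κ R)

/-- The basis of the fibre induced by a basis of `N`. -/
abbrev fibreBasis (e : Module.Basis (Fin d) R N) : Module.Basis (Fin d) (κ R) (κ R ⊗[R] N) :=
  e.baseChange (κ R)

/-- The flag `Q` in the coordinates given by the basis `e`. -/
def coordFlag (e : Module.Basis (Fin d) R N) (Q : Fin (d + 1) → Submodule R N) :
    Fin (d + 1) → Submodule R (Fin d → R) :=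
  fun a => (Q a).map (e.equivFun : N →ₗ[R] (Fin d → R))

/-- The flag `(1 + ε φ) P` in `κ[ε] ^ d`, for a flag `P` in the fibre and an endomorphism `φ` of the
fibre, in the coordinates of the fibre given by `e`. -/
def deformedFlag (e : Module.Basis (Fin d) R N) (φ : Module.End (κ R) (κ R ⊗[R] N))
    (P : Fin (d + 1) → Submodule (κ R) (κ R ⊗[R] N)) :
    Fin (d + 1) → Submodule (DualNumber (κ R)) (Fin d → DualNumber (κ R)) :=
  fun a => Submodule.span _ ((fun (w : κ R ⊗[R] N) (j : Fin d) =>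
    (TrivSqZeroExt.inl ((fibreBasis e).equivFun w j) +
      TrivSqZeroExt.inr ((fibreBasis e).equivFun (φ w) j) : DualNumber (κ R))) '' (P a : Set _))

/-- `φ` represents the derivative of the flag `Q` (read in the frame `e`) along the tangent vector
`D`: the flag over `κ[ε]` obtained from `Q` along `D` is `(1 + ε φ) Q(x)`.  This is the
identification of the tangent space of the flag variety at `Q(x)` with `End / Fix Q(x)`. -/
def IsDeriv (e : Module.Basis (Fin d) R N) (D : Derivation ℤ R (κ R))
    (Q : Fin (d + 1) → Submodule R N) (φ : Module.End (κ R) (κ R ⊗[R] N)) : Prop :=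
  mapFlag (dualNumberHom D) (coordFlag e Q) = deformedFlag e φ (fibreFlag Q)

/-- The derivative of a vector along `D`, in the frame `e`. -/
def conn (e : Module.Basis (Fin d) R N) (D : Derivation ℤ R (κ R)) (s : N) : κ R ⊗[R] N :=
  (fibreBasis e).equivFun.symm fun j => D (e.equivFun s j)

theorem fibreBasis_equivFun_tmul (e : Module.Basis (Fin d) R N) (s : N) (j : Fin d) :
    (fibreBasis e).equivFun (1 ⊗ₜ[R] s) j = IsLocalRing.residue R (e.equivFun s j) := by
  simp [Module.Basis.baseChange_repr_tmul, Algebra.smul_def]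

theorem conn_add (e : Module.Basis (Fin d) R N) (D : Derivation ℤ R (κ R)) (s t : N) :
    conn e D (s + t) = conn e D s + conn e D t := by
  unfold conn
  rw [← map_add]
  congr 1
  ext j
  simp

theorem conn_smul (e : Module.Basis (Fin d) R N) (D : Derivation ℤ R (κ R)) (r : R) (s : N) :
    conn e D (r • s) = IsLocalRing.residue R r • conn e D s + D r • ((1 : κ R) ⊗ₜ[R] s) := by
  unfold conn
  apply (fibreBasis e).equivFun.injective
  ext j
  rw [map_add, map_smul, map_smul, LinearEquiv.apply_symm_apply, LinearEquiv.apply_symm_apply,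
    map_smul, Pi.add_apply, Pi.smul_apply, Pi.smul_apply, Pi.smul_apply, fibreBasis_equivFun_tmul]
  simp [Algebra.smul_def, mul_comm]

theorem fibre_smul_sub (c : κ R) (x y : κ R ⊗[R] N) : c • (x - y) = c • x - c • y :=
  smul_sub c x y

theorem exists_tmul_of_mem_fibreFlag (Q : Fin (d + 1) → Submodule R N) (a : Fin (d + 1))
    (w : κ R ⊗[R] N) (hw : w ∈ fibreFlag Q a) : ∃ s ∈ Q a, w = 1 ⊗ₜ[R] s := by
  unfold fibreFlag at hw
  rw [Submodule.baseChange_eq_span] at hw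
  induction hw using Submodule.span_induction with
  | mem w hw =>
    obtain ⟨s, hs, rfl⟩ := hw
    exact ⟨s, hs, rfl⟩
  | zero => exact ⟨0, zero_mem _, by simp⟩
  | add x y _ _ hx hy =>
    obtain ⟨s, hs, rfl⟩ := hx
    obtain ⟨t, ht, rfl⟩ := hy
    exact ⟨s + t, add_mem hs ht, by rw [TensorProduct.tmul_add]⟩
  | smul c x _ hx =>
    obtain ⟨s, hs, rfl⟩ := hx
    obtain ⟨r, rfl⟩ := IsLocalRing.residue_surjective c
    refine ⟨r • s, Submodule.smul_mem _ _ hs, ?_⟩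
    rw [TensorProduct.tmul_smul]
    change algebraMap R (κ R) r • _ = _
    rw [algebraMap_smul]

/-- In terms of sections: `φ` represents the derivative iff `∇_D s - φ (s(x))` lies in `Q(x)^a` for
every `s ∈ Q^a`. -/
theorem isDeriv_iff (e : Module.Basis (Fin d) R N) (D : Derivation ℤ R (κ R))
    (Q : Fin (d + 1) → Submodule R N) (φ : Module.End (κ R) (κ R ⊗[R] N)) :
    IsDeriv e D Q φ ↔
      ∀ a, ∀ s ∈ Q a, conn e D s - φ (1 ⊗ₜ[R] s) ∈ fibreFlag Q a := by
  set E := (fibreBasis e).equivFun with hE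
  have hmem : ∀ a, ∀ s ∈ Q a, (1 : κ R) ⊗ₜ[R] s ∈ fibreFlag Q a := fun a s hs =>
    Submodule.tmul_mem_baseChange_of_mem 1 hs
  have hgen : ∀ (s : N), (fun j => dualNumberHom D (e.equivFun s j)) =
      fun j => (TrivSqZeroExt.inl (E (1 ⊗ₜ[R] s) j) +
        TrivSqZeroExt.inr (E (conn e D s) j) : DualNumber (κ R)) := by
    intro s
    ext j
    · simp [hE, dualNumberHom, fibreBasis_equivFun_tmul]
    · simp only [hE, dualNumberHom, conn, LinearEquiv.apply_symm_apply]
      simp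
  constructor
  · intro h a s hs
    have h1 : (fun j => dualNumberHom D (e.equivFun s j)) ∈
        mapFlag (dualNumberHom D) (coordFlag e Q) a :=
      Submodule.subset_span ⟨e.equivFun s, ⟨s, hs, rfl⟩, rfl⟩
    rw [h, hgen] at h1
    have key : ∀ y ∈ deformedFlag e φ (fibreFlag Q) a,
        E.symm (fun j => (y j).fst) ∈ fibreFlag Q a ∧
        E.symm (fun j => (y j).snd) - φ (E.symm (fun j => (y j).fst)) ∈ fibreFlag Q a := by
      intro y hy
      induction hy using Submodule.span_induction with
      | mem y hy =>
        obtain ⟨w, hw, rfl⟩ := hy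
        have e1 : E.symm (fun j => (TrivSqZeroExt.inl (E w j) +
          TrivSqZeroExt.inr (E (φ w) j) : DualNumber (κ R)).fst) = w := by simp
        have e2 : E.symm (fun j => (TrivSqZeroExt.inl (E w j) +
          TrivSqZeroExt.inr (E (φ w) j) : DualNumber (κ R)).snd) = φ w := by simp
        refine ⟨?_, ?_⟩
        · exact e1.symm ▸ hw
        · have : E.symm (fun j => (TrivSqZeroExt.inl (E w j) +
            TrivSqZeroExt.inr (E (φ w) j) : DualNumber (κ R)).snd) -
              φ (E.symm (fun j => (TrivSqZeroExt.inl (E w j) +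
                TrivSqZeroExt.inr (E (φ w) j) : DualNumber (κ R)).fst)) = 0 := by
            rw [e1, e2, sub_self]
          exact this.symm ▸ zero_mem _
      | zero =>
        have : (fun _ : Fin d => (0 : κ R)) = 0 := rfl
        simp [this]
      | add x y _ _ hx hy =>
        have e1 : (fun j => ((x + y) j).fst) = (fun j => (x j).fst) + fun j => (y j).fst := by
          ext; simp
        have e2 : (fun j => ((x + y) j).snd) = (fun j => (x j).snd) + fun j => (y j).snd := by
          ext; simp
        rw [e1, e2, map_add, map_add, map_add, add_sub_add_comm]
        exact ⟨add_mem hx.1 hy.1, add_mem hx.2 hy.2⟩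
      | smul c x _ hx =>
        have e1 : (fun j => ((c • x) j).fst) = c.fst • (fun j => (x j).fst) := by
          ext; simp
        have e2 : (fun j => ((c • x) j).snd) =
            c.fst • (fun j => (x j).snd) + c.snd • fun j => (x j).fst := by
          ext; simp [mul_comm]
        rw [e1, e2, map_add, map_smul, map_smul, map_smul, map_smul, add_sub_right_comm,
          ← fibre_smul_sub]
        exact ⟨Submodule.smul_mem _ _ hx.1, add_mem (Submodule.smul_mem _ _ hx.2)
          (Submodule.smul_mem _ _ hx.1)⟩
    have := (key _ h1).2
    simpa using this
  · intro h
    have heps : ∀ a, ∀ w ∈ fibreFlag Q a,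
        (fun j => (TrivSqZeroExt.inr (E w j) : DualNumber (κ R))) ∈
          mapFlag (dualNumberHom D) (coordFlag e Q) a := by
      intro a w hw
      obtain ⟨s, hs, rfl⟩ := exists_tmul_of_mem_fibreFlag Q a w hw
      have h1 : (fun j => dualNumberHom D (e.equivFun s j)) ∈
          mapFlag (dualNumberHom D) (coordFlag e Q) a :=
        Submodule.subset_span ⟨e.equivFun s, ⟨s, hs, rfl⟩, rfl⟩
      have h2 := Submodule.smul_mem _ (TrivSqZeroExt.inr 1 : DualNumber (κ R)) h1
      rw [hgen] at h2
      convert h2 using 1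
      ext j <;> simp
    have heps' : ∀ a, ∀ w ∈ fibreFlag Q a,
        (fun j => (TrivSqZeroExt.inr (E w j) : DualNumber (κ R))) ∈
          deformedFlag e φ (fibreFlag Q) a := by
      intro a w hw
      have h2 := Submodule.smul_mem (deformedFlag e φ (fibreFlag Q) a)
        (TrivSqZeroExt.inr 1 : DualNumber (κ R)) (Submodule.subset_span ⟨w, hw, rfl⟩)
      convert h2 using 1
      ext j <;> simp [hE]
    funext a
    apply le_antisymm
    · refine Submodule.span_le.mpr ?_
      rintro _ ⟨_, ⟨s, hs, rfl⟩, rfl⟩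
      have h1 : (fun j => (TrivSqZeroExt.inl (E (1 ⊗ₜ[R] s) j) +
          TrivSqZeroExt.inr (E (φ (1 ⊗ₜ[R] s)) j) : DualNumber (κ R))) ∈
          deformedFlag e φ (fibreFlag Q) a :=
        Submodule.subset_span ⟨_, hmem a s hs, rfl⟩
      have h2 := add_mem h1 (heps' a _ (h a s hs))
      have h3 := hgen s
      change (fun j => dualNumberHom D (e.equivFun s j)) ∈ _
      rw [h3]
      refine cast (congrArg (· ∈ deformedFlag e φ (fibreFlag Q) a) ?_) h2
      ext j <;> simp
    · refine Submodule.span_le.mpr ?_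
      rintro _ ⟨w, hw, rfl⟩
      obtain ⟨s, hs, rfl⟩ := exists_tmul_of_mem_fibreFlag Q a w hw
      have h1 : (fun j => dualNumberHom D (e.equivFun s j)) ∈
          mapFlag (dualNumberHom D) (coordFlag e Q) a :=
        Submodule.subset_span ⟨e.equivFun s, ⟨s, hs, rfl⟩, rfl⟩
      rw [hgen] at h1
      have h2 := sub_mem h1 (heps a _ (h a s hs))
      change (fun j => (TrivSqZeroExt.inl (E (1 ⊗ₜ[R] s) j) +
          TrivSqZeroExt.inr (E (φ (1 ⊗ₜ[R] s)) j) : DualNumber (κ R))) ∈ _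
      refine cast (congrArg (· ∈ mapFlag (dualNumberHom D) (coordFlag e Q) a) ?_) h2
      ext j <;> simp

/-- A chain of submodules of `N` is a complete flag (with locally free graded pieces of rank one) if
it is the chain of tails of some basis. -/
def IsFlag (Q : Fin (d + 1) → Submodule R N) : Prop :=
  ∃ g : Module.Basis (Fin d) R N, Q = tailFlag g

theorem exists_isDeriv (e : Module.Basis (Fin d) R N) (D : Derivation ℤ R (κ R))
    {Q : Fin (d + 1) → Submodule R N} (hQ : IsFlag Q) : ∃ φ, IsDeriv e D Q φ := by
  obtain ⟨g, rfl⟩ := hQ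
  refine ⟨(fibreBasis g).constr (κ R) fun j => conn e D (g j), ?_⟩
  rw [isDeriv_iff]
  intro a s hs
  have hφ : ∀ j, ((fibreBasis g).constr (κ R) fun j => conn e D (g j)) (1 ⊗ₜ[R] g j) =
      conn e D (g j) := by
    intro j
    have := (fibreBasis g).constr_basis (κ R) (fun j => conn e D (g j)) j
    rwa [Module.Basis.baseChange_apply] at this
  unfold tailFlag at hs
  induction hs using Submodule.span_induction with
  | mem s hs =>
    obtain ⟨j, _, rfl⟩ := hs
    rw [hφ, sub_self]
    exact zero_mem _
  | zero => simp [conn, show (fun _ : Fin d => (0 : κ R)) = 0 from rfl]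
  | add x y _ _ hx hy =>
    rw [conn_add, TensorProduct.tmul_add, map_add, add_sub_add_comm]
    exact add_mem hx hy
  | smul c x hx' hx =>
    have h1 : (1 : κ R) ⊗ₜ[R] (c • x) = IsLocalRing.residue R c • ((1 : κ R) ⊗ₜ[R] x) := by
      rw [TensorProduct.tmul_smul]
      exact (algebraMap_smul (κ R) c _).symm
    rw [conn_smul, h1, map_smul, add_sub_right_comm, ← fibre_smul_sub]
    exact add_mem (Submodule.smul_mem _ _ hx)
      (Submodule.smul_mem _ _ (Submodule.tmul_mem_baseChange_of_mem 1 hx'))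

theorem IsDeriv.sub_mem {e : Module.Basis (Fin d) R N} {D : Derivation ℤ R (κ R)}
    {Q : Fin (d + 1) → Submodule R N} {φ ψ : Module.End (κ R) (κ R ⊗[R] N)}
    (hφ : IsDeriv e D Q φ) (hψ : IsDeriv e D Q ψ) : φ - ψ ∈ fixFlag (fibreFlag Q) := by
  rw [isDeriv_iff] at hφ hψ
  intro a w hw
  obtain ⟨s, hs, rfl⟩ := exists_tmul_of_mem_fibreFlag Q a w hw
  have := Submodule.sub_mem _ (hψ a s hs) (hφ a s hs)
  rw [sub_sub_sub_cancel_left] at this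
  exact this

/-- The derivative at `x` of the map to the flag variety defined by the flag `Q` and the frame `e`,
as a linear map from the derivations to `End / Fix Q(x)`; it is characterized by
`flagDeriv_eq`. -/
def flagDeriv (e : Module.Basis (Fin d) R N) {Q : Fin (d + 1) → Submodule R N} (hQ : IsFlag Q) :
    Derivation ℤ R (κ R) →ₗ[κ R]
      FlagTangent (fibreFlag Q) where
  toFun D := FlagTangent.mk _ (exists_isDeriv e D hQ).choose
  map_add' D D' := by
    rw [← map_add]
    refine FlagTangent.mk_eq _ <| IsDeriv.sub_mem (exists_isDeriv e (D + D') hQ).choose_spec ?_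
    have h := (isDeriv_iff _ _ _ _).mp (exists_isDeriv e D hQ).choose_spec
    have h' := (isDeriv_iff _ _ _ _).mp (exists_isDeriv e D' hQ).choose_spec
    rw [isDeriv_iff]
    intro a s hs
    have hc : conn e (D + D') s = conn e D s + conn e D' s := by
      unfold conn
      rw [← map_add]
      rfl
    rw [hc, LinearMap.add_apply, add_sub_add_comm]
    exact add_mem (h a s hs) (h' a s hs)
  map_smul' c D := by
    rw [RingHom.id_apply, ← map_smul]
    refine FlagTangent.mk_eq _ <| IsDeriv.sub_mem (exists_isDeriv e (c • D) hQ).choose_spec ?_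
    have h := (isDeriv_iff _ _ _ _).mp (exists_isDeriv e D hQ).choose_spec
    rw [isDeriv_iff]
    intro a s hs
    have hc : conn e (c • D) s = c • conn e D s := by
      unfold conn
      rw [← map_smul]
      rfl
    rw [hc, LinearMap.smul_apply, ← fibre_smul_sub]
    exact Submodule.smul_mem _ _ (h a s hs)

theorem flagDeriv_eq (e : Module.Basis (Fin d) R N) {Q : Fin (d + 1) → Submodule R N}
    (hQ : IsFlag Q) (D : Derivation ℤ R (κ R)) {φ : Module.End (κ R) (κ R ⊗[R] N)}
    (hφ : IsDeriv e D Q φ) : flagDeriv e hQ D = FlagTangent.mk _ φ :=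
  FlagTangent.mk_eq _ (IsDeriv.sub_mem (exists_isDeriv e D hQ).choose_spec hφ)

/-- The derivatives of several flags, modulo simultaneous changes of basis. -/
def relDeriv {l : ℕ} (e : Module.Basis (Fin d) R N) {Q : Fin l → Fin (d + 1) → Submodule R N}
    (hQ : ∀ i, IsFlag (Q i)) :
    Derivation ℤ R (κ R) →ₗ[κ R] RelDefSpace fun i => fibreFlag (Q i) :=
  (LinearMap.range (diagonalMap fun i => fibreFlag (Q i))).mkQ ∘ₗ
    LinearMap.pi fun i => flagDeriv e (hQ i)

/-- `relDeriv` does not depend on the frame. -/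
theorem relDeriv_eq {l : ℕ} (e e' : Module.Basis (Fin d) R N)
    {Q : Fin l → Fin (d + 1) → Submodule R N} (hQ : ∀ i, IsFlag (Q i)) :
    relDeriv e hQ = relDeriv e' hQ := by
  ext1 D
  set A : Module.End (κ R) (κ R ⊗[R] N) :=
    (fibreBasis e).constr (κ R) fun j => conn e' D (e j) - conn e D (e j) with hA
  have hA1 : ∀ s : N, A (1 ⊗ₜ[R] s) = conn e' D s - conn e D s := by
    intro s
    have hs : s ∈ Submodule.span R (Set.range e) := by rw [e.span_eq]; trivial
    induction hs using Submodule.span_induction with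
    | mem s hs =>
      obtain ⟨j, rfl⟩ := hs
      have := (fibreBasis e).constr_basis (κ R) (fun j => conn e' D (e j) - conn e D (e j)) j
      rwa [Module.Basis.baseChange_apply] at this
    | zero => simp [conn, show (fun _ : Fin d => (0 : κ R)) = 0 from rfl]
    | add x y _ _ hx hy =>
      rw [TensorProduct.tmul_add, map_add, hx, hy, conn_add, conn_add, add_sub_add_comm]
    | smul c x _ hx =>
      have h1 : (1 : κ R) ⊗ₜ[R] (c • x) = IsLocalRing.residue R c • ((1 : κ R) ⊗ₜ[R] x) := by
        rw [TensorProduct.tmul_smul]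
        exact (algebraMap_smul (κ R) c _).symm
      rw [h1, map_smul, hx, conn_smul, conn_smul, add_sub_add_right_eq_sub, smul_sub]
  have hφ : ∀ i, ∃ φ, IsDeriv e D (Q i) φ := fun i => exists_isDeriv e D (hQ i)
  choose φ hφ using hφ
  have hφ' : ∀ i, IsDeriv e' D (Q i) (φ i + A) := by
    intro i
    have h := (isDeriv_iff _ _ _ _).mp (hφ i)
    rw [isDeriv_iff]
    intro a s hs
    have := h a s hs
    rw [LinearMap.add_apply, hA1]
    convert this using 1
    abel
  refine (Submodule.Quotient.eq _).mpr ⟨-A, ?_⟩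
  funext i
  refine Eq.trans (b := flagDeriv e (hQ i) D - flagDeriv e' (hQ i) D) ?_ rfl
  rw [flagDeriv_eq e (hQ i) D (hφ i), flagDeriv_eq e' (hQ i) D (hφ' i),
    ← map_sub]
  change FlagTangent.mk _ (-A) = _
  congr 1
  abel

end Derivative

/-! ### Vector bundles and complete flags of subbundles -/

section Bundles

/-- The stalk of a sheaf of modules. -/
abbrev Stalk {S : Scheme.{u}} (M : S.Modules) (x : S) : Type u :=
  ToType (TopCat.Presheaf.stalk M.presheaf x)

instance stalkModule {S : Scheme.{u}} (M : S.Modules) (x : S) :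
    Module (S.presheaf.stalk x) (Stalk M x) :=
  letI M' : PresheafOfModules.{u} (S.presheaf ⋙ forget₂ CommRingCat RingCat) := M.val
  inferInstanceAs (Module (S.presheaf.stalk x) ↑(TopCat.Presheaf.stalk M'.presheaf x))

/-- The germ of a section of a sheaf of modules. -/
def secGerm {S : Scheme.{u}} (M : S.Modules) {x : S} {U : S.Opens} (hx : x ∈ U) (s : Γ(M, U)) :
    Stalk M x :=
  M.presheaf.germ U x hx s

/-- The restriction of a section of a sheaf of modules. -/
def resSec {S : Scheme.{u}} (M : S.Modules) {U V : S.Opens} (h : V ≤ U) (s : Γ(M, U)) : Γ(M, V) :=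
  M.presheaf.map (homOfLE h).op s

/-- The restriction of a function. -/
def resFun {S : Scheme.{u}} {U V : S.Opens} (h : V ≤ U) : Γ(S, U) →+* Γ(S, V) :=
  (S.presheaf.map (homOfLE h).op).hom

/-- The germ of a function. -/
def funGerm {S : Scheme.{u}} {x : S} {U : S.Opens} (hx : x ∈ U) : Γ(S, U) →+* S.presheaf.stalk x :=
  (S.presheaf.germ U x hx).hom

theorem secGerm_smul {S : Scheme.{u}} (M : S.Modules) {x : S} {U : S.Opens} (hx : x ∈ U)
    (r : Γ(S, U)) (m : Γ(M, U)) :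
    secGerm M hx (r • m) = funGerm hx r • secGerm M hx m :=
  letI M' : PresheafOfModules.{u} (S.presheaf ⋙ forget₂ CommRingCat RingCat) := M.val
  PresheafOfModules.germ_smul M' x U hx r m

theorem secGerm_add {S : Scheme.{u}} (M : S.Modules) {x : S} {U : S.Opens} (hx : x ∈ U)
    (m n : Γ(M, U)) : secGerm M hx (m + n) = secGerm M hx m + secGerm M hx n :=
  map_add (M.presheaf.germ U x hx).hom m n

theorem secGerm_zero {S : Scheme.{u}} (M : S.Modules) {x : S} {U : S.Opens} (hx : x ∈ U) :
    secGerm M hx (0 : Γ(M, U)) = 0 :=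
  map_zero (M.presheaf.germ U x hx).hom

theorem secGerm_sum {S : Scheme.{u}} (M : S.Modules) {x : S} {U : S.Opens} (hx : x ∈ U)
    {d : ℕ} (m : Fin d → Γ(M, U)) :
    secGerm M hx (∑ j, m j) = ∑ j, secGerm M hx (m j) :=
  map_sum (M.presheaf.germ U x hx).hom m _

theorem secGerm_res {S : Scheme.{u}} (M : S.Modules) {x : S} {U V : S.Opens} (h : V ≤ U)
    (hx : x ∈ V) (m : Γ(M, U)) : secGerm M hx (resSec M h m) = secGerm M (h hx) m :=
  TopCat.Presheaf.germ_res_apply M.presheaf (homOfLE h) x hx m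

theorem funGerm_res {S : Scheme.{u}} {x : S} {U V : S.Opens} (h : V ≤ U)
    (hx : x ∈ V) (m : Γ(S, U)) : funGerm hx (resFun h m) = funGerm (h hx) m :=
  TopCat.Presheaf.germ_res_apply S.presheaf (homOfLE h) x hx m

theorem resSec_smul {S : Scheme.{u}} (M : S.Modules) {U V : S.Opens} (h : V ≤ U)
    (r : Γ(S, U)) (m : Γ(M, U)) : resSec M h (r • m) = resFun h r • resSec M h m :=
  M.map_smul (homOfLE h) r m

theorem resSec_sum {S : Scheme.{u}} (M : S.Modules) {U V : S.Opens} (h : V ≤ U)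
    {d : ℕ} (m : Fin d → Γ(M, U)) : resSec M h (∑ j, m j) = ∑ j, resSec M h (m j) :=
  map_sum (M.presheaf.map (homOfLE h).op).hom m _

/-- Sections `e_0, …, e_{d-1}` of `M` over `U` form a frame if they induce an isomorphism
`𝒪_U ^ d ≅ M|_U`. -/
def IsFrame {S : Scheme.{u}} (M : S.Modules) {d : ℕ} (U : S.Opens) (e : Fin d → Γ(M, U)) : Prop :=
  ∀ (V : S.Opens) (h : V ≤ U), Function.Bijective
    fun c : Fin d → Γ(S, V) => ∑ j, c j • resSec M h (e j)

/-- A vector bundle of rank `d`: a sheaf of modules that is locally isomorphic to `𝒪 ^ d`. -/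
structure VectorBundle (S : Scheme.{u}) (d : ℕ) where
  sheaf : S.Modules
  locallyFree : ∀ x : S, ∃ U : S.Opens, x ∈ U ∧ ∃ e : Fin d → Γ(sheaf, U), IsFrame sheaf U e

/-- A complete flag `H = P^0 ⊇ P^1 ⊇ … ⊇ P^d = 0` of subbundles, indexed by codimension: subsheaves
of modules such that, locally on `S`, there is a frame `e` of `H` for which `P^a` is the free
submodule on `e_a, …, e_{d-1}`. -/
structure CompleteFlag {S : Scheme.{u}} {d : ℕ} (H : VectorBundle S d) where
  sub : Fin (d + 1) → (U : S.Opens) → Submodule Γ(S, U) Γ(H.sheaf, U)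
  res_mem : ∀ (a : Fin (d + 1)) {U V : S.Opens} (h : V ≤ U), ∀ s ∈ sub a U,
    resSec H.sheaf h s ∈ sub a V
  mem_of_locally : ∀ (a : Fin (d + 1)) (U : S.Opens) (s : Γ(H.sheaf, U)),
    (∀ x ∈ U, ∃ (V : S.Opens) (h : V ≤ U), x ∈ V ∧ resSec H.sheaf h s ∈ sub a V) → s ∈ sub a U
  adapted : ∀ x : S, ∃ U : S.Opens, x ∈ U ∧ ∃ e : Fin d → Γ(H.sheaf, U), IsFrame H.sheaf U e ∧
    ∀ (V : S.Opens) (h : V ≤ U) (a : Fin (d + 1)),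
      sub a V = tailFlag (fun j => resSec H.sheaf h (e j)) a

/-- The stalk at `x` of a complete flag. -/
def CompleteFlag.stalk {S : Scheme.{u}} {d : ℕ} {H : VectorBundle S d} (P : CompleteFlag H)
    (x : S) : Fin (d + 1) → Submodule (S.presheaf.stalk x) (Stalk H.sheaf x) :=
  fun a => Submodule.span _
    {w | ∃ (U : S.Opens) (hx : x ∈ U), ∃ s ∈ P.sub a U, w = secGerm H.sheaf hx s}

theorem IsFrame.linearIndependent {S : Scheme.{u}} {M : S.Modules} {d : ℕ} {U : S.Opens}
    {e : Fin d → Γ(M, U)} (he : IsFrame M U e) {x : S} (hx : x ∈ U) :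
    LinearIndependent (S.presheaf.stalk x) fun j => secGerm M hx (e j) := by
  rw [Fintype.linearIndependent_iff]
  intro c hc
  have h1 : ∀ j, ∃ (V : S.Opens) (hV : x ∈ V) (r : Γ(S, V)), funGerm hV r = c j :=
    fun j => TopCat.Presheaf.exists_germ_eq S.presheaf (c j)
  choose V hV r hr using h1
  obtain ⟨W, hW, hWU, hWV⟩ : ∃ W : S.Opens, x ∈ W ∧ W ≤ U ∧ ∀ j, W ≤ V j := by
    refine ⟨U ⊓ Finset.univ.inf V, ⟨hx, ?_⟩, inf_le_left,
      fun j => inf_le_right.trans (Finset.inf_le (Finset.mem_univ j))⟩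
    rw [TopologicalSpace.Opens.coe_finset_inf]
    simpa using hV
  have h2 : secGerm M hW (∑ j, resFun (hWV j) (r j) • resSec M hWU (e j)) =
      secGerm M hW (0 : Γ(M, W)) := by
    rw [secGerm_sum, secGerm_zero, ← hc]
    refine Finset.sum_congr rfl fun j _ => ?_
    rw [secGerm_smul, secGerm_res, funGerm_res, hr]
  obtain ⟨W', hW', i, i', h3⟩ := TopCat.Presheaf.germ_eq M.presheaf x hW hW _ _ h2
  have h4 : resSec M i.le (∑ j, resFun (hWV j) (r j) • resSec M hWU (e j)) = 0 :=
    h3.trans (map_zero (M.presheaf.map i'.op).hom)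
  have h5 := (he W' (i.le.trans hWU)).1
    (a₁ := fun j => resFun i.le (resFun (hWV j) (r j))) (a₂ := 0) (by
      simp only [Pi.zero_apply, zero_smul, Finset.sum_const_zero]
      rw [← h4, resSec_sum]
      refine Finset.sum_congr rfl fun j _ => ?_
      rw [resSec_smul]
      congr 1
      change M.presheaf.map _ _ = M.presheaf.map _ (M.presheaf.map _ _)
      rw [← ConcreteCategory.comp_apply, ← Functor.map_comp]
      rfl)
  intro j
  have h6 := congrArg (funGerm hW') (congrFun h5 j)
  rw [funGerm_res, funGerm_res, hr] at h6
  simpa using h6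

theorem IsFrame.top_le_span {S : Scheme.{u}} {M : S.Modules} {d : ℕ} {U : S.Opens}
    {e : Fin d → Γ(M, U)} (he : IsFrame M U e) {x : S} (hx : x ∈ U) :
    ⊤ ≤ Submodule.span (S.presheaf.stalk x) (Set.range fun j => secGerm M hx (e j)) := by
  rintro w -
  obtain ⟨V, hVU, hV, s, rfl⟩ := TopCat.Presheaf.exists_le_germ_eq M.presheaf w hx
  obtain ⟨c, rfl⟩ := (he V hVU).2 s
  change secGerm M hV _ ∈ _
  rw [secGerm_sum]
  refine Submodule.sum_mem _ fun j _ => ?_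
  rw [secGerm_smul, secGerm_res]
  exact Submodule.smul_mem _ _ (Submodule.subset_span ⟨j, rfl⟩)

/-- The basis of the stalk at `x` given by a frame around `x`. -/
def IsFrame.stalkBasis {S : Scheme.{u}} {M : S.Modules} {d : ℕ} {U : S.Opens}
    {e : Fin d → Γ(M, U)} (he : IsFrame M U e) {x : S} (hx : x ∈ U) :
    Module.Basis (Fin d) (S.presheaf.stalk x) (Stalk M x) :=
  Module.Basis.mk (he.linearIndependent hx) (he.top_le_span hx)

theorem CompleteFlag.isFlag_stalk {S : Scheme.{u}} {d : ℕ} {H : VectorBundle S d}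
    (P : CompleteFlag H) (x : S) : IsFlag (P.stalk x) := by
  obtain ⟨U, hx, e, he, hP⟩ := P.adapted x
  refine ⟨he.stalkBasis hx, ?_⟩
  have hb : ∀ j, he.stalkBasis hx j = secGerm H.sheaf hx (e j) := fun j =>
    Module.Basis.mk_apply _ _ j
  funext a
  apply le_antisymm
  · refine Submodule.span_le.mpr ?_
    rintro _ ⟨V, hV, s, hs, rfl⟩
    have h1 := P.res_mem a (inf_le_left : V ⊓ U ≤ V) s hs
    rw [hP (V ⊓ U) inf_le_right] at h1
    have hxW : x ∈ V ⊓ U := ⟨hV, hx⟩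
    rw [← secGerm_res H.sheaf (inf_le_left : V ⊓ U ≤ V) hxW]
    generalize resSec H.sheaf (inf_le_left : V ⊓ U ≤ V) s = t at h1
    change secGerm H.sheaf hxW t ∈ tailFlag (he.stalkBasis hx) a
    unfold tailFlag at h1
    induction h1 using Submodule.span_induction with
    | mem t ht =>
      obtain ⟨j, hj, rfl⟩ := ht
      rw [secGerm_res, ← hb]
      exact Submodule.subset_span ⟨j, hj, rfl⟩
    | zero =>
      rw [secGerm_zero]
      exact zero_mem _
    | add y z _ _ hy hz =>
      rw [secGerm_add]
      exact add_mem hy hz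
    | smul c y _ hy =>
      rw [secGerm_smul]
      exact Submodule.smul_mem _ _ hy
  · refine Submodule.span_le.mpr ?_
    rintro _ ⟨j, hj, rfl⟩
    rw [hb]
    have h1 : resSec H.sheaf le_rfl (e j) ∈ P.sub a U := by
      rw [hP U le_rfl]
      exact Submodule.subset_span ⟨j, hj, rfl⟩
    have h2 := secGerm_res H.sheaf (le_refl U) hx (e j)
    change secGerm H.sheaf hx (e j) ∈ _
    rw [← h2]
    exact Submodule.subset_span ⟨U, hx, _, h1, rfl⟩

/-- A frame of the bundle at `x`, i.e. the germ at `x` of a section of the frame bundle. -/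
def VectorBundle.frameAt {S : Scheme.{u}} {d : ℕ} (H : VectorBundle S d) (x : S) :
    Module.Basis (Fin d) (S.presheaf.stalk x) (Stalk H.sheaf x) :=
  (H.locallyFree x).choose_spec.2.choose_spec.stalkBasis (H.locallyFree x).choose_spec.1

end Bundles

/-! ### The frame bundle, the flag variety, and versality -/

section Versality

/-- A complete flag of subbundles of the trivial bundle `𝒪_T ^ d`, given by its stalks: locally on
`T` there is an invertible matrix `g` of functions such that the `a`-th member of the flag is
spanned by the rows `g_a, …, g_{d-1}`. -/
@[ext]
structure TrivialFlag (T : Scheme.{u}) (d : ℕ) where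
  fib : (t : T) → Fin (d + 1) → Submodule (T.presheaf.stalk t) (Fin d → T.presheaf.stalk t)
  adapted : ∀ t : T, ∃ U : T.Opens, t ∈ U ∧ ∃ g : Matrix (Fin d) (Fin d) Γ(T, U), IsUnit g ∧
    ∀ (t' : T) (h : t' ∈ U), fib t' = tailFlag fun i j => funGerm h (g i j)

theorem mapFlag_tailFlag {d : ℕ} {R R' : Type*} [CommRing R] [CommRing R'] (f : R →+* R')
    (g : Fin d → Fin d → R) : mapFlag f (tailFlag g) = tailFlag fun i j => f (g i j) := by
  funext a
  rw [mapFlag_span f (tailFlag g) a _ rfl, Set.image_image]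
  rfl

theorem stalkMap_funGerm {T T' : Scheme.{u}} (h : T' ⟶ T) {U : T.Opens} (t' : T')
    (ht : h t' ∈ U) (r : Γ(T, U)) :
    (h.stalkMap t').hom (funGerm ht r) =
      funGerm (U := h ⁻¹ᵁ U) (x := t') ht ((h.app U).hom r) :=
  Scheme.Hom.germ_stalkMap_apply h U t' ht r

/-- The pullback of a complete flag in the trivial bundle. -/
def TrivialFlag.pullback {T T' : Scheme.{u}} {d : ℕ} (h : T' ⟶ T) (F : TrivialFlag T d) :
    TrivialFlag T' d where
  fib t' := mapFlag (h.stalkMap t').hom (F.fib (h t'))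
  adapted t' := by
    obtain ⟨U, hU, g, hg, hF⟩ := F.adapted (h t')
    refine ⟨h ⁻¹ᵁ U, hU, g.map (h.app U).hom, hg.map (h.app U).hom.mapMatrix, ?_⟩
    intro t'' ht''
    rw [hF (h t'') ht'', mapFlag_tailFlag]
    congr 1
    funext i j
    exact stalkMap_funGerm h t'' ht'' (g i j)

/-- The functor of points of `Fl(d) ^ l`, the `l`-fold fibre power over `k` of the variety of
complete flags in `k ^ d`: a `T`-point is a morphism `T → Spec k` together with `l` complete flags of
subbundles of `𝒪_T ^ d`. -/
def flagVarietyPow (k : Type u) [Field k] (d l : ℕ) : Scheme.{u}ᵒᵖ ⥤ Type u where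
  obj T := (T.unop ⟶ Spec (.of k)) × (Fin l → TrivialFlag T.unop d)
  map h := ↾fun y => (h.unop ≫ y.1, fun i => (y.2 i).pullback h.unop)
  map_id T := by
    refine ConcreteCategory.hom_ext _ _ fun y => ?_
    refine Prod.ext (Category.id_comp y.1) ?_
    funext i
    ext1
    funext t
    change mapFlag ((𝟙 T.unop : T.unop ⟶ T.unop).stalkMap t).hom _ = _
    rw [Scheme.Hom.stalkMap_id]
    exact mapFlag_id _
  map_comp h h' := by
    refine ConcreteCategory.hom_ext _ _ fun y => ?_
    refine Prod.ext (Category.assoc h'.unop h.unop y.1) ?_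
    funext i
    ext1
    funext t
    change mapFlag ((h'.unop ≫ h.unop).stalkMap t).hom _ = mapFlag _ (mapFlag _ _)
    rw [Scheme.Hom.stalkMap_comp]
    exact mapFlag_comp _ _ _

/-- A `T`-point of the frame bundle of `H`: a morphism `b : T → S` and an isomorphism
`b^* H ≅ 𝒪_T ^ d`.  By adjunction the latter is an `𝒪_S`-linear map `coord : H → b_* 𝒪_T ^ d`; it
corresponds to an isomorphism iff it sends local frames of `H` to bases. -/
structure FramePoint {S : Scheme.{u}} {d : ℕ} (H : VectorBundle S d) (T : Scheme.{u}) where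
  base : T ⟶ S
  coord : (U : S.Opens) → Γ(H.sheaf, U) → Fin d → Γ(T, base ⁻¹ᵁ U)
  coord_add : ∀ U s s', coord U (s + s') = coord U s + coord U s'
  coord_smul : ∀ U (r : Γ(S, U)) s j, coord U (r • s) j = (base.app U).hom r * coord U s j
  coord_res : ∀ (U V : S.Opens) (h : V ≤ U) s j,
    coord V (resSec H.sheaf h s) j = resFun (base.preimage_mono h) (coord U s j)
  isUnit : ∀ (U : S.Opens) (e : Fin d → Γ(H.sheaf, U)), IsFrame H.sheaf U e →
    IsUnit (Matrix.of fun i j => coord U (e i) j)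

theorem FramePoint.ext' {S : Scheme.{u}} {d : ℕ} {H : VectorBundle S d} {T : Scheme.{u}}
    {y z : FramePoint H T} (hb : y.base = z.base)
    (hc : ∀ U s j (h : z.base ⁻¹ᵁ U ≤ y.base ⁻¹ᵁ U), resFun h (y.coord U s j) = z.coord U s j) :
    y = z := by
  obtain ⟨b, c, h1, h2, h3, h4⟩ := y
  obtain ⟨b', c', h1', h2', h3', h4'⟩ := z
  obtain rfl : b = b' := hb
  have : c = c' := by
    funext U s j
    refine Eq.trans ?_ (hc U s j le_rfl)
    change _ = T.presheaf.map (𝟙 _) _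
    simp
  subst this
  rfl

/-- The pullback of a point of the frame bundle. -/
def FramePoint.pullback {S : Scheme.{u}} {d : ℕ} {H : VectorBundle S d} {T T' : Scheme.{u}}
    (h : T' ⟶ T) (y : FramePoint H T) : FramePoint H T' where
  base := h ≫ y.base
  coord U s j := (h.app (y.base ⁻¹ᵁ U)).hom (y.coord U s j)
  coord_add U s s' := by
    funext j
    rw [y.coord_add]
    exact map_add _ _ _
  coord_smul U r s j := by
    rw [y.coord_smul, map_mul, Scheme.Hom.comp_app]
    rfl
  coord_res U V i s j := by
    rw [y.coord_res]
    exact congrArg (fun q => q.hom (y.coord U s j))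
      (h.naturality (homOfLE (y.base.preimage_mono i)).op)
  isUnit U e he :=
    (y.isUnit U e he).map (h.app (y.base ⁻¹ᵁ U)).hom.mapMatrix

/-- The functor of points of `Fr(H)|_W = Fr(H|_W)`, for an open subset `W` of `S`: the points of the
frame bundle of `H` lying over `W`. -/
def frameBundle {S : Scheme.{u}} {d : ℕ} (H : VectorBundle S d) (W : S.Opens) :
    Scheme.{u}ᵒᵖ ⥤ Type u where
  obj T := {y : FramePoint H T.unop // ∀ t, y.base t ∈ W}
  map h := ↾fun y => ⟨y.1.pullback h.unop, fun t => y.2 (h.unop t)⟩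
  map_id T := by
    refine ConcreteCategory.hom_ext _ _ fun y => ?_
    refine Subtype.ext (FramePoint.ext' (Category.id_comp y.1.base) ?_)
    intro U s j i
    change T.unop.presheaf.map (𝟙 _) _ = _
    simp
    rfl
  map_comp {T T' T''} h h' := by
    refine ConcreteCategory.hom_ext _ _ fun y => ?_
    refine Subtype.ext (FramePoint.ext' (Category.assoc h'.unop h.unop y.1.base) ?_)
    intro U s j i
    change T''.unop.presheaf.map (𝟙 _) (((h'.unop ≫ h.unop).app (y.1.base ⁻¹ᵁ U)).hom
      (y.1.coord U s j)) = ((h'.unop.app _).hom ((h.unop.app _).hom (y.1.coord U s j)))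
    simp
    rfl

/-- The flag in `𝒪_T ^ d` induced by a flag in `H` and a frame of `b^* H`, for `b : T → S`. -/
def FramePoint.flag {S : Scheme.{u}} {d : ℕ} {H : VectorBundle S d} {T : Scheme.{u}}
    (y : FramePoint H T) (P : CompleteFlag H) : TrivialFlag T d where
  fib t a := Submodule.span _ {w | ∃ (U : S.Opens) (ht : y.base t ∈ U), ∃ s ∈ P.sub a U,
    w = fun j => funGerm (U := y.base ⁻¹ᵁ U) (x := t) ht (y.coord U s j)}
  adapted t := by
    obtain ⟨U, hU, e, he, hP⟩ := P.adapted (y.base t)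
    refine ⟨y.base ⁻¹ᵁ U, hU, _, y.isUnit U e he, ?_⟩
    intro t' ht'
    funext a
    apply le_antisymm
    · refine Submodule.span_le.mpr ?_
      rintro _ ⟨V, hV, s, hs, rfl⟩
      have h1 := P.res_mem a (inf_le_left : V ⊓ U ≤ V) s hs
      rw [hP (V ⊓ U) inf_le_right] at h1
      have hW : t' ∈ y.base ⁻¹ᵁ (V ⊓ U) := ⟨hV, ht'⟩
      have h2 : (fun j => funGerm (U := y.base ⁻¹ᵁ V) (x := t') hV (y.coord V s j)) =
          fun j => funGerm hW (y.coord (V ⊓ U) (resSec H.sheaf inf_le_left s) j) := by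
        funext j
        rw [y.coord_res, funGerm_res]
      rw [h2]
      generalize resSec H.sheaf (inf_le_left : V ⊓ U ≤ V) s = r at h1
      change (fun j => funGerm hW (y.coord (V ⊓ U) r j)) ∈ tailFlag _ a
      unfold tailFlag at h1
      induction h1 using Submodule.span_induction with
      | mem r hr =>
        obtain ⟨i, hi, rfl⟩ := hr
        refine Submodule.subset_span ⟨i, hi, ?_⟩
        funext j
        change _ = funGerm hW (y.coord (V ⊓ U) (resSec H.sheaf inf_le_right (e i)) j)
        rw [y.coord_res, funGerm_res]
        rfl
      | zero =>
        have h0 : y.coord (V ⊓ U) 0 = 0 := by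
          have := y.coord_add (V ⊓ U) 0 0
          simpa using this
        rw [h0]
        convert zero_mem (tailFlag _ a) using 1
        funext j
        exact map_zero _
      | add r r' _ _ hr hr' =>
        rw [y.coord_add]
        convert add_mem hr hr' using 1
        funext j
        exact map_add _ _ _
      | smul c r _ hr =>
        convert Submodule.smul_mem _ (funGerm hW ((y.base.app (V ⊓ U)).hom c)) hr using 1
        funext j
        rw [y.coord_smul, map_mul]
        rfl
    · refine Submodule.span_le.mpr ?_
      rintro _ ⟨i, hi, rfl⟩
      refine Submodule.subset_span ⟨U, ht', resSec H.sheaf le_rfl (e i), ?_, ?_⟩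
      · rw [hP U le_rfl]
        exact Submodule.subset_span ⟨i, hi, rfl⟩
      · funext j
        rw [y.coord_res, funGerm_res]
        rfl

theorem FramePoint.flag_pullback {S : Scheme.{u}} {d : ℕ} {H : VectorBundle S d}
    {T T' : Scheme.{u}} (h : T' ⟶ T) (y : FramePoint H T) (P : CompleteFlag H) :
    (y.pullback h).flag P = (y.flag P).pullback h := by
  ext1
  funext t a
  symm
  refine (mapFlag_span (h.stalkMap t).hom ((y.flag P).fib (h t)) a _ rfl).trans ?_
  refine congrArg (Submodule.span _) ?_
  ext w
  constructor
  · rintro ⟨_, ⟨U, hU, s, hs, rfl⟩, rfl⟩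
    refine ⟨U, hU, s, hs, ?_⟩
    funext j
    exact stalkMap_funGerm h t hU _
  · rintro ⟨U, hU, s, hs, rfl⟩
    refine ⟨_, ⟨U, hU, s, hs, rfl⟩, ?_⟩
    funext j
    exact stalkMap_funGerm h t hU _

/-- The morphism `p : Fr(H|_W) → Fl(d) ^ l` induced by flags `P_1, …, P_l` in `H`, where `S` is a
scheme over `k` by `f`. -/
def frameToFlags {k : Type u} [Field k] {S : Scheme.{u}} (f : S ⟶ Spec (.of k)) {d l : ℕ}
    {H : VectorBundle S d} (P : Fin l → CompleteFlag H) (W : S.Opens) :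
    frameBundle H W ⟶ flagVarietyPow k d l where
  app T := ↾fun y => (y.1.base ≫ f, fun i => y.1.flag (P i))
  naturality T T' h := by
    ext y
    refine Prod.ext (Category.assoc _ _ _) ?_
    funext i
    exact FramePoint.flag_pullback h.unop y.1 (P i)

/-- The flags are versal over the open subset `W` if `p : Fr(H|_W) → Fl(d) ^ l` is a smooth
morphism (of functors of points: representable by schemes, with smooth base changes). -/
def IsVersalOn {k : Type u} [Field k] {S : Scheme.{u}} (f : S ⟶ Spec (.of k)) {d l : ℕ}
    {H : VectorBundle S d} (P : Fin l → CompleteFlag H) (W : S.Opens) : Prop :=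
  MorphismProperty.presheaf (fun _ _ g => Smooth g : MorphismProperty Scheme.{u})
    (frameToFlags f P W)

/-- The flags are versal at `x` if they are versal on some open neighbourhood of `x`. -/
def IsVersalAt {k : Type u} [Field k] {S : Scheme.{u}} (f : S ⟶ Spec (.of k)) {d l : ℕ}
    {H : VectorBundle S d} (P : Fin l → CompleteFlag H) (x : S) : Prop :=
  ∃ W : S.Opens, x ∈ W ∧ IsVersalOn f P W

/-- A scheme over `k` is smooth at `x` if it is smooth over `k` on some neighbourhood of `x`. -/
def IsSmoothAt {k : Type u} [Field k] {S : Scheme.{u}} (f : S ⟶ Spec (.of k)) (x : S) : Prop :=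
  ∃ W : S.Opens, x ∈ W ∧ Smooth (W.ι ≫ f)

end Versality

/-! ### The relative deformation map -/

section RelativeDeformation

/-- The structure homomorphism from `k` to the local ring at `x`. -/
def fieldToStalk {k : Type u} [Field k] {S : Scheme.{u}} (f : S ⟶ Spec (.of k)) (x : S) :
    k →+* S.presheaf.stalk x :=
  (S.presheaf.germ ⊤ x trivial).hom.comp (f.appTop.hom.comp (Scheme.ΓSpecIso (.of k)).inv.hom)

/-- The tangent space `T_x S = Der_k(𝒪_{S,x}, κ(x))` at a closed point of a scheme over an
algebraically closed field `k`. -/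
def tangentSpace {k : Type u} [Field k] {S : Scheme.{u}} (f : S ⟶ Spec (.of k)) (x : S) :
    Submodule (IsLocalRing.ResidueField (S.presheaf.stalk x))
      (Derivation ℤ (S.presheaf.stalk x) (IsLocalRing.ResidueField (S.presheaf.stalk x))) where
  carrier := {D | ∀ c : k, D (fieldToStalk f x c) = 0}
  add_mem' hD hD' c := by simp [hD c, hD' c]
  zero_mem' c := by simp
  smul_mem' a D hD c := by simp [hD c]

/-- The flag `(P)_x` in the fibre `H_x = κ(x) ⊗ H` of the bundle at `x`. -/
def CompleteFlag.fibre {S : Scheme.{u}} {d : ℕ} {H : VectorBundle S d} (P : CompleteFlag H)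
    (x : S) : Fin (d + 1) → Submodule (IsLocalRing.ResidueField (S.presheaf.stalk x))
      (IsLocalRing.ResidueField (S.presheaf.stalk x) ⊗[S.presheaf.stalk x] Stalk H.sheaf x) :=
  fibreFlag (P.stalk x)

/-- The relative deformation map `δ_x : T_x S → M(H_x; (P_1)_x, …, (P_l)_x)`: choose a section `s` of
the frame bundle near `x`, take the derivative at `x` of `p ∘ s : S → Fl(d) ^ l`, and pass to the
cokernel `M`.  By `relDeriv_eq` the choice does not matter. -/
def relDeformation {k : Type u} [Field k] {S : Scheme.{u}} (f : S ⟶ Spec (.of k)) {d l : ℕ}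
    {H : VectorBundle S d} (P : Fin l → CompleteFlag H) (x : S) :
    tangentSpace f x →ₗ[IsLocalRing.ResidueField (S.presheaf.stalk x)]
      RelDefSpace fun i => (P i).fibre x :=
  relDeriv (H.frameAt x) (fun i => (P i).isFlag_stalk x) ∘ₗ (tangentSpace f x).subtype

end RelativeDeformation

end RelFlag
end

noncomputable section

namespace RelFlag

/-! ### Flags spanned by the rows of an invertible matrix -/

section MatrixFlags

variable {d : ℕ} {R : Type*} [CommRing R]

/-! Around x choose an affine open U with coordinate ring A, a frame of H over U, and invertible
matrices g_i over A whose rows, read in the frame, span the flags (`exists_flagChart`). Flags of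
rows of G and H coincide iff G H⁻¹ is upper triangular (`tailFlag_eq_iff`), so the problem becomes
one about matrices. A C-point of the frame bundle over U is a pair of α : A → C and an invertible
matrix M over C, with associated flags spanned by the rows of α(g_i) M. Hence the fibre product with
a map Spec B → Fl(d)^l given by matrices K_i classifies triples (α, γ, M) with α(g_i) M γ(K_i)⁻¹
upper triangular. It is represented by an explicit finitely presented B-algebra
(`exists_universal_compatible`, `FlagChart.exists_isPullback`), and since every family of flags is
locally given by matrices, these local answers glue (`presheaf_of_locally`).

Smooth and surjective implies versal. In matrices, surjectivity of δ_x says that every tuple (E_i)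
over κ(x) equals, up to upper triangular matrices, δ(g_i) g_i⁻¹ + g_i N g_i⁻¹ for a k-derivation δ :
A → κ(x) and a matrix N. As A is smooth, finitely many such δ lift to vector fields on U, and
invertibility of one determinant spreads the property to a neighbourhood of x
(`exists_isTransversal_away`). There, a compatible triple lifts along any square-zero extension:
lift α and M arbitrarily, then cancel the strictly lower triangular error by adding a derivation to
α and replacing M by (1 + N) M (`IsTransversal.exists_lift`). This is formal smoothness of the
universal algebra.

Versal implies surjective. The tuple (1 + εE_i) g_i(x) is a tangent vector of Fl(d)^l. The base
change of p along it is smooth over κ(x)[ε] and has a κ(x)-point, so it has a section through that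
point, whose ε-part is the required pair (δ, N) (`relDeformation_surjective_of_isVersalOn`).

Versal implies smooth. Base change p along the universal tuple of invertible matrices, whose
parameter ring is smooth over k. The total space X is then smooth over k, and near x the scheme S is
a retract of it: the chosen frame gives a section of the projection from X to S. Retracts of
formally smooth algebras are formally smooth (`formallySmooth_of_retract`,
`isSmoothAt_of_isVersalOn`). -/

theorem mem_tailFlag_iff {G : Matrix (Fin d) (Fin d) R} (hG : IsUnit G) (a : Fin (d + 1))
    (v : Fin d → R) :
    v ∈ tailFlag (R := R) G a ↔ ∀ q : Fin d, (q : ℕ) < a → Matrix.vecMul v G⁻¹ q = 0 := by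
  have hdet := (Matrix.isUnit_iff_isUnit_det _).mp hG
  constructor
  · intro hv
    unfold tailFlag at hv
    induction hv using Submodule.span_induction with
    | mem w hw =>
      obtain ⟨j, hj, rfl⟩ := hw
      intro q hq
      have h1 : Matrix.vecMul (G j) G⁻¹ q = (G * G⁻¹) j q := rfl
      rw [h1, Matrix.mul_nonsing_inv _ hdet, Matrix.one_apply_ne]
      rintro rfl
      exact absurd hj (not_le.mpr hq)
    | zero => simp
    | add x y _ _ hx hy =>
      intro q hq
      rw [Matrix.add_vecMul, Pi.add_apply, hx q hq, hy q hq, add_zero]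
    | smul c x _ hx =>
      intro q hq
      rw [Matrix.smul_vecMul, Pi.smul_apply, hx q hq, smul_zero]
  · intro h
    have h1 : v = ∑ j, Matrix.vecMul v G⁻¹ j • G j := by
      rw [← Matrix.vecMul_eq_sum, Matrix.vecMul_vecMul, Matrix.nonsing_inv_mul _ hdet,
        Matrix.vecMul_one]
    rw [h1]
    refine Submodule.sum_mem _ fun j _ => ?_
    by_cases hj : (j : ℕ) < a
    · rw [h j hj, zero_smul]
      exact zero_mem _
    · exact Submodule.smul_mem _ _ (Submodule.subset_span ⟨j, not_lt.mp hj, rfl⟩)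

/-- Row p of G H⁻¹ holds the coordinates of row p of G in the basis of rows of H; triangularity says
that only rows of index at least p occur. -/
theorem tailFlag_le_of_blockTriangular {G H : Matrix (Fin d) (Fin d) R} (hH : IsUnit H)
    (h : (G * H⁻¹).BlockTriangular id) : tailFlag (R := R) G ≤ tailFlag H := by
  intro a
  refine Submodule.span_le.mpr ?_
  rintro _ ⟨p, hp, rfl⟩
  exact (mem_tailFlag_iff hH a _).mpr fun q hq => h (show q < p from hq.trans_le hp)

theorem blockTriangular_mul_inv {G H : Matrix (Fin d) (Fin d) R} (hH : IsUnit H)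
    (h : tailFlag (R := R) G ≤ tailFlag H) : (G * H⁻¹).BlockTriangular id := by
  intro p q hqp
  have h1 : G p ∈ tailFlag (R := R) G p.castSucc :=
    Submodule.subset_span ⟨p, show (p.castSucc : ℕ) ≤ p by simp, rfl⟩
  exact (mem_tailFlag_iff hH _ _).mp (h _ h1) q hqp

/-- Two invertible matrices have the same flag of rows iff they differ by a triangular matrix. -/
theorem tailFlag_eq_iff {G H : Matrix (Fin d) (Fin d) R} (hG : IsUnit G) (hH : IsUnit H) :
    tailFlag (R := R) G = tailFlag H ↔ (G * H⁻¹).BlockTriangular id := by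
  refine ⟨fun h => blockTriangular_mul_inv hH h.le, fun h => le_antisymm
    (tailFlag_le_of_blockTriangular hH h) (tailFlag_le_of_blockTriangular hG ?_)⟩
  have hu : IsUnit (G * H⁻¹) := hG.mul (by simpa using hH)
  let _ := hu.invertible
  have h2 := Matrix.blockTriangular_inv_of_blockTriangular h
  rwa [Matrix.mul_inv_rev, Matrix.nonsing_inv_nonsing_inv _
    ((Matrix.isUnit_iff_isUnit_det _).mp hH)] at h2

end MatrixFlags

/-! ### Derivatives of flags in terms of matrices -/

section MatrixDerivative

variable {d : ℕ} {R : Type*} [CommRing R] [IsLocalRing R] {N : Type*} [AddCommGroup N] [Module R N]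

local notation "κ" => IsLocalRing.ResidueField

/-- Translates the fibre of a flag into the row flag of the residue matrix, so that the
triangularity criteria apply to it. -/
theorem fibreFlag_tailFlag_mem_iff (e : Module.Basis (Fin d) R N)
    {g : Matrix (Fin d) (Fin d) R} {s : Fin d → N} (hs : ∀ p, s p = ∑ j, g p j • e j)
    (a : Fin (d + 1)) (w : κ R ⊗[R] N) :
    w ∈ fibreFlag (tailFlag (R := R) s) a ↔
      (fibreBasis e).equivFun w ∈
        tailFlag (R := κ R) (g.map (IsLocalRing.residue R)) a := by
  have h1 : fibreFlag (tailFlag (R := R) s) a =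
      Submodule.span (κ R) ((fun p => (1 : κ R) ⊗ₜ[R] s p) '' {j | (a : ℕ) ≤ (j : ℕ)}) := by
    unfold fibreFlag tailFlag
    rw [Submodule.baseChange_span, ← Set.image_image (fun x => (1 : κ R) ⊗ₜ[R] x) s]
    rfl
  have h2 : ∀ p, (fibreBasis e).equivFun ((1 : κ R) ⊗ₜ[R] s p) =
      (g.map (IsLocalRing.residue R)) p := by
    intro p
    funext j
    rw [fibreBasis_equivFun_tmul, hs p]
    simp [Finsupp.single_apply]
  have h3 : tailFlag (R := κ R) (g.map (IsLocalRing.residue R)) a =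
      (fibreFlag (tailFlag (R := R) s) a).map ((fibreBasis e).equivFun : _ →ₗ[κ R] _) := by
    rw [h1, Submodule.map_span, Set.image_image]
    unfold tailFlag
    congr 1
    ext v
    simp only [Set.mem_image]
    constructor
    · rintro ⟨p, hp, rfl⟩
      exact ⟨p, hp, h2 p⟩
    · rintro ⟨p, hp, rfl⟩
      exact ⟨p, hp, (h2 p).symm⟩
  rw [h3]
  constructor
  · intro hw
    exact ⟨w, hw, rfl⟩
  · rintro ⟨w', hw', h⟩
    rwa [← (fibreBasis e).equivFun.injective h]

/-- The matrix of an endomorphism of the fibre, acting on row vectors. -/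
def rowMatrix (e : Module.Basis (Fin d) R N) (φ : Module.End (κ R) (κ R ⊗[R] N)) :
    Matrix (Fin d) (Fin d) (κ R) :=
  (LinearMap.toMatrix (fibreBasis e) (fibreBasis e) φ).transpose

theorem equivFun_apply_eq_vecMul (e : Module.Basis (Fin d) R N)
    (φ : Module.End (κ R) (κ R ⊗[R] N)) (w : κ R ⊗[R] N) :
    (fibreBasis e).equivFun (φ w) =
      Matrix.vecMul ((fibreBasis e).equivFun w) (rowMatrix e φ) := by
  rw [rowMatrix, Matrix.vecMul_transpose]
  exact (LinearMap.toMatrix_mulVec_repr (fibreBasis e) (fibreBasis e) φ w).symm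

theorem rowMatrix_surjective (e : Module.Basis (Fin d) R N) :
    Function.Surjective (rowMatrix e) := fun M =>
  ⟨(LinearMap.toMatrix (fibreBasis e) (fibreBasis e)).symm M.transpose, by simp [rowMatrix]⟩

theorem rowMatrix_sub (e : Module.Basis (Fin d) R N) (φ ψ : Module.End (κ R) (κ R ⊗[R] N)) :
    rowMatrix e (φ - ψ) = rowMatrix e φ - rowMatrix e ψ :=
  congrArg Matrix.transpose (map_sub (LinearMap.toMatrix (fibreBasis e) (fibreBasis e)) φ ψ)

variable (e : Module.Basis (Fin d) R N) {g : Matrix (Fin d) (Fin d) R} {s : Fin d → N}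

theorem isUnit_map_residue (hg : IsUnit g) : IsUnit (g.map (IsLocalRing.residue R)) :=
  hg.map (IsLocalRing.residue R).mapMatrix

/-- In the basis formed by the rows of the residue matrix G, the endomorphism φ has row matrix G Φ
G⁻¹, and preserving all tails of a basis means being triangular in it. -/
theorem fixFlag_iff (hg : IsUnit g) (hs : ∀ p, s p = ∑ j, g p j • e j)
    (φ : Module.End (κ R) (κ R ⊗[R] N)) :
    φ ∈ fixFlag (fibreFlag (tailFlag (R := R) s)) ↔
      (g.map (IsLocalRing.residue R) * rowMatrix e φ *
        (g.map (IsLocalRing.residue R))⁻¹).BlockTriangular id := by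
  have hu := isUnit_map_residue hg
  set G := g.map (IsLocalRing.residue R) with hG
  have hrow : ∀ p, ∃ w, (fibreBasis e).equivFun w = G p := fun p =>
    (fibreBasis e).equivFun.surjective (G p)
  constructor
  · intro h
    refine blockTriangular_mul_inv hu fun a => ?_
    refine Submodule.span_le.mpr ?_
    rintro _ ⟨p, hp, rfl⟩
    obtain ⟨w, hw⟩ := hrow p
    have h1 : w ∈ fibreFlag (tailFlag (R := R) s) a := by
      rw [fibreFlag_tailFlag_mem_iff e hs, hw]
      exact Submodule.subset_span ⟨p, hp, rfl⟩
    have h2 := h a w h1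
    rw [fibreFlag_tailFlag_mem_iff e hs, equivFun_apply_eq_vecMul, hw] at h2
    exact h2
  · intro h a w hw
    rw [fibreFlag_tailFlag_mem_iff e hs] at hw ⊢
    rw [equivFun_apply_eq_vecMul]
    generalize (fibreBasis e).equivFun w = v at hw
    unfold tailFlag at hw
    induction hw using Submodule.span_induction with
    | mem v hv =>
      obtain ⟨p, hp, rfl⟩ := hv
      exact tailFlag_le_of_blockTriangular hu h a (Submodule.subset_span ⟨p, hp, rfl⟩)
    | zero => simp
    | add x y _ _ hx hy =>
      rw [Matrix.add_vecMul]
      exact add_mem hx hy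
    | smul c x _ hx =>
      rw [Matrix.smul_vecMul]
      exact Submodule.smul_mem _ _ hx

/-- By the Leibniz rule the condition of `isDeriv_iff` need only be tested on the generators s_p,
because the extra term D(c) · s(x) already lies in the fibre of the flag. On s_p the vector to be
tested has row p of D(g) − ḡ Φ as its coordinates. -/
theorem isDeriv_tailFlag_iff (hg : IsUnit g) (hs : ∀ p, s p = ∑ j, g p j • e j)
    (D : Derivation ℤ R (κ R)) (φ : Module.End (κ R) (κ R ⊗[R] N)) :
    IsDeriv e D (tailFlag (R := R) s) φ ↔
      ((g.map D - g.map (IsLocalRing.residue R) * rowMatrix e φ) *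
        (g.map (IsLocalRing.residue R))⁻¹).BlockTriangular id := by
  have hu := isUnit_map_residue hg
  have hrow : ∀ p, (fibreBasis e).equivFun (conn e D (s p) - φ (1 ⊗ₜ[R] s p)) =
      (g.map D - g.map (IsLocalRing.residue R) * rowMatrix e φ) p := by
    intro p
    have h1 : e.equivFun (s p) = g p := by
      funext j
      rw [hs p]
      simp [Finsupp.single_apply]
    rw [map_sub, equivFun_apply_eq_vecMul]
    congr 1
    · unfold conn
      rw [LinearEquiv.apply_symm_apply, h1]
      rfl
    · have : (fibreBasis e).equivFun ((1 : κ R) ⊗ₜ[R] s p) =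
          (g.map (IsLocalRing.residue R)) p := by
        funext j
        rw [fibreBasis_equivFun_tmul, h1]
        rfl
      rw [this]
      rfl
  rw [isDeriv_iff]
  constructor
  · intro h
    refine blockTriangular_mul_inv hu fun a => ?_
    refine Submodule.span_le.mpr ?_
    rintro _ ⟨p, hp, rfl⟩
    have h1 := h a (s p) (Submodule.subset_span ⟨p, hp, rfl⟩)
    rw [fibreFlag_tailFlag_mem_iff e hs, hrow] at h1
    exact h1
  · intro h a t ht
    unfold tailFlag at ht
    induction ht using Submodule.span_induction with
    | mem t ht =>
      obtain ⟨p, hp, rfl⟩ := ht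
      rw [fibreFlag_tailFlag_mem_iff e hs, hrow]
      exact tailFlag_le_of_blockTriangular hu h a (Submodule.subset_span ⟨p, hp, rfl⟩)
    | zero => simp [conn, show (fun _ : Fin d => (0 : κ R)) = 0 from rfl]
    | add x y _ _ hx hy =>
      rw [conn_add, TensorProduct.tmul_add, map_add, add_sub_add_comm]
      exact add_mem hx hy
    | smul c x hx' hx =>
      have h1 : (1 : κ R) ⊗ₜ[R] (c • x) = IsLocalRing.residue R c • ((1 : κ R) ⊗ₜ[R] x) := by
        rw [TensorProduct.tmul_smul]
        exact (algebraMap_smul (κ R) c _).symm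
      rw [conn_smul, h1, map_smul, add_sub_right_comm, ← fibre_smul_sub]
      exact add_mem (Submodule.smul_mem _ _ hx)
        (Submodule.smul_mem _ _ (Submodule.tmul_mem_baseChange_of_mem 1 hx'))

variable {l : ℕ} {G : Fin l → Matrix (Fin d) (Fin d) R} {t : Fin l → Fin d → N}

/-- Surjectivity of the relative deformation map in terms of matrices. -/
theorem relDeriv_surjective_iff (hG : ∀ i, IsUnit (G i))
    (ht : ∀ i p, t i p = ∑ j, G i p j • e j)
    {Q : Fin l → Fin (d + 1) → Submodule R N} (hQ : ∀ i, IsFlag (Q i))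
    (hQt : ∀ i, Q i = tailFlag (t i))
    (T : Submodule (κ R) (Derivation ℤ R (κ R))) :
    Function.Surjective (relDeriv e hQ ∘ₗ T.subtype) ↔
      ∀ E : Fin l → Matrix (Fin d) (Fin d) (κ R), ∃ D ∈ T, ∃ A : Matrix (Fin d) (Fin d) (κ R),
        ∀ i, ((G i).map D * ((G i).map (IsLocalRing.residue R))⁻¹ +
          (G i).map (IsLocalRing.residue R) * A * ((G i).map (IsLocalRing.residue R))⁻¹ -
            E i).BlockTriangular id := by
  obtain rfl : Q = fun i => tailFlag (t i) := funext hQt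
  have hdet : ∀ i, IsUnit ((G i).map (IsLocalRing.residue R)).det := fun i =>
    (Matrix.isUnit_iff_isUnit_det _).mp (isUnit_map_residue (hG i))
  have key : ∀ (D : Derivation ℤ R (κ R)) (φ : Fin l → Module.End (κ R) (κ R ⊗[R] N)),
      relDeriv e hQ D = (LinearMap.range (diagonalMap fun i => fibreFlag (tailFlag (t i)))).mkQ
        (fun i => FlagTangent.mk _ (φ i)) ↔
      ∃ A : Matrix (Fin d) (Fin d) (κ R),
        ∀ i, ((G i).map D * ((G i).map (IsLocalRing.residue R))⁻¹ +
          (G i).map (IsLocalRing.residue R) * A * ((G i).map (IsLocalRing.residue R))⁻¹ -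
            (G i).map (IsLocalRing.residue R) * rowMatrix e (φ i) *
              ((G i).map (IsLocalRing.residue R))⁻¹).BlockTriangular id := by
    intro D φ
    choose ψ hψ using fun i => exists_isDeriv e D (hQ i)
    have h1 : relDeriv e hQ D =
        (LinearMap.range (diagonalMap fun i => fibreFlag (tailFlag (t i)))).mkQ
          (fun i => FlagTangent.mk _ (ψ i)) := by
      refine congrArg (LinearMap.range
        (diagonalMap fun i => fibreFlag (tailFlag (t i)))).mkQ ?_
      funext i
      exact flagDeriv_eq e (hQ i) D (hψ i)
    have h2 : relDeriv e hQ D = (LinearMap.range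
          (diagonalMap fun i => fibreFlag (tailFlag (t i)))).mkQ
          (fun i => FlagTangent.mk _ (φ i)) ↔
        ∃ ν : Module.End (κ R) (κ R ⊗[R] N), ∀ i,
          ν - (φ i - ψ i) ∈ fixFlag (fibreFlag (tailFlag (R := R) (t i))) := by
      rw [h1, eq_comm]
      refine (Submodule.Quotient.eq _).trans ?_
      refine exists_congr fun ν => ?_
      refine funext_iff.trans (forall_congr' fun i => ?_)
      exact Submodule.Quotient.eq (fixFlag (fibreFlag (tailFlag (t i))))
        (x := ν) (y := φ i - ψ i)
    rw [h2]
    have h3 : (∃ A : Matrix (Fin d) (Fin d) (κ R),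
        ∀ i, ((G i).map D * ((G i).map (IsLocalRing.residue R))⁻¹ +
          (G i).map (IsLocalRing.residue R) * A * ((G i).map (IsLocalRing.residue R))⁻¹ -
            (G i).map (IsLocalRing.residue R) * rowMatrix e (φ i) *
              ((G i).map (IsLocalRing.residue R))⁻¹).BlockTriangular id) ↔
        ∃ ν : Module.End (κ R) (κ R ⊗[R] N),
        ∀ i, ((G i).map D * ((G i).map (IsLocalRing.residue R))⁻¹ +
          (G i).map (IsLocalRing.residue R) * rowMatrix e ν *
            ((G i).map (IsLocalRing.residue R))⁻¹ -
            (G i).map (IsLocalRing.residue R) * rowMatrix e (φ i) *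
              ((G i).map (IsLocalRing.residue R))⁻¹).BlockTriangular id :=
      (rowMatrix_surjective e).exists
    rw [h3]
    refine exists_congr fun ν => forall_congr' fun i => ?_
    rw [fixFlag_iff e (hG i) (ht i)]
    -- The two matrices to be compared differ by (D(g) − ḡ ψ) ḡ⁻¹, which is triangular because ψ
    -- represents the derivative.
    have h4 := (isDeriv_tailFlag_iff e (hG i) (ht i) D (ψ i)).mp (hψ i)
    rw [rowMatrix_sub, rowMatrix_sub]
    constructor
    · intro h
      refine cast (congrArg (fun M => Matrix.BlockTriangular M id) ?_) (h4.add h)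
      noncomm_ring
    · intro h
      refine cast (congrArg (fun M => Matrix.BlockTriangular M id) ?_) (h.sub h4)
      noncomm_ring
  constructor
  · intro h E
    -- For this φ_i the conjugate ḡ φ_i ḡ⁻¹ appearing in `key` is exactly E_i.
    have h1 : ∀ i, ∃ φ, rowMatrix e φ = ((G i).map (IsLocalRing.residue R))⁻¹ * E i *
        (G i).map (IsLocalRing.residue R) := fun i => rowMatrix_surjective e _
    choose φ hφ using h1
    obtain ⟨⟨D, hD⟩, hD'⟩ := h ((LinearMap.range
          (diagonalMap fun i => fibreFlag (tailFlag (t i)))).mkQ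
          (fun i => FlagTangent.mk _ (φ i)))
    obtain ⟨A, hA⟩ := (key D φ).mp hD'
    refine ⟨D, hD, A, fun i => ?_⟩
    convert hA i using 2
    rw [hφ, ← Matrix.mul_assoc, Matrix.mul_assoc _ ((G i).map (IsLocalRing.residue R)),
      Matrix.mul_nonsing_inv _ (hdet i), Matrix.mul_one, ← Matrix.mul_assoc,
      Matrix.mul_nonsing_inv _ (hdet i), Matrix.one_mul]
  · intro h y
    obtain ⟨z, rfl⟩ := Submodule.mkQ_surjective _ y
    choose φ hφ using fun i => Submodule.mkQ_surjective _ (z i)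
    obtain rfl : (fun i => FlagTangent.mk _ (φ i)) = z := funext hφ
    obtain ⟨D, hD, A, hA⟩ := h fun i => (G i).map (IsLocalRing.residue R) * rowMatrix e (φ i) *
      ((G i).map (IsLocalRing.residue R))⁻¹
    exact ⟨⟨D, hD⟩, (key D φ).mpr ⟨A, hA⟩⟩

end MatrixDerivative

/-! ### Representability is Zariski local on the target -/

section Gluing

/-- Limits of presheaves of sets are computed objectwise, so being cartesian is a statement about
pairs of sections. -/
theorem isPullback_presheaf_iff {C : Type*} [Category C] {E F Y G : Cᵒᵖ ⥤ Type u} {p : E ⟶ F}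
    {q : E ⟶ Y} {φ : F ⟶ G} {g : Y ⟶ G} :
    IsPullback p q φ g ↔ p ≫ φ = q ≫ g ∧ ∀ T : Cᵒᵖ,
      (∀ a b : E.obj T, p.app T a = p.app T b → q.app T a = q.app T b → a = b) ∧
      ∀ (a : F.obj T) (b : Y.obj T), φ.app T a = g.app T b →
        ∃ c : E.obj T, p.app T c = a ∧ q.app T c = b := by
  constructor
  · intro h
    refine ⟨h.w, fun T => ?_⟩
    have hT := h.map ((evaluation Cᵒᵖ (Type u)).obj T)
    exact ⟨fun a b h1 h2 => Limits.Types.ext_of_isPullback hT h1 h2,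
      fun a b h => Limits.Types.exists_of_isPullback hT a b h⟩
  · rintro ⟨w, h⟩
    refine ⟨⟨w⟩, ⟨Limits.evaluationJointlyReflectsLimits _ fun T => ?_⟩⟩
    have hT : IsPullback (p.app T) (q.app T) (φ.app T) (g.app T) :=
      (Limits.Types.isPullback_iff _ _ _ _).mpr ⟨congrArg (fun α => α.app T) w,
        fun a b hab => (h T).1 a b hab.1 hab.2, (h T).2⟩
    exact (Limits.isLimitMapConePullbackConeEquiv ((evaluation Cᵒᵖ (Type u)).obj T) w).symm
      hT.isLimit

/-- A fibre product of sheaves over a separated presheaf is a sheaf. -/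
theorem isSheaf_of_isPullback {C : Type*} [Category C] (J : GrothendieckTopology C)
    {E F Y G : Cᵒᵖ ⥤ Type u} {p : E ⟶ F} {q : E ⟶ Y} {φ : F ⟶ G} {g : Y ⟶ G}
    (h : IsPullback p q φ g) (hF : Presieve.IsSheaf J F) (hY : Presieve.IsSheaf J Y)
    (hG : Presieve.IsSeparated J G) : Presieve.IsSheaf J E := by
  obtain ⟨w, h⟩ := isPullback_presheaf_iff.mp h
  have hw : ∀ (T : Cᵒᵖ) (a : E.obj T), φ.app T (p.app T a) = g.app T (q.app T a) :=
    fun T a => congrArg (fun α => α.app T a) w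
  intro T S hS
  rw [← Presieve.isSeparatedFor_and_exists_isAmalgamation_iff_isSheafFor]
  constructor
  · intro x a b ha hb
    refine (h _).1 a b ?_ ?_
    · refine (hF S hS).isSeparatedFor.ext fun T' f hf => ?_
      rw [← NatTrans.naturality_apply p, ← NatTrans.naturality_apply p, ha f hf, hb f hf]
    · refine (hY S hS).isSeparatedFor.ext fun T' f hf => ?_
      rw [← NatTrans.naturality_apply q, ← NatTrans.naturality_apply q, ha f hf, hb f hf]
  · intro x hx
    obtain ⟨a, ha⟩ := ((hF S hS) (fun T' f hf => p.app _ (x f hf)) (by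
      intro Y₁ Y₂ Z g₁ g₂ f₁ f₂ h₁ h₂ e
      change F.map _ (p.app _ _) = F.map _ (p.app _ _)
      rw [← NatTrans.naturality_apply p, ← NatTrans.naturality_apply p, hx g₁ g₂ h₁ h₂ e])).exists
    obtain ⟨b, hb⟩ := ((hY S hS) (fun T' f hf => q.app _ (x f hf)) (by
      intro Y₁ Y₂ Z g₁ g₂ f₁ f₂ h₁ h₂ e
      change Y.map _ (q.app _ _) = Y.map _ (q.app _ _)
      rw [← NatTrans.naturality_apply q, ← NatTrans.naturality_apply q, hx g₁ g₂ h₁ h₂ e])).exists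
    -- The amalgamations a and b have equal images locally. Only uniqueness of gluing in G enters
    -- here, which is why G may be merely separated.
    have hab : φ.app _ a = g.app _ b := by
      refine (hG S hS).ext fun T' f hf => ?_
      rw [← NatTrans.naturality_apply φ, ← NatTrans.naturality_apply g, ha f hf, hb f hf, hw]
    obtain ⟨c, rfl, rfl⟩ := (h _).2 a b hab
    refine ⟨c, fun T' f hf => (h _).1 _ _ ?_ ?_⟩
    · rw [NatTrans.naturality_apply p, ha f hf]
    · rw [NatTrans.naturality_apply q, hb f hf]

theorem sieve_mem_zariskiTopology {T : Scheme.{u}} (S : Sieve T)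
    (h : ∀ x : T, ∃ (T' : Scheme.{u}) (j : T' ⟶ T), IsOpenImmersion j ∧ x ∈ Set.range j ∧ S j) :
    S ∈ Scheme.zariskiTopology T := by
  choose T' j hj hx hS using h
  let U : T.OpenCover := Scheme.Cover.mkOfCovers T T' j (fun x => ⟨x, hx x⟩) hj
  refine GrothendieckTopology.superset_covering _ ?_ U.mem_grothendieckTopology
  rintro Y _ ⟨_, a, _, ⟨i⟩, rfl⟩
  exact S.downward_closed (hS i) a

/-- A morphism from a sheaf to a separated presheaf has the property `Q` if, Zariski locally on the
target, it is representable with the property `Q`. -/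
theorem presheaf_of_locally (Q : MorphismProperty Scheme.{u}) [IsZariskiLocalAtTarget Q]
    {F G : Scheme.{u}ᵒᵖ ⥤ Type u} (φ : F ⟶ G)
    (hF : Presieve.IsSheaf Scheme.zariskiTopology F)
    (hG : Presieve.IsSeparated Scheme.zariskiTopology G)
    (h : ∀ (T : Scheme.{u}) (g : yoneda.obj T ⟶ G) (x : T), ∃ (T' : Scheme.{u}) (j : T' ⟶ T),
      IsOpenImmersion j ∧ x ∈ Set.range j ∧ ∃ (X : Scheme.{u}) (p : yoneda.obj X ⟶ F)
        (q : X ⟶ T'), IsPullback p (yoneda.map q) φ (yoneda.map j ≫ g) ∧ Q q) :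
    MorphismProperty.presheaf Q φ := by
  refine MorphismProperty.relative.of_exists fun T g => ?_
  choose T' j hj hx X p q hpq hq using h T g
  -- The presheaf fibre product E is a Zariski sheaf. It will be covered by the representable pieces
  -- X x, each lying over an open piece of T.
  have hE := IsPullback.of_hasPullback φ g
  set E := Limits.pullback φ g
  let E' : Sheaf Scheme.zariskiTopology.{u} (Type u) := ⟨E, by
    rw [isSheaf_iff_isSheaf_of_type]
    exact isSheaf_of_isPullback _ hE hF
      (GrothendieckTopology.Subcanonical.isSheaf_of_isRepresentable _) hG⟩
  let c : (x : T) → (yoneda.obj (X x) ⟶ E'.1) := fun x =>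
    hE.lift (p x) (yoneda.map (q x ≫ j x)) (by rw [(hpq x).w, yoneda.map_comp, Category.assoc])
  have hc : ∀ x, IsPullback (c x) (yoneda.map (q x)) (Limits.pullback.snd φ g)
      (yoneda.map (j x)) := fun x =>
    IsPullback.of_right (by rw [hE.lift_fst]; exact hpq x)
      (by rw [hE.lift_snd, yoneda.map_comp]) hE
  -- Each c x is a base change of the open immersion j x, hence an open subfunctor of E.
  have hco : ∀ x, MorphismProperty.presheaf @IsOpenImmersion (c x) := fun x =>
    (MorphismProperty.relative_isStableUnderBaseChange (F := yoneda)
      @IsOpenImmersion).of_isPullback (hc x).flip (MorphismProperty.relative_map (hj x))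
  have hsurj : Presheaf.IsLocallySurjective Scheme.zariskiTopology (Limits.Sigma.desc c) := by
    constructor
    intro Y s
    refine sieve_mem_zariskiTopology _ fun y => ?_
    let t : Y ⟶ T := (Limits.pullback.snd φ g).app _ s
    have := hj (t y)
    refine ⟨Limits.pullback t (j (t y)), Limits.pullback.fst t (j (t y)), inferInstance, ?_, ?_⟩
    · rw [IsOpenImmersion.range_pullbackFst]
      exact hx (t y)
    · obtain ⟨z, hz, -⟩ := ((isPullback_presheaf_iff.mp (hc (t y))).2
        (op (Limits.pullback t (j (t y))))).2 (E.map (Limits.pullback.fst t (j (t y))).op s)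
        (Limits.pullback.snd t (j (t y))) (by
          rw [NatTrans.naturality_apply]
          exact Limits.pullback.condition (f := t) (g := j (t y)))
      refine ⟨(Limits.Sigma.ι (fun x => yoneda.obj (X x)) (t y)).app _ z, ?_⟩
      rw [← hz]
      exact congrArg (fun α => α.app _ z) (Limits.Sigma.ι_desc c (t y))
  -- A Zariski sheaf covered by open representable subfunctors is representable.
  obtain ⟨⟨Z, ⟨r⟩⟩⟩ := Scheme.LocalRepresentability.isRepresentable (F := E') (f := c) hco
  let iso : yoneda.obj Z ≅ E := Functor.representableByEquiv r
  obtain ⟨s, hs⟩ := yoneda.map_surjective (iso.hom ≫ Limits.pullback.snd φ g)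
  have hZ : IsPullback (iso.hom ≫ Limits.pullback.fst φ g) (yoneda.map s) φ g := by
    rw [hs]
    exact hE.of_iso iso.symm (Iso.refl _) (Iso.refl _) (Iso.refl _) (by simp) (by simp) (by simp)
      (by simp)
  refine ⟨Z, _, s, hZ, ?_⟩
  let U : T.OpenCover := Scheme.Cover.mkOfCovers T T' j (fun x => ⟨x, hx x⟩) hj
  refine IsZariskiLocalAtTarget.of_openCover U fun x => ?_
  obtain ⟨a, ha⟩ := yoneda.map_surjective (c x ≫ iso.inv)
  have h1 : IsPullback (yoneda.map a) (yoneda.map (q x)) (yoneda.map s) (yoneda.map (j x)) := by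
    rw [ha, hs]
    exact (hc x).of_iso (Iso.refl _) iso.symm (Iso.refl _) (Iso.refl _) (by simp) (by simp)
      (by simp) (by simp)
  -- Over the open piece j x the representing morphism s restricts to q x, so s has the property Q
  -- because Q is local on the target.
  have h2 : IsPullback a (q x) s (j x) := IsPullback.of_map yoneda
    (yoneda.map_injective (by simpa using h1.w)) h1
  have h3 : IsPullback (Limits.pullback.fst s (j x)) (Limits.pullback.snd s (j x)) s (j x) :=
    IsPullback.of_hasPullback _ _
  exact (Q.arrow_mk_iso_iff (Arrow.isoMk (h3.isoIsPullback _ _ h2) (Iso.refl _)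
    ((h3.isoIsPullback_hom_snd _ _ h2).trans (Category.comp_id _).symm))).mpr (hq x)

end Gluing

/-! ### Frames and coordinates -/

section Frames

variable {S : Scheme.{u}}

theorem resSec_resSec (M : S.Modules) {U V W : S.Opens} (h : V ≤ U) (h' : W ≤ V) (s : Γ(M, U)) :
    resSec M h' (resSec M h s) = resSec M (h'.trans h) s := by
  change M.presheaf.map _ (M.presheaf.map _ _) = M.presheaf.map _ _
  rw [← ConcreteCategory.comp_apply, ← Functor.map_comp]
  rfl

theorem resSec_self (M : S.Modules) {U : S.Opens} (h : U ≤ U) (s : Γ(M, U)) :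
    resSec M h s = s := by
  change M.presheaf.map (𝟙 _) _ = _
  simp

theorem resSec_add (M : S.Modules) {U V : S.Opens} (h : V ≤ U) (s t : Γ(M, U)) :
    resSec M h (s + t) = resSec M h s + resSec M h t :=
  map_add (M.presheaf.map (homOfLE h).op).hom s t

theorem resFun_resFun {U V W : S.Opens} (h : V ≤ U) (h' : W ≤ V) (s : Γ(S, U)) :
    resFun h' (resFun h s) = resFun (h'.trans h) s := by
  change S.presheaf.map _ (S.presheaf.map _ _) = S.presheaf.map _ _
  rw [← ConcreteCategory.comp_apply, ← Functor.map_comp]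
  rfl

theorem resFun_self {U : S.Opens} (h : U ≤ U) (s : Γ(S, U)) : resFun h s = s := by
  change S.presheaf.map (𝟙 _) _ = _
  simp

/-- The two inclusions force U = V. This is used for open sets that agree without being given by the
same expression, such as the preimages of V and V ⊓ U under a morphism landing in U. -/
theorem resFun_injective {U V : S.Opens} (h : V ≤ U) (h' : U ≤ V) :
    Function.Injective (resFun h) := by
  intro s t hst
  have := congrArg (resFun h') hst
  rwa [resFun_resFun, resFun_resFun, resFun_self, resFun_self] at this

theorem app_resFun {T : Scheme.{u}} (b : T ⟶ S) {U V : S.Opens} (h : V ≤ U) (r : Γ(S, U)) :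
    (b.app V).hom (resFun h r) = resFun (b.preimage_mono h) ((b.app U).hom r) :=
  congrArg (fun q => q.hom r) (b.naturality (homOfLE h).op)

variable {M : S.Modules} {d : ℕ} {U : S.Opens} {e : Fin d → Γ(M, U)}

theorem IsFrame.restrict (he : IsFrame M U e) {V : S.Opens} (h : V ≤ U) :
    IsFrame M V fun j => resSec M h (e j) := by
  intro W h'
  simp only [resSec_resSec]
  exact he W (h'.trans h)

/-- The coordinates with respect to a frame. -/
def IsFrame.coords (he : IsFrame M U e) {V : S.Opens} (h : V ≤ U) :
    Γ(M, V) ≃ₗ[Γ(S, V)] (Fin d → Γ(S, V)) :=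
  (LinearEquiv.ofBijective
    { toFun := fun c => ∑ j, c j • resSec M h (e j)
      map_add' := fun c c' => by simp [add_smul, Finset.sum_add_distrib]
      map_smul' := fun r c => by simp [mul_smul, Finset.smul_sum] } (he V h)).symm

theorem IsFrame.sum_coords (he : IsFrame M U e) {V : S.Opens} (h : V ≤ U) (s : Γ(M, V)) :
    ∑ j, he.coords h s j • resSec M h (e j) = s :=
  (he.coords h).symm_apply_apply s

theorem IsFrame.coords_sum (he : IsFrame M U e) {V : S.Opens} (h : V ≤ U)
    (c : Fin d → Γ(S, V)) : he.coords h (∑ j, c j • resSec M h (e j)) = c :=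
  (he.coords h).apply_symm_apply c

theorem IsFrame.coords_res (he : IsFrame M U e) {V W : S.Opens} (h : V ≤ U) (h' : W ≤ V)
    (s : Γ(M, V)) (j : Fin d) :
    he.coords (h'.trans h) (resSec M h' s) j = resFun h' (he.coords h s j) := by
  have h1 : resSec M h' s =
      ∑ j, resFun h' (he.coords h s j) • resSec M (h'.trans h) (e j) := by
    conv_lhs => rw [← he.sum_coords h s, resSec_sum]
    simp only [resSec_smul, resSec_resSec]
  rw [h1, he.coords_sum]

/-- A frame as a basis. -/
def IsFrame.basis (he : IsFrame M U e) {V : S.Opens} (h : V ≤ U) :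
    Module.Basis (Fin d) Γ(S, V) Γ(M, V) :=
  Module.Basis.ofEquivFun (he.coords h)

theorem IsFrame.basis_apply (he : IsFrame M U e) {V : S.Opens} (h : V ≤ U) (j : Fin d) :
    he.basis h j = resSec M h (e j) := by
  unfold IsFrame.basis
  rw [Module.Basis.coe_ofEquivFun, LinearEquiv.symm_apply_eq]
  have := he.coords_sum h (Pi.single j 1)
  simp only [Pi.single_apply, ite_smul, one_smul, zero_smul, Finset.sum_ite_eq',
    Finset.mem_univ, if_true] at this
  rw [this]

/-- The matrix expressing one frame in terms of another one is invertible. -/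
theorem IsFrame.isUnit_coords (he : IsFrame M U e) {V : S.Opens} {e' : Fin d → Γ(M, V)}
    (he' : IsFrame M V e') {W : S.Opens} (h : W ≤ U) (h' : W ≤ V) :
    IsUnit (Matrix.of fun i j => he.coords h (resSec M h' (e' i)) j) := by
  have h1 : (Matrix.of fun i j => he.coords h (resSec M h' (e' i)) j) =
      ((he.basis h).toMatrix (he'.basis h')).transpose := by
    ext i j
    rw [Matrix.transpose_apply, Module.Basis.toMatrix_apply, he'.basis_apply]
    simp [IsFrame.basis]
  rw [h1, Matrix.isUnit_transpose]
  let _ := (he.basis h).invertibleToMatrix (he'.basis h')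
  exact isUnit_of_invertible _

end Frames

/-! ### Charts -/

section Charts

variable {S : Scheme.{u}} {d l : ℕ} {H : VectorBundle S d}

/-- An affine open subset with a frame of `H`, in which the flags are given by the rows of
invertible matrices. -/
structure FlagChart (P : Fin l → CompleteFlag H) where
  U : S.Opens
  affine : IsAffineOpen U
  e : Fin d → Γ(H.sheaf, U)
  frame : IsFrame H.sheaf U e
  g : Fin l → Matrix (Fin d) (Fin d) Γ(S, U)
  isUnit : ∀ i, IsUnit (g i)
  adapted : ∀ i (V : S.Opens) (h : V ≤ U) (a : Fin (d + 1)), (P i).sub a V =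
    tailFlag (fun p => resSec H.sheaf h (∑ j, g i p j • e j)) a

variable {P : Fin l → CompleteFlag H}

/-- The restriction of a chart. -/
def FlagChart.restrict (c : FlagChart P) {V : S.Opens} (hV : IsAffineOpen V) (h : V ≤ c.U) :
    FlagChart P where
  U := V
  affine := hV
  e j := resSec H.sheaf h (c.e j)
  frame := c.frame.restrict h
  g i := (c.g i).map (resFun h)
  isUnit i := (c.isUnit i).map (resFun h).mapMatrix
  adapted i W h' a := by
    rw [c.adapted i W (h'.trans h) a]
    congr 1
    funext p
    rw [← resSec_resSec _ h h', resSec_sum]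
    simp only [resSec_smul]
    rfl

/-- Shrink to an affine open contained in a trivializing neighbourhood of H and in an adapted
neighbourhood of each flag; g_i then records the adapted frame of P_i in the fixed frame e, and is
invertible as a change of frame. -/
theorem exists_flagChart (P : Fin l → CompleteFlag H) (W : S.Opens) (x : S) (hx : x ∈ W) :
    ∃ c : FlagChart P, x ∈ c.U ∧ c.U ≤ W := by
  obtain ⟨U, hU, e, he⟩ := H.locallyFree x
  choose V hV e' he' hP using fun i => (P i).adapted x
  let O : S.Opens := (W ⊓ U) ⊓ Finset.univ.inf V
  have hO : x ∈ O := by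
    refine ⟨⟨hx, hU⟩, ?_⟩
    rw [TopologicalSpace.Opens.coe_finset_inf]
    simpa using hV
  obtain ⟨A, hA, hxA, hAO⟩ := TopologicalSpace.Opens.isBasis_iff_nbhd.mp S.isBasis_affineOpens hO
  have hAU : A ≤ U := hAO.trans (inf_le_left.trans inf_le_right)
  have hAV : ∀ i, A ≤ V i := fun i =>
    hAO.trans (inf_le_right.trans (Finset.inf_le (Finset.mem_univ i)))
  refine ⟨{ U := A
            affine := hA
            e := fun j => resSec H.sheaf hAU (e j)
            frame := he.restrict hAU
            g := fun i => Matrix.of fun p j => he.coords hAU (resSec H.sheaf (hAV i) (e' i p)) j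
            isUnit := fun i => he.isUnit_coords (he' i) hAU (hAV i)
            adapted := ?_ }, hxA, hAO.trans (inf_le_left.trans inf_le_left)⟩
  intro i B h a
  rw [hP i B (h.trans (hAV i)) a]
  congr 1
  funext p
  simp only [Matrix.of_apply]
  rw [he.sum_coords hAU, resSec_resSec]

/-- The invertible matrices defining the flags at the stalk. -/
theorem FlagChart.stalk_eq (c : FlagChart P) {x : S} (hx : x ∈ c.U) (i : Fin l) :
    (P i).stalk x = tailFlag (fun p => ∑ j, (c.g i).map (funGerm hx) p j •
      c.frame.stalkBasis hx j) := by
  have hb : ∀ p, ∑ j, (c.g i).map (funGerm hx) p j • c.frame.stalkBasis hx j =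
      secGerm H.sheaf hx (∑ j, c.g i p j • c.e j) := by
    intro p
    rw [secGerm_sum]
    refine Finset.sum_congr rfl fun j _ => ?_
    rw [secGerm_smul]
    exact congrArg _ (Module.Basis.mk_apply _ _ j)
  funext a
  apply le_antisymm
  · refine Submodule.span_le.mpr ?_
    rintro _ ⟨V, hV, s, hs, rfl⟩
    have h1 := (P i).res_mem a (inf_le_left : V ⊓ c.U ≤ V) s hs
    rw [c.adapted i (V ⊓ c.U) inf_le_right] at h1
    have hxW : x ∈ V ⊓ c.U := ⟨hV, hx⟩
    rw [← secGerm_res H.sheaf (inf_le_left : V ⊓ c.U ≤ V) hxW]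
    generalize resSec H.sheaf (inf_le_left : V ⊓ c.U ≤ V) s = t at h1
    change secGerm H.sheaf hxW t ∈ tailFlag _ a
    unfold tailFlag at h1
    induction h1 using Submodule.span_induction with
    | mem t ht =>
      obtain ⟨p, hp, rfl⟩ := ht
      rw [secGerm_res, ← hb]
      exact Submodule.subset_span ⟨p, hp, rfl⟩
    | zero =>
      rw [secGerm_zero]
      exact zero_mem _
    | add y z _ _ hy hz =>
      rw [secGerm_add]
      exact add_mem hy hz
    | smul r y _ hy =>
      rw [secGerm_smul]
      exact Submodule.smul_mem _ _ hy
  · refine Submodule.span_le.mpr ?_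
    rintro _ ⟨p, hp, rfl⟩
    refine Submodule.subset_span ⟨c.U, hx, ∑ j, c.g i p j • c.e j, ?_, hb p⟩
    rw [c.adapted i c.U le_rfl]
    refine Submodule.subset_span ⟨p, hp, ?_⟩
    exact resSec_self _ _ _

end Charts

/-! ### Points of the frame bundle in a chart -/

section FramePoints

variable {S : Scheme.{u}} {d : ℕ} {H : VectorBundle S d} {T : Scheme.{u}} {U : S.Opens}
  {e : Fin d → Γ(H.sheaf, U)}

/-- The matrix of a point of the frame bundle with respect to a frame. -/
def FramePoint.mat (y : FramePoint H T) (hy : ⊤ ≤ y.base ⁻¹ᵁ U) (e : Fin d → Γ(H.sheaf, U)) :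
    Matrix (Fin d) (Fin d) Γ(T, ⊤) :=
  Matrix.of fun j m => resFun hy (y.coord U (e j) m)

theorem FramePoint.isUnit_mat (y : FramePoint H T) (hy : ⊤ ≤ y.base ⁻¹ᵁ U)
    (he : IsFrame H.sheaf U e) : IsUnit (y.mat hy e) :=
  (y.isUnit U e he).map (resFun hy).mapMatrix

theorem FramePoint.coord_zero (y : FramePoint H T) (V : S.Opens) : y.coord V 0 = 0 := by
  have := y.coord_add V 0 0
  simpa using this

theorem FramePoint.coord_sum (y : FramePoint H T) (V : S.Opens) {ι : Type*} (s : Finset ι)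
    (t : ι → Γ(H.sheaf, V)) : y.coord V (∑ i ∈ s, t i) = ∑ i ∈ s, y.coord V (t i) :=
  map_sum (⟨⟨y.coord V, y.coord_zero V⟩, y.coord_add V⟩ : _ →+ _) t s

/-- By linearity the coordinates are determined by their values on a frame. Over U, a point of the
frame bundle is therefore the same as its base together with an invertible matrix;
`FramePoint.ext_mat` and `FramePoint.ofMat` give the two directions. -/
theorem FramePoint.coord_eq (y : FramePoint H T) (hy : ⊤ ≤ y.base ⁻¹ᵁ U)
    (he : IsFrame H.sheaf U e) {V : S.Opens} (h : V ≤ U) (s : Γ(H.sheaf, V)) (m : Fin d) :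
    y.coord V s m = ∑ j, (y.base.app V).hom (he.coords h s j) *
      resFun le_top (y.mat hy e j m) := by
  conv_lhs => rw [← he.sum_coords h s, y.coord_sum, Finset.sum_apply]
  refine Finset.sum_congr rfl fun j _ => ?_
  rw [y.coord_smul, y.coord_res]
  congr 1
  exact (resFun_resFun _ _ _).symm

theorem FramePoint.ext_mat {y z : FramePoint H T} (hy : ⊤ ≤ y.base ⁻¹ᵁ U)
    (hz : ⊤ ≤ z.base ⁻¹ᵁ U) (he : IsFrame H.sheaf U e) (hb : y.base = z.base)
    (hm : y.mat hy e = z.mat hz e) : y = z := by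
  refine FramePoint.ext' hb fun V s m h => ?_
  -- The frame exists only over U, so V is replaced by V ⊓ U; the preimage does not change because
  -- the base lands in U.
  have hle : z.base ⁻¹ᵁ V ≤ z.base ⁻¹ᵁ (V ⊓ U) := fun t ht => ⟨ht, hz trivial⟩
  apply resFun_injective (z.base.preimage_mono (inf_le_left : V ⊓ U ≤ V)) hle
  rw [resFun_resFun, ← z.coord_res]
  have hle' : y.base ⁻¹ᵁ V ≤ y.base ⁻¹ᵁ (V ⊓ U) := fun t ht => ⟨ht, hy trivial⟩
  have h2 := y.coord_res V (V ⊓ U) inf_le_left s m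
  have h3 : z.base ⁻¹ᵁ (V ⊓ U) ≤ y.base ⁻¹ᵁ (V ⊓ U) := by rw [hb]
  have h4 := congrArg (resFun h3) h2
  rw [resFun_resFun] at h4
  rw [← h4, y.coord_eq hy he inf_le_right, z.coord_eq hz he inf_le_right, map_sum]
  refine Finset.sum_congr rfl fun j _ => ?_
  rw [map_mul, resFun_resFun, hm]
  congr 1
  have : ∀ (b : T ⟶ S) (_ : b = z.base) (h : z.base ⁻¹ᵁ (V ⊓ U) ≤ b ⁻¹ᵁ (V ⊓ U))
      (r : Γ(S, V ⊓ U)), resFun h ((b.app (V ⊓ U)).hom r) = (z.base.app (V ⊓ U)).hom r := by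
    rintro b rfl h r
    exact resFun_self _ _
  exact this _ hb _ _

theorem preimage_le_preimage_inf {b : T ⟶ S} (hb : ⊤ ≤ b ⁻¹ᵁ U) (V : S.Opens) :
    b ⁻¹ᵁ V ≤ b ⁻¹ᵁ (V ⊓ U) :=
  fun _ ht => ⟨ht, hb trivial⟩

/-- The point of the frame bundle with given base and matrix. -/
def FramePoint.ofMat (b : T ⟶ S) (hb : ⊤ ≤ b ⁻¹ᵁ U) (he : IsFrame H.sheaf U e)
    (A : Matrix (Fin d) (Fin d) Γ(T, ⊤)) (hA : IsUnit A) : FramePoint H T where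
  base := b
  -- A section over V is restricted to V ⊓ U, expanded there in the frame, and multiplied by A; the
  -- result lives over the preimage of V since b lands in U.
  coord V s m := resFun (preimage_le_preimage_inf hb V)
    (∑ j, (b.app (V ⊓ U)).hom (he.coords inf_le_right (resSec H.sheaf inf_le_left s) j) *
      resFun le_top (A j m))
  coord_add V s s' := by
    funext m
    rw [Pi.add_apply, ← map_add, ← Finset.sum_add_distrib]
    congr 1
    refine Finset.sum_congr rfl fun j _ => ?_
    rw [resSec_add, map_add, Pi.add_apply, map_add, add_mul]
  coord_smul V r s m := by
    have h1 : (b.app V).hom r = resFun (preimage_le_preimage_inf hb V)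
        ((b.app (V ⊓ U)).hom (resFun inf_le_left r)) := by
      rw [app_resFun, resFun_resFun, resFun_self]
    rw [h1, ← map_mul, Finset.mul_sum]
    congr 1
    refine Finset.sum_congr rfl fun j _ => ?_
    rw [resSec_smul, map_smul, Pi.smul_apply, smul_eq_mul, map_mul, mul_assoc]
  coord_res V W h s m := by
    have hi : W ⊓ U ≤ V ⊓ U := inf_le_inf_right _ h
    simp only [map_sum, map_mul, resFun_resFun]
    refine Finset.sum_congr rfl fun j _ => ?_
    congr 1
    rw [resSec_resSec]
    have h1 := he.coords_res (inf_le_right : V ⊓ U ≤ U) hi (resSec H.sheaf inf_le_left s) j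
    rw [resSec_resSec] at h1
    have h2 := congrArg (b.app (W ⊓ U)).hom h1
    rw [app_resFun] at h2
    refine (congrArg (resFun _) h2).trans ?_
    rw [resFun_resFun]
  isUnit V e' he' := by
    have h1 := ((he.isUnit_coords he' (inf_le_right : V ⊓ U ≤ U) inf_le_left).map
      (b.app (V ⊓ U)).hom.mapMatrix).mul (hA.map (resFun (le_top : b ⁻¹ᵁ (V ⊓ U) ≤ ⊤)).mapMatrix)
    exact h1.map (resFun (preimage_le_preimage_inf hb V)
       ).mapMatrix

theorem FramePoint.ofMat_mat (b : T ⟶ S) (hb : ⊤ ≤ b ⁻¹ᵁ U) (he : IsFrame H.sheaf U e)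
    (A : Matrix (Fin d) (Fin d) Γ(T, ⊤)) (hA : IsUnit A) :
    (FramePoint.ofMat b hb he A hA).mat (U := U) hb e = A := by
  ext j m
  have h1 : ∀ i, he.coords (inf_le_right : U ⊓ U ≤ U) (resSec H.sheaf inf_le_left (e j)) i =
      (Pi.single j 1 : Fin d → Γ(S, U ⊓ U)) i := by
    intro i
    have := he.coords_sum (inf_le_right : U ⊓ U ≤ U) (Pi.single j 1)
    simp only [Pi.single_apply, ite_smul, one_smul, zero_smul, Finset.sum_ite_eq',
      Finset.mem_univ, if_true] at this
    rw [this]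
  change resFun _ (resFun _ (∑ i, _)) = _
  simp only [h1, map_sum, map_mul]
  rw [Finset.sum_eq_single j]
  · simp only [Pi.single_eq_same, map_one, one_mul]
    exact (congrArg (resFun hb) (resFun_resFun _ _ _)).trans
      ((resFun_resFun _ _ _).trans (resFun_self _ _))
  · intro i _ hi
    simp [hi]
  · simp

theorem FramePoint.pullback_mat {T' : Scheme.{u}} (h : T' ⟶ T) (y : FramePoint H T)
    (hy : ⊤ ≤ y.base ⁻¹ᵁ U) (hy' : ⊤ ≤ (y.pullback h).base ⁻¹ᵁ U) (e : Fin d → Γ(H.sheaf, U)) :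
    (y.pullback h).mat hy' e = (y.mat hy e).map h.appTop.hom := by
  ext j m
  exact (app_resFun h hy _).symm

end FramePoints

/-! ### The universal frame compatible with given flags -/

section UniversalFrame

variable {d l : ℕ} {k A B : Type u} [CommRing k] [CommRing A] [CommRing B]

theorem map_nonsing_inv {R R' : Type*} [CommRing R] [CommRing R'] (f : R →+* R')
    {G : Matrix (Fin d) (Fin d) R} (hG : IsUnit G) : (G.map f)⁻¹ = G⁻¹.map f := by
  refine Matrix.inv_eq_right_inv ?_
  rw [← Matrix.map_mul, Matrix.mul_nonsing_inv _ ((Matrix.isUnit_iff_isUnit_det _).mp hG)]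
  exact map_one f.mapMatrix

/-- A point of `Spec A × GL_d × Spec B` at which the flags given by `g` and by the inverses of the
matrices `L` agree. -/
structure IsCompatible (iA : k →+* A) (iB : k →+* B) (g : Fin l → Matrix (Fin d) (Fin d) A)
    (L : Fin l → Matrix (Fin d) (Fin d) B) {C : Type*} [CommRing C] (α : A →+* C) (γ : B →+* C)
    (M : Matrix (Fin d) (Fin d) C) : Prop where
  comp_eq : α.comp iA = γ.comp iB
  isUnit : IsUnit M
  triangular : ∀ i, ((g i).map α * M * (L i).map γ).BlockTriangular id

theorem IsCompatible.comp {iA : k →+* A} {iB : k →+* B} {g : Fin l → Matrix (Fin d) (Fin d) A}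
    {L : Fin l → Matrix (Fin d) (Fin d) B} {C C' : Type*} [CommRing C] [CommRing C']
    {α : A →+* C} {γ : B →+* C} {M : Matrix (Fin d) (Fin d) C}
    (h : IsCompatible iA iB g L α γ M) (ψ : C →+* C') :
    IsCompatible iA iB g L (ψ.comp α) (ψ.comp γ) (M.map ψ) where
  comp_eq := by rw [RingHom.comp_assoc, h.comp_eq, RingHom.comp_assoc]
  isUnit := h.isUnit.map ψ.mapMatrix
  triangular i := by
    have h1 : (g i).map (ψ.comp α) * M.map ψ * (L i).map (ψ.comp γ) =
        ((g i).map α * M * (L i).map γ).map ψ := by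
      rw [Matrix.map_mul, Matrix.map_mul, Matrix.map_map, Matrix.map_map]
      rfl
    rw [h1]
    intro p q hpq
    rw [Matrix.map_apply, h.triangular i hpq, map_zero]

/-- The universal compatible point exists and is finitely presented over `B`. -/
theorem exists_universal_compatible (iA : k →+* A) (iB : k →+* B) (hA : iA.FinitePresentation)
    (g : Fin l → Matrix (Fin d) (Fin d) A) (L : Fin l → Matrix (Fin d) (Fin d) B) :
    ∃ (Q : CommRingCat.{u}) (α₀ : A →+* Q) (γ₀ : B →+* Q) (M₀ : Matrix (Fin d) (Fin d) Q),
      IsCompatible iA iB g L α₀ γ₀ M₀ ∧ γ₀.FinitePresentation ∧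
      ∀ (C : Type u) [CommRing C] (α : A →+* C) (γ : B →+* C) (M : Matrix (Fin d) (Fin d) C),
        IsCompatible iA iB g L α γ M →
          ∃! ψ : Q →+* C, ψ.comp α₀ = α ∧ ψ.comp γ₀ = γ ∧ M₀.map ψ = M := by
  let _ := iA.toAlgebra
  let _ := iB.toAlgebra
  have : Algebra.FinitePresentation k A := hA
  let AB := B ⊗[k] A
  -- One set of variables for the entries of M, a second one for the entries of its inverse.
  let σ := (Fin d × Fin d) ⊕ (Fin d × Fin d)
  let Poly := MvPolynomial σ AB
  let X : Matrix (Fin d) (Fin d) Poly := Matrix.of fun p q => MvPolynomial.X (Sum.inl (p, q))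
  let Y : Matrix (Fin d) (Fin d) Poly := Matrix.of fun p q => MvPolynomial.X (Sum.inr (p, q))
  let a : A →+* Poly := MvPolynomial.C.comp (Algebra.TensorProduct.includeRight : A →ₐ[k] AB)
  let b : B →+* Poly := MvPolynomial.C.comp
    (Algebra.TensorProduct.includeLeftRingHom : B →+* AB)
  -- The relations are X Y = 1 and the vanishing of all strictly lower triangular entries of g_i X
  -- L_i. There are finitely many, which keeps the quotient finitely presented over B.
  let rel : (Fin d × Fin d) ⊕ (Fin l × {x : Fin d × Fin d // x.2 < x.1}) → Poly :=
    Sum.elim (fun x => (X * Y - 1) x.1 x.2)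
      (fun x => ((g x.1).map a * X * (L x.1).map b) x.2.1.1 x.2.1.2)
  let J : Ideal Poly := Ideal.span (Set.range rel)
  have hJ : J.FG := ⟨(Set.finite_range rel).toFinset, by simp [J]⟩
  let π : Poly →+* (Poly ⧸ J) := Ideal.Quotient.mk J
  have hrel : ∀ x, π (rel x) = 0 := fun x =>
    Ideal.Quotient.eq_zero_iff_mem.mpr (Ideal.subset_span ⟨x, rfl⟩)
  have hXY : X.map π * Y.map π = 1 := by
    rw [← Matrix.map_mul]
    ext p q
    have h1 := hrel (Sum.inl (p, q))
    have h2 : rel (Sum.inl (p, q)) = (X * Y) p q - (1 : Matrix (Fin d) (Fin d) Poly) p q := rfl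
    rw [h2, map_sub, sub_eq_zero] at h1
    rw [Matrix.map_apply, h1, Matrix.one_apply, Matrix.one_apply]
    split_ifs <;> simp
  refine ⟨CommRingCat.of (Poly ⧸ J), π.comp a, π.comp b, X.map π, ⟨?_, ?_, ?_⟩, ?_, ?_⟩
  · ext c
    have h1 : (Algebra.TensorProduct.includeRight : A →ₐ[k] AB) (iA c) =
        (Algebra.TensorProduct.includeLeftRingHom : B →+* AB) (iB c) := by
      have h2 := (Algebra.TensorProduct.includeRight : A →ₐ[k] AB).commutes c
      have h3 := (Algebra.TensorProduct.includeLeft : B →ₐ[k] AB).commutes c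
      exact h2.trans h3.symm
    exact congrArg (fun z => π (MvPolynomial.C z)) h1
  · exact (Matrix.isUnit_iff_isUnit_det _).mpr (Matrix.isUnit_det_of_right_inverse hXY)
  · intro i p q hpq
    have h1 := hrel (Sum.inr (i, ⟨(p, q), hpq⟩))
    have h2 : (g i).map (π.comp a) * X.map π * (L i).map (π.comp b) =
        ((g i).map a * X * (L i).map b).map π := by
      rw [Matrix.map_mul, Matrix.map_mul, Matrix.map_map, Matrix.map_map]
      rfl
    rw [h2]
    exact h1
  · have h1 : Algebra.FinitePresentation B AB := inferInstance
    have h2 : Algebra.FinitePresentation B Poly := inferInstance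
    have h3 : Algebra.FinitePresentation B (Poly ⧸ J) := Algebra.FinitePresentation.quotient hJ
    exact RingHom.finitePresentation_algebraMap.mpr h3
  · intro C _ α γ M hM
    have hdet := (Matrix.isUnit_iff_isUnit_det _).mp hM.isUnit
    let _ := (γ.comp iB).toAlgebra
    let α' : A →ₐ[k] C := ⟨α, fun c => RingHom.congr_fun hM.comp_eq c⟩
    let γ' : B →ₐ[k] C := ⟨γ, fun c => rfl⟩
    let val : σ → C := Sum.elim (fun x => M x.1 x.2) (fun x => M⁻¹ x.1 x.2)
    let ψ₀ : Poly →+* C :=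
      MvPolynomial.eval₂Hom (Algebra.TensorProduct.productMap γ' α' : AB →+* C) val
    have hψa : ψ₀.comp a = α := by
      refine RingHom.ext fun z => (MvPolynomial.eval₂Hom_C _ _ _).trans ?_
      exact Algebra.TensorProduct.productMap_right_apply γ' α' z
    have hψb : ψ₀.comp b = γ := by
      refine RingHom.ext fun z => (MvPolynomial.eval₂Hom_C _ _ _).trans ?_
      exact Algebra.TensorProduct.productMap_left_apply γ' α' z
    have hψX : X.map ψ₀ = M := by
      ext p q
      exact MvPolynomial.eval₂Hom_X' _ _ _
    have hψY : Y.map ψ₀ = M⁻¹ := by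
      ext p q
      exact MvPolynomial.eval₂Hom_X' _ _ _
    have hψJ : ∀ z ∈ J, ψ₀ z = 0 := by
      intro z hz
      have : J ≤ RingHom.ker ψ₀ := by
        refine Ideal.span_le.mpr ?_
        rintro _ ⟨x | x, rfl⟩
        · have h1 : ψ₀ (rel (Sum.inl x)) = ((X * Y - 1).map ψ₀) x.1 x.2 := rfl
          have h2 : (X * Y - 1).map ψ₀ = 0 := by
            rw [Matrix.map_sub _ (map_sub ψ₀), Matrix.map_mul, hψX, hψY,
              Matrix.mul_nonsing_inv _ hdet, sub_eq_zero]
            exact (map_one ψ₀.mapMatrix).symm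
          change ψ₀ _ = 0
          rw [h1, h2]
          rfl
        · have h1 : ψ₀ (rel (Sum.inr x)) =
              (((g x.1).map a * X * (L x.1).map b).map ψ₀) x.2.1.1 x.2.1.2 := rfl
          have h2 : ((g x.1).map a * X * (L x.1).map b).map ψ₀ =
              (g x.1).map α * M * (L x.1).map γ := by
            rw [Matrix.map_mul, Matrix.map_mul, Matrix.map_map, Matrix.map_map, hψX,
              ← RingHom.coe_comp, ← RingHom.coe_comp, hψa, hψb]
          change ψ₀ _ = 0
          rw [h1, h2]
          exact hM.triangular x.1 x.2.2
      exact this hz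
    refine ⟨Ideal.Quotient.lift J ψ₀ hψJ, ⟨?_, ?_, ?_⟩, ?_⟩
    · rw [← hψa]
      rfl
    · rw [← hψb]
      rfl
    · rw [Matrix.map_map, ← hψX]
      rfl
    · rintro ψ ⟨h1, h2, h3⟩
      refine Ideal.Quotient.ringHom_ext ?_
      -- The relation X Y = 1 leaves no choice for the image of Y, so the variables of the inverse
      -- do not spoil uniqueness.
      have h4 : Y.map (ψ.comp π) = M⁻¹ := by
        symm
        refine Matrix.inv_eq_right_inv ?_
        rw [← h3, RingHom.coe_comp, ← Matrix.map_map, ← Matrix.map_mul, hXY]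
        exact map_one ψ.mapMatrix
      have h5 : X.map (ψ.comp π) = M := by
        rw [← h3, Matrix.map_map]
        rfl
      refine Eq.trans (b := ψ₀) (MvPolynomial.ringHom_ext ?_ ?_) (by ext z <;> rfl)
      · intro z
        induction z using TensorProduct.induction_on with
        | zero => simp
        | add x y hx hy => simp only [map_add, hx, hy]
        | tmul x y =>
          have e1 : (x ⊗ₜ[k] y : AB) = (Algebra.TensorProduct.includeLeftRingHom : B →+* AB) x *
              (Algebra.TensorProduct.includeRight : A →ₐ[k] AB) y := by simp
          rw [e1, map_mul, map_mul, map_mul]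
          congr 1
          · exact (RingHom.congr_fun h2 x).trans (RingHom.congr_fun hψb x).symm
          · exact (RingHom.congr_fun h1 y).trans (RingHom.congr_fun hψa y).symm
      · rintro (⟨p, q⟩ | ⟨p, q⟩)
        · exact congrFun (congrFun (h5.trans hψX.symm) p) q
        · exact congrFun (congrFun (h4.trans hψY.symm) p) q

end UniversalFrame

/-! ### Transversality and formal smoothness -/

section Transversality

variable {d l : ℕ} {k A B : Type u} [CommRing k] [CommRing A] [CommRing B]

/-- Every first-order deformation of the flags given by `g` is induced, up to a change of the
frame, by a vector field. -/
def IsTransversal (iA : k →+* A) (g : Fin l → Matrix (Fin d) (Fin d) A) : Prop :=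
  ∀ E : Fin l → Matrix (Fin d) (Fin d) A, ∃ D : Derivation ℤ A A, (∀ c, D (iA c) = 0) ∧
    ∃ N : Matrix (Fin d) (Fin d) A, ∀ i,
      ((g i).map D * (g i)⁻¹ + g i * N * (g i)⁻¹ - E i).BlockTriangular id

theorem blockTriangular_sum {R ι : Type*} [CommRing R] (s : Finset ι)
    (M : ι → Matrix (Fin d) (Fin d) R) (h : ∀ i ∈ s, (M i).BlockTriangular id) :
    (∑ i ∈ s, M i).BlockTriangular id := by
  intro p q hpq
  rw [Matrix.sum_apply]
  exact Finset.sum_eq_zero fun i hi => h i hi hpq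

/-- Transversality is linear in E. Solve it over A for every elementary matrix, then combine the
solutions with the entries of E as coefficients. Since these entries lie in I, so do all values of
the resulting derivation and of N. -/
theorem IsTransversal.exists_deformation {iA : k →+* A} {g : Fin l → Matrix (Fin d) (Fin d) A}
    (h : IsTransversal iA g) {C : Type*} [CommRing C] (I : Ideal C) (α : A →+* C)
    (E : Fin l → Matrix (Fin d) (Fin d) C) (hE : ∀ i p q, E i p q ∈ I) :
    ∃ δ : A →+ C, (∀ a, δ a ∈ I) ∧ (∀ a b, δ (a * b) = α a * δ b + α b * δ a) ∧
      (∀ c, δ (iA c) = 0) ∧ ∃ N : Matrix (Fin d) (Fin d) C, (∀ p q, N p q ∈ I) ∧ ∀ i,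
        ((g i).map δ * (g i)⁻¹.map α + (g i).map α * N * (g i)⁻¹.map α -
          E i).BlockTriangular id := by
  classical
  let ι := Fin l × Fin d × Fin d
  let e : ι → Fin l → Matrix (Fin d) (Fin d) A := fun x i =>
    if i = x.1 then Matrix.single x.2.1 x.2.2 1 else 0
  let w : ι → C := fun x => E x.1 x.2.1 x.2.2
  choose D hD N hN using fun x => h (e x)
  refine ⟨∑ x, (AddMonoidHom.mulLeft (w x)).comp (α.toAddMonoidHom.comp (D x : A →+ A)),
    ?_, ?_, ?_, ∑ x, w x • (N x).map α, ?_, ?_⟩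
  · intro a
    rw [AddMonoidHom.finsetSum_apply]
    exact Ideal.sum_mem _ fun x _ => Ideal.mul_mem_right _ _ (hE _ _ _)
  · intro a b
    simp only [AddMonoidHom.finsetSum_apply]
    rw [Finset.mul_sum, Finset.mul_sum, ← Finset.sum_add_distrib]
    refine Finset.sum_congr rfl fun x _ => ?_
    change w x * α (D x (a * b)) = α a * (w x * α (D x b)) + α b * (w x * α (D x a))
    rw [Derivation.leibniz, smul_eq_mul, smul_eq_mul, map_add, map_mul, map_mul]
    ring
  · intro c
    rw [AddMonoidHom.finsetSum_apply]
    refine Finset.sum_eq_zero fun x _ => ?_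
    change w x * α (D x (iA c)) = 0
    rw [hD, map_zero, mul_zero]
  · intro p q
    rw [Matrix.sum_apply]
    exact Ideal.sum_mem _ fun x _ => Ideal.mul_mem_right _ _ (hE _ _ _)
  · intro i
    have h1 : (g i).map ⇑(∑ x, (AddMonoidHom.mulLeft (w x)).comp
        (α.toAddMonoidHom.comp (D x : A →+ A)) : A →+ C) = ∑ x, w x • ((g i).map (D x)).map α := by
      ext p q
      rw [Matrix.map_apply, AddMonoidHom.finsetSum_apply, Matrix.sum_apply]
      rfl
    have h2 : E i = ∑ x, w x • (e x i).map α := by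
      ext p q
      rw [Matrix.sum_apply]
      simp only [Matrix.smul_apply, Matrix.map_apply, e, w, smul_eq_mul]
      rw [Finset.sum_eq_single (i, p, q)]
      · simp
      · rintro ⟨i', p', q'⟩ - hne
        by_cases hi : i = i'
        · subst hi
          have : ¬ (p' = p ∧ q' = q) := by
            rintro ⟨rfl, rfl⟩
            exact hne rfl
          simp [this]
        · simp [hi]
      · simp
    rw [h1, h2, Finset.sum_mul, Finset.mul_sum, Finset.sum_mul, ← Finset.sum_add_distrib,
      ← Finset.sum_sub_distrib]
    refine blockTriangular_sum _ _ fun x _ => ?_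
    have h3 : w x • ((g i).map (D x)).map α * (g i)⁻¹.map α +
        (g i).map α * w x • (N x).map α * (g i)⁻¹.map α - w x • (e x i).map α =
        w x • ((g i).map (D x) * (g i)⁻¹ + g i * N x * (g i)⁻¹ - e x i).map α := by
      rw [Matrix.map_sub _ (map_sub α), Matrix.map_add _ (map_add α), Matrix.map_mul,
        Matrix.map_mul, Matrix.map_mul, smul_sub, smul_add, Matrix.mul_smul, Matrix.smul_mul,
        Matrix.smul_mul]
    rw [h3]
    intro p q hpq
    rw [Matrix.smul_apply, Matrix.map_apply, hN x i hpq, map_zero, smul_zero]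

theorem map_mul_eq_zero_of_sq {C : Type*} [CommRing C] {I : Ideal C} (hI : I ^ 2 = ⊥)
    {M N : Matrix (Fin d) (Fin d) C} (hM : ∀ p q, M p q ∈ I) (hN : ∀ p q, N p q ∈ I) :
    M * N = 0 := by
  ext p q
  rw [Matrix.mul_apply]
  refine Finset.sum_eq_zero fun j _ => ?_
  have : M p j * N j q ∈ I ^ 2 := by
    rw [pow_two]
    exact Ideal.mul_mem_mul (hM p j) (hN j q)
  rwa [hI, Ideal.mem_bot] at this

theorem mul_mem_of_right {C : Type*} [CommRing C] {I : Ideal C}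
    {M N : Matrix (Fin d) (Fin d) C} (hN : ∀ p q, N p q ∈ I) (p q : Fin d) : (M * N) p q ∈ I := by
  rw [Matrix.mul_apply]
  exact Ideal.sum_mem _ fun j _ => Ideal.mul_mem_left _ _ (hN j q)

theorem mul_mem_of_left {C : Type*} [CommRing C] {I : Ideal C}
    {M N : Matrix (Fin d) (Fin d) C} (hM : ∀ p q, M p q ∈ I) (p q : Fin d) : (M * N) p q ∈ I := by
  rw [Matrix.mul_apply]
  exact Ideal.sum_mem _ fun j _ => Ideal.mul_mem_right _ _ (hM p j)

/-- Compatible points lift along square zero extensions if the flags are transversal. -/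
theorem IsTransversal.exists_lift {iA : k →+* A} {iB : k →+* B}
    {g : Fin l → Matrix (Fin d) (Fin d) A} {L : Fin l → Matrix (Fin d) (Fin d) B}
    (h : IsTransversal iA g) (hg : ∀ i, IsUnit (g i)) (hL : ∀ i, IsUnit (L i))
    (hA : iA.FormallySmooth) {C : Type u} [CommRing C] {I : Ideal C} (hI : I ^ 2 = ⊥)
    (γ : B →+* C) {α₁ : A →+* C ⧸ I} {M₁ : Matrix (Fin d) (Fin d) (C ⧸ I)}
    (h₁ : IsCompatible iA iB g L α₁ ((Ideal.Quotient.mk I).comp γ) M₁) :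
    ∃ (α : A →+* C) (M : Matrix (Fin d) (Fin d) C), IsCompatible iA iB g L α γ M ∧
      (Ideal.Quotient.mk I).comp α = α₁ ∧ M.map (Ideal.Quotient.mk I) = M₁ := by
  set π := Ideal.Quotient.mk I with hπ
  -- Formal smoothness of A over k lifts α₁; the matrix is lifted entry by entry and stays
  -- invertible because I is nilpotent. Only triangularity can fail for these lifts.
  obtain ⟨β, hβk, hβ⟩ : ∃ β : A →+* C, β.comp iA = γ.comp iB ∧ π.comp β = α₁ := by
    let _ := iA.toAlgebra
    let _ := (γ.comp iB).toAlgebra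
    have : Algebra.FormallySmooth k A := hA
    obtain ⟨β, hβ⟩ := Algebra.FormallySmooth.comp_surjective k A I hI
      ⟨α₁, fun c => RingHom.congr_fun h₁.comp_eq c⟩
    exact ⟨β, RingHom.ext β.commutes, RingHom.ext fun a => DFunLike.congr_fun hβ a⟩
  obtain ⟨M, hM⟩ : ∃ M : Matrix (Fin d) (Fin d) C, M.map π = M₁ := by
    choose m hm using fun p q => Ideal.Quotient.mk_surjective (M₁ p q)
    exact ⟨Matrix.of m, by ext p q; exact hm p q⟩
  have hunit : ∀ M : Matrix (Fin d) (Fin d) C, M.map π = M₁ → IsUnit M := by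
    intro M hM
    rw [Matrix.isUnit_iff_isUnit_det, ← IsNilpotent.isUnit_quotient_mk_iff (I := I) ⟨2, hI⟩]
    have h2 := (Matrix.isUnit_iff_isUnit_det _).mp h₁.isUnit
    rw [← hM] at h2
    exact (RingHom.map_det π M).symm ▸ h2
  set G : Fin l → Matrix (Fin d) (Fin d) C := fun i => (g i).map β
  set b : Fin l → Matrix (Fin d) (Fin d) C := fun i => G i * M * (L i).map γ with hb
  have hbu : ∀ i, IsUnit (b i) := fun i =>
    (((hg i).map β.mapMatrix).mul (hunit M hM)).mul ((hL i).map γ.mapMatrix)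
  have hbdet : ∀ i, IsUnit (b i).det := fun i => (Matrix.isUnit_iff_isUnit_det _).mp (hbu i)
  -- The strictly lower triangular part of b i is the obstruction. It lies in I because the given
  -- point is compatible modulo I.
  let s : Fin l → Matrix (Fin d) (Fin d) C := fun i =>
    Matrix.of fun p q => if q < p then b i p q else 0
  have hbtri : ∀ i, (b i - s i).BlockTriangular id := by
    intro i p q hpq
    have : q < p := hpq
    simp [s, this]
  have hs : ∀ i p q, s i p q ∈ I := by
    intro i p q
    simp only [s, Matrix.of_apply]
    split_ifs with hpq
    · have h3 : (b i).map π = (g i).map α₁ * M₁ * (L i).map (π.comp γ) := by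
        rw [hb, Matrix.map_mul, Matrix.map_mul, Matrix.map_map, Matrix.map_map, hM, ← hβ]
        rfl
      rw [← Ideal.Quotient.eq_zero_iff_mem]
      have h4 := h₁.triangular i (show id q < id p from hpq)
      rw [← h3] at h4
      exact h4
    · exact zero_mem _
  -- The prescribed deformation −s b⁻¹ is the one whose effect 1 − s b⁻¹ turns b into b − s, which
  -- is triangular.
  obtain ⟨δ, hδI, hδmul, hδk, N, hN, hδN⟩ := h.exists_deformation I β (fun i => -(s i * (b i)⁻¹))
    (fun i p q => I.neg_mem (mul_mem_of_left (hs i) p q))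
  have hI' : ∀ x ∈ I, ∀ y ∈ I, x * y = 0 := by
    intro x hx y hy
    have : x * y ∈ I ^ 2 := by
      rw [pow_two]
      exact Ideal.mul_mem_mul hx hy
    rwa [hI, Ideal.mem_bot] at this
  have hδ1 : δ 1 = 0 := by
    have := hδmul 1 1
    simpa using this
  -- Adding δ to β gives a ring homomorphism because the product of two values of δ lies in I² = 0.
  let α : A →+* C :=
    { toFun := fun a => β a + δ a
      map_one' := by rw [map_one, hδ1, add_zero]
      map_zero' := by simp
      map_add' := fun x y => by rw [map_add, map_add]; ring
      map_mul' := fun x y => by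
        rw [map_mul, hδmul]
        linear_combination -hI' _ (hδI x) _ (hδI y) }
  have hπI : ∀ x ∈ I, π x = 0 := fun x hx => Ideal.Quotient.eq_zero_iff_mem.mpr hx
  have hπα : π.comp α = α₁ := by
    rw [← hβ]
    ext a
    change π (β a + δ a) = π (β a)
    rw [map_add, hπI _ (hδI a), add_zero]
  have hπM : ((1 + N) * M).map π = M₁ := by
    have : (1 + N).map π = 1 := by
      rw [Matrix.map_add _ (map_add π)]
      have h5 : N.map π = 0 := by
        ext p q
        exact hπI _ (hN p q)
      rw [h5, add_zero]
      exact map_one π.mapMatrix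
    rw [Matrix.map_mul, this, Matrix.one_mul, hM]
  refine ⟨α, (1 + N) * M, ⟨?_, hunit _ hπM, fun i => ?_⟩, hπα, hπM⟩
  · rw [← hβk]
    ext c
    change β (iA c) + δ (iA c) = β (iA c)
    rw [hδk, add_zero]
  · have hδi : ∀ p q, (g i).map δ p q ∈ I := fun p q => hδI _
    have e1 : (g i).map α = G i + (g i).map δ := rfl
    set X := (g i).map δ * (g i)⁻¹.map β + G i * N * (g i)⁻¹.map β with hX
    have hinv : (g i)⁻¹.map β * G i = 1 := by
      change (g i)⁻¹.map β * (g i).map β = 1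
      rw [← Matrix.map_mul, Matrix.nonsing_inv_mul _ ((Matrix.isUnit_iff_isUnit_det _).mp (hg i))]
      exact map_one β.mapMatrix
    have e2 : X * G i = (g i).map δ + G i * N := by
      rw [hX, add_mul, mul_assoc, hinv, mul_assoc (G i * N), hinv, mul_one, mul_one]
    have hXI : ∀ p q, X p q ∈ I := fun p q =>
      I.add_mem (mul_mem_of_left hδi p q) (mul_mem_of_left (mul_mem_of_right hN) p q)
    -- To first order the corrected point acts on b by 1 + X: the derivation and the change of frame
    -- contribute the two summands of X.
    have e3 : (g i).map α * ((1 + N) * M) * (L i).map γ = b i + X * b i := by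
      have e4 : (G i + (g i).map δ) * (1 + N) = (1 + X) * G i := by
        have e5 := map_mul_eq_zero_of_sq hI hδi hN
        rw [add_mul 1 X, one_mul, e2, mul_add, mul_one, add_mul (G i) _ N, e5, add_zero]
        abel
      rw [e1, ← mul_assoc, e4, hb]
      noncomm_ring
    set Y := X - -(s i * (b i)⁻¹) with hY
    have hYtri : Y.BlockTriangular id := hδN i
    have hYI : ∀ p q, Y p q ∈ I := fun p q =>
      I.sub_mem (hXI p q) (I.neg_mem (mul_mem_of_left (hs i) p q))
    -- Since Y s has entries in I² = 0, the corrected matrix factors as (1 + Y)(b − s), a product of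
    -- triangular matrices.
    have e6 : b i + X * b i = (b i - s i) + Y * (b i - s i) := by
      have e7 : X = Y - s i * (b i)⁻¹ := by rw [hY]; abel
      have e8 : Y * s i = 0 := map_mul_eq_zero_of_sq hI hYI (hs i)
      have e9 : s i * (b i)⁻¹ * b i = s i := by
        rw [mul_assoc, Matrix.nonsing_inv_mul _ (hbdet i), mul_one]
      rw [e7, sub_mul, e9, mul_sub, e8]
      abel
    rw [e3, e6]
    exact (hbtri i).add (hYtri.mul (hbtri i))

/-- The universal compatible point is formally smooth if the flags are transversal. -/
theorem IsTransversal.formallySmooth {iA : k →+* A} {iB : k →+* B}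
    {g : Fin l → Matrix (Fin d) (Fin d) A} {L : Fin l → Matrix (Fin d) (Fin d) B}
    (h : IsTransversal iA g) (hg : ∀ i, IsUnit (g i)) (hL : ∀ i, IsUnit (L i))
    (hA : iA.FormallySmooth) {Q : Type u} [CommRing Q] {α₀ : A →+* Q} {γ₀ : B →+* Q}
    {M₀ : Matrix (Fin d) (Fin d) Q} (h₀ : IsCompatible iA iB g L α₀ γ₀ M₀)
    (hQ : ∀ (C : Type u) [CommRing C] (α : A →+* C) (γ : B →+* C)
      (M : Matrix (Fin d) (Fin d) C), IsCompatible iA iB g L α γ M →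
        ∃! ψ : Q →+* C, ψ.comp α₀ = α ∧ ψ.comp γ₀ = γ ∧ M₀.map ψ = M) :
    γ₀.FormallySmooth := by
  let _ := γ₀.toAlgebra
  change Algebra.FormallySmooth B Q
  rw [Algebra.FormallySmooth.iff_comp_surjective]
  intro C _ _ I hI φ
  have hφγ : (φ : Q →+* C ⧸ I).comp γ₀ = (Ideal.Quotient.mk I).comp (algebraMap B C) :=
    RingHom.ext fun b => φ.commutes b
  have h₁ := h₀.comp (φ : Q →+* C ⧸ I)
  rw [hφγ] at h₁
  obtain ⟨α, M, hαM, hα, hM⟩ := h.exists_lift hg hL hA hI (algebraMap B C) h₁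
  obtain ⟨ψ, ⟨hψ1, hψ2, hψ3⟩, -⟩ := hQ C α (algebraMap B C) M hαM
  refine ⟨⟨ψ, fun b => RingHom.congr_fun hψ2 b⟩, ?_⟩
  -- Both homomorphisms classify the same compatible point modulo I, so the constructed ψ does lift
  -- φ.
  have hu := (hQ (C ⧸ I) _ _ _ h₁).unique
    (y₁ := (Ideal.Quotient.mk I).comp ψ) (y₂ := (φ : Q →+* C ⧸ I))
    ⟨by rw [RingHom.comp_assoc, hψ1, hα], by rw [RingHom.comp_assoc, hψ2],
      by rw [← hM, ← hψ3, Matrix.map_map]; rfl⟩ ⟨rfl, hφγ, rfl⟩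
  exact AlgHom.ext fun x => RingHom.congr_fun hu x

end Transversality

/-! ### Morphisms to affine open subsets -/

section AffineTargets

variable {S T T' : Scheme.{u}} {U : S.Opens}

/-- The pullback of functions along a morphism that factors through an open subset. -/
def pullFun (b : T ⟶ S) (hb : ⊤ ≤ b ⁻¹ᵁ U) : Γ(S, U) →+* Γ(T, ⊤) :=
  (resFun hb).comp (b.app U).hom

theorem pullFun_comp (h : T' ⟶ T) (b : T ⟶ S) (hb : ⊤ ≤ b ⁻¹ᵁ U) (hb' : ⊤ ≤ (h ≫ b) ⁻¹ᵁ U) :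
    pullFun (h ≫ b) hb' = h.appTop.hom.comp (pullFun b hb) := by
  ext r
  exact (app_resFun h hb ((b.app U).hom r)).symm

theorem funGerm_pullFun (b : T ⟶ S) (hb : ⊤ ≤ b ⁻¹ᵁ U) (t : T) (r : Γ(S, U)) :
    funGerm (U := ⊤) (x := t) trivial (pullFun b hb r) =
      funGerm (U := b ⁻¹ᵁ U) (x := t) (hb trivial) ((b.app U).hom r) :=
  funGerm_res hb trivial _

theorem pullFun_resFun {V : S.Opens} (h : V ≤ U) (b : T ⟶ S) (hb : ⊤ ≤ b ⁻¹ᵁ V)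
    (hb' : ⊤ ≤ b ⁻¹ᵁ U) (r : Γ(S, U)) : pullFun b hb (resFun h r) = pullFun b hb' r := by
  change resFun _ ((b.app V).hom (resFun h r)) = _
  rw [app_resFun, resFun_resFun]
  rfl

variable {B : CommRingCat.{u}}

/-- The ring homomorphism corresponding to a morphism to an affine scheme. -/
def specFun (z : T ⟶ Spec B) : B →+* Γ(T, ⊤) :=
  z.appTop.hom.comp (Scheme.ΓSpecIso B).inv.hom

theorem specFun_comp (h : T' ⟶ T) (z : T ⟶ Spec B) :
    specFun (h ≫ z) = h.appTop.hom.comp (specFun z) := by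
  unfold specFun
  rw [Scheme.Hom.comp_appTop]
  rfl

theorem specFun_SpecMap {C : CommRingCat.{u}} (φ : B ⟶ C) :
    specFun (Spec.map φ) = (Scheme.ΓSpecIso C).inv.hom.comp φ.hom := by
  have := Scheme.ΓSpecIso_inv_naturality φ
  exact (congrArg CommRingCat.Hom.hom this).symm

theorem specFun_comp_SpecMap {C : CommRingCat.{u}} (φ : B ⟶ C) (z : T ⟶ Spec C) :
    specFun (z ≫ Spec.map φ) = (specFun z).comp φ.hom := by
  rw [specFun_comp, specFun_SpecMap]
  rfl

theorem specFun_injective : Function.Injective (specFun (T := T) (B := B)) := by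
  intro z z' h
  exact ext_to_Spec (R := B) (CommRingCat.hom_ext h)

theorem specFun_surjective (φ : B →+* Γ(T, ⊤)) : ∃ z : T ⟶ Spec B, specFun z = φ := by
  refine ⟨T.toSpecΓ ≫ Spec.map (CommRingCat.ofHom φ), ?_⟩
  rw [specFun_comp_SpecMap]
  have : specFun T.toSpecΓ = RingHom.id _ := by
    unfold specFun
    rw [Scheme.toSpecΓ_appTop, ← CommRingCat.hom_comp, Iso.inv_hom_id]
    rfl
  rw [this]
  rfl

theorem top_le_preimage_fromSpec (hU : IsAffineOpen U) (z : T ⟶ Spec Γ(S, U)) :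
    ⊤ ≤ (z ≫ hU.fromSpec) ⁻¹ᵁ U := by
  intro t _
  have h1 : ∀ y, hU.fromSpec y ∈ (U : Set S) := fun y => hU.range_fromSpec ▸ Set.mem_range_self y
  exact h1 (z t)

theorem pullFun_comp_fromSpec (hU : IsAffineOpen U) (z : T ⟶ Spec Γ(S, U))
    (hz : ⊤ ≤ (z ≫ hU.fromSpec) ⁻¹ᵁ U) : pullFun (z ≫ hU.fromSpec) hz = specFun z := by
  have h0 : ⊤ ≤ hU.fromSpec ⁻¹ᵁ U := hU.fromSpec_preimage_self.ge
  rw [pullFun_comp z hU.fromSpec h0]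
  unfold specFun
  congr 1
  ext r
  change resFun h0 ((hU.fromSpec.app U).hom r) = _
  rw [hU.fromSpec_app_self]
  exact (resFun_resFun _ _ _).trans (resFun_self _ _)

theorem exists_eq_comp_fromSpec (hU : IsAffineOpen U) (b : T ⟶ S) (hb : ⊤ ≤ b ⁻¹ᵁ U) :
    ∃ z : T ⟶ Spec Γ(S, U), b = z ≫ hU.fromSpec := by
  refine ⟨IsOpenImmersion.lift hU.fromSpec b ?_, (IsOpenImmersion.lift_fac _ _ _).symm⟩
  rw [hU.range_fromSpec]
  rintro _ ⟨t, rfl⟩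
  exact hb trivial

theorem hom_ext_pullFun (hU : IsAffineOpen U) {b b' : T ⟶ S} (hb : ⊤ ≤ b ⁻¹ᵁ U)
    (hb' : ⊤ ≤ b' ⁻¹ᵁ U) (h : pullFun b hb = pullFun b' hb') : b = b' := by
  obtain ⟨z, rfl⟩ := exists_eq_comp_fromSpec hU b hb
  obtain ⟨z', rfl⟩ := exists_eq_comp_fromSpec hU b' hb'
  rw [pullFun_comp_fromSpec, pullFun_comp_fromSpec] at h
  rw [specFun_injective h]

theorem exists_pullFun_eq (hU : IsAffineOpen U) (φ : Γ(S, U) →+* Γ(T, ⊤)) :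
    ∃ (b : T ⟶ S) (hb : ⊤ ≤ b ⁻¹ᵁ U), pullFun b hb = φ := by
  obtain ⟨z, rfl⟩ := specFun_surjective φ
  exact ⟨z ≫ hU.fromSpec, top_le_preimage_fromSpec hU z, pullFun_comp_fromSpec hU z _⟩

/-- The structure homomorphism of the functions on an open subset. -/
def structureFun (f : S ⟶ Spec B) (U : S.Opens) : B →+* Γ(S, U) :=
  (resFun le_top).comp (specFun f)

theorem specFun_comp_eq (f : S ⟶ Spec B) (b : T ⟶ S) (hb : ⊤ ≤ b ⁻¹ᵁ U) :
    specFun (b ≫ f) = (pullFun b hb).comp (structureFun f U) := by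
  rw [specFun_comp]
  ext r
  change _ = pullFun b hb (resFun le_top (specFun f r))
  rw [pullFun_resFun le_top b hb le_top]
  exact (resFun_self _ _).symm

end AffineTargets

/-! ### Flags given by matrices -/

section MatrixFlags

variable {S T T' : Scheme.{u}} {d l : ℕ}

/-- The flag in the trivial bundle spanned by the rows of an invertible matrix. -/
def TrivialFlag.ofMat (K : Matrix (Fin d) (Fin d) Γ(T, ⊤)) (hK : IsUnit K) : TrivialFlag T d where
  fib _ := tailFlag fun i j => funGerm (U := ⊤) trivial (K i j)
  adapted _ := ⟨⊤, trivial, K, hK, fun _ _ => rfl⟩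

theorem funGerm_eq_zero {r : Γ(T, ⊤)}
    (h : ∀ t : T, funGerm (U := ⊤) (x := t) trivial r = 0) : r = 0 := by
  refine TopCat.Presheaf.section_ext T.sheaf ⊤ r 0 fun t _ => ?_
  exact (h t).trans (map_zero _).symm

/-- Flags are compared on stalks, where `tailFlag_eq_iff` applies; an entry of K L⁻¹ vanishes as
soon as all its germs do. -/
theorem TrivialFlag.ofMat_eq_iff {K L : Matrix (Fin d) (Fin d) Γ(T, ⊤)} (hK : IsUnit K)
    (hL : IsUnit L) :
    TrivialFlag.ofMat K hK = TrivialFlag.ofMat L hL ↔ (K * L⁻¹).BlockTriangular id := by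
  have h1 : ∀ t : T, (TrivialFlag.ofMat K hK).fib t = (TrivialFlag.ofMat L hL).fib t ↔
      ((K * L⁻¹).map (funGerm (U := ⊤) (x := t) trivial)).BlockTriangular id := by
    intro t
    refine (tailFlag_eq_iff (hK.map (funGerm (U := ⊤) (x := t) trivial).mapMatrix)
      (hL.map (funGerm (U := ⊤) (x := t) trivial).mapMatrix)).trans ?_
    rw [Matrix.map_mul, ← map_nonsing_inv _ hL]
    rfl
  constructor
  · intro h p q hpq
    refine funGerm_eq_zero fun t => ?_
    exact (h1 t).mp (congrFun (congrArg TrivialFlag.fib h) t) hpq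
  · intro h
    ext1
    funext t
    refine (h1 t).mpr fun p q hpq => ?_
    rw [Matrix.map_apply, h hpq, map_zero]

theorem TrivialFlag.pullback_ofMat (h : T' ⟶ T) {K : Matrix (Fin d) (Fin d) Γ(T, ⊤)}
    (hK : IsUnit K) : (TrivialFlag.ofMat K hK).pullback h =
      TrivialFlag.ofMat (K.map h.appTop.hom) (hK.map h.appTop.hom.mapMatrix) := by
  ext1
  funext t
  refine (mapFlag_tailFlag _ _).trans ?_
  congr 1
  funext i j
  exact stalkMap_funGerm (U := ⊤) h t trivial _

variable {H : VectorBundle S d} {P : Fin l → CompleteFlag H}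

theorem FlagChart.isUnit_mul (c : FlagChart P) (y : FramePoint H T) (hy : ⊤ ≤ y.base ⁻¹ᵁ c.U)
    (i : Fin l) : IsUnit ((c.g i).map (pullFun y.base hy) * y.mat hy c.e) :=
  ((c.isUnit i).map (pullFun y.base hy).mapMatrix).mul (y.isUnit_mat hy c.frame)

/-- The flag induced on a point of the frame bundle in a chart. -/
theorem FlagChart.flag_eq (c : FlagChart P) (y : FramePoint H T) (hy : ⊤ ≤ y.base ⁻¹ᵁ c.U)
    (i : Fin l) : y.flag (P i) =
      TrivialFlag.ofMat ((c.g i).map (pullFun y.base hy) * y.mat hy c.e) (c.isUnit_mul y hy i) := by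
  have hb : ∀ (t : T) p, (fun m => funGerm (U := y.base ⁻¹ᵁ c.U) (x := t) (hy trivial)
      (y.coord c.U (∑ j, c.g i p j • c.e j) m)) = fun m => funGerm (U := ⊤) (x := t) trivial
        (((c.g i).map (pullFun y.base hy) * y.mat hy c.e) p m) := by
    intro t p
    funext m
    rw [y.coord_sum, Finset.sum_apply, Matrix.mul_apply, map_sum, map_sum]
    refine Finset.sum_congr rfl fun j _ => ?_
    rw [y.coord_smul, map_mul, map_mul]
    congr 1
    · exact (funGerm_pullFun _ _ _ _).symm
    · exact (funGerm_res hy trivial _).symm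
  ext1
  funext t a
  apply le_antisymm
  · refine Submodule.span_le.mpr ?_
    rintro _ ⟨V, hV, s, hs, rfl⟩
    have h1 := (P i).res_mem a (inf_le_left : V ⊓ c.U ≤ V) s hs
    rw [c.adapted i (V ⊓ c.U) inf_le_right] at h1
    have hW : t ∈ y.base ⁻¹ᵁ (V ⊓ c.U) := ⟨hV, hy trivial⟩
    have h2 : (fun j => funGerm (U := y.base ⁻¹ᵁ V) (x := t) hV (y.coord V s j)) =
        fun j => funGerm hW (y.coord (V ⊓ c.U) (resSec H.sheaf inf_le_left s) j) := by
      funext j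
      rw [y.coord_res, funGerm_res]
    rw [h2]
    generalize resSec H.sheaf (inf_le_left : V ⊓ c.U ≤ V) s = r at h1
    change (fun j => funGerm hW (y.coord (V ⊓ c.U) r j)) ∈ tailFlag _ a
    unfold tailFlag at h1
    induction h1 using Submodule.span_induction with
    | mem r hr =>
      obtain ⟨p, hp, rfl⟩ := hr
      refine Submodule.subset_span ⟨p, hp, ?_⟩
      refine (hb t p).symm.trans ?_
      funext j
      rw [y.coord_res, funGerm_res]
    | zero =>
      rw [y.coord_zero]
      convert zero_mem (tailFlag _ a) using 1
      funext j
      exact map_zero _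
    | add r r' _ _ hr hr' =>
      rw [y.coord_add]
      convert add_mem hr hr' using 1
      funext j
      exact map_add _ _ _
    | smul r s _ hs =>
      convert Submodule.smul_mem _ (funGerm hW ((y.base.app (V ⊓ c.U)).hom r)) hs using 1
      funext j
      rw [y.coord_smul, map_mul]
      rfl
  · refine Submodule.span_le.mpr ?_
    rintro _ ⟨p, hp, rfl⟩
    refine Submodule.subset_span ⟨c.U, hy trivial, ∑ j, c.g i p j • c.e j, ?_, (hb t p).symm⟩
    rw [c.adapted i c.U le_rfl]
    refine Submodule.subset_span ⟨p, hp, ?_⟩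
    exact resSec_self _ _ _

end MatrixFlags

/-! ### The local structure of the map from the frame bundle to the flag variety -/

section LocalStructure

variable {k : Type u} [Field k] {S T T' : Scheme.{u}} {d l : ℕ} {B : CommRingCat.{u}}

theorem isUnit_map {R R' : Type*} [CommRing R] [CommRing R'] (φ : R →+* R')
    {M : Matrix (Fin d) (Fin d) R} (hM : IsUnit M) : IsUnit (M.map φ) :=
  hM.map φ.mapMatrix

theorem specFun_id : specFun (𝟙 (Spec B)) = (Scheme.ΓSpecIso B).inv.hom := by
  unfold specFun
  rw [Scheme.Hom.id_appTop]
  rfl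

/-- The family of flags over `Spec B` given by invertible matrices. -/
def specFlags (iB : CommRingCat.of k ⟶ B) (K : Fin l → Matrix (Fin d) (Fin d) B)
    (hK : ∀ i, IsUnit (K i)) : yoneda.obj (Spec B) ⟶ flagVarietyPow k d l where
  app T := ↾fun z => (z ≫ Spec.map iB, fun i => TrivialFlag.ofMat ((K i).map (specFun z))
    (isUnit_map (specFun z) (hK i)))
  naturality T T' h := by
    ext z
    refine Prod.ext (Category.assoc _ _ _) ?_
    funext i
    refine Eq.trans ?_ (TrivialFlag.pullback_ofMat h.unop (isUnit_map (specFun z) (hK i))).symm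
    congr 1

/-- Locally, every family of flags is given by invertible matrices. -/
theorem exists_specFlags (g : yoneda.obj T ⟶ flagVarietyPow k d l) (x : T) :
    ∃ (B : CommRingCat.{u}) (j : Spec B ⟶ T), IsOpenImmersion j ∧ x ∈ Set.range j ∧
      ∃ (iB : CommRingCat.of k ⟶ B) (K : Fin l → Matrix (Fin d) (Fin d) B)
        (hK : ∀ i, IsUnit (K i)), yoneda.map j ≫ g = specFlags iB K hK := by
  let F : (T ⟶ Spec (.of k)) × (Fin l → TrivialFlag T d) := yonedaEquiv g
  choose V hV G hG hF using fun i => (F.2 i).adapted x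
  let O : T.Opens := Finset.univ.inf V
  have hO : x ∈ O := by
    change x ∈ ((Finset.univ.inf V : T.Opens) : Set T)
    rw [TopologicalSpace.Opens.coe_finset_inf]
    simpa using hV
  obtain ⟨B, j, hj, hx, hjO⟩ := Scheme.exists_affine_mem_range_and_range_subset hO
  have hjV : ∀ i, ⊤ ≤ j ⁻¹ᵁ V i := fun i t _ =>
    (Finset.inf_le (Finset.mem_univ i) : O ≤ V i) (hjO ⟨t, rfl⟩)
  have hK : ∀ i, IsUnit ((G i).map (pullFun j (hjV i))) := fun i =>
    isUnit_map (pullFun j (hjV i)) (hG i)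
  refine ⟨B, j, hj, hx, (Spec.preimage (j ≫ F.1)),
    fun i => ((G i).map (pullFun j (hjV i))).map (Scheme.ΓSpecIso B).hom.hom,
    fun i => isUnit_map (Scheme.ΓSpecIso B).hom.hom (hK i), ?_⟩
  refine yonedaEquiv.injective ?_
  have h1 : yonedaEquiv (yoneda.map j ≫ g) = (flagVarietyPow k d l).map j.op (yonedaEquiv g) :=
    (yonedaEquiv_naturality g j).symm
  rw [h1]
  refine Prod.ext ?_ ?_
  · change j ≫ F.1 = 𝟙 _ ≫ Spec.map _
    rw [Spec.map_preimage, Category.id_comp]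
  · funext i
    change (F.2 i).pullback j = TrivialFlag.ofMat _
      (isUnit_map (specFun (𝟙 (Spec B))) (isUnit_map (Scheme.ΓSpecIso B).hom.hom (hK i)))
    ext1
    funext t
    refine (congrArg (mapFlag _) (hF i (j t) (hjV i trivial))).trans ?_
    refine (mapFlag_tailFlag _ _).trans ?_
    change tailFlag _ = tailFlag _
    congr 1
    funext p q
    refine (stalkMap_funGerm j t (hjV i trivial) _).trans ?_
    refine (funGerm_pullFun j (hjV i) t _).symm.trans ?_
    congr 1
    rw [Matrix.map_apply, Matrix.map_apply, Matrix.map_apply, specFun_id]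
    exact (Iso.hom_inv_id_apply (Scheme.ΓSpecIso B) _).symm

/-- An open immersion induces isomorphisms on stalks, so flags that agree on a Zariski cover have
the same stalks. Separatedness is all that `presheaf_of_locally` asks of the target. -/
theorem isSeparated_flagVarietyPow :
    Presieve.IsSeparated Scheme.zariskiTopology (flagVarietyPow k d l) := by
  intro T S hS x a b ha hb
  have hab : ∀ {T' : Scheme.{u}} (j : T' ⟶ T), S j →
      (flagVarietyPow k d l).map j.op a = (flagVarietyPow k d l).map j.op b := fun j hj =>
    (ha j hj).trans (hb j hj).symm
  have hY : Presieve.IsSheaf Scheme.zariskiTopology (yoneda.obj (Spec (.of k))) :=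
    GrothendieckTopology.Subcanonical.isSheaf_of_isRepresentable _
  refine Prod.ext ?_ ?_
  · exact (hY S hS).isSeparatedFor.ext fun T' j hj => congrArg Prod.fst (hab j hj)
  · funext i
    ext1
    funext t
    obtain ⟨U, hU⟩ := Scheme.mem_grothendieckTopology_iff.mp hS
    obtain ⟨n, t', rfl⟩ := U.exists_eq t
    have h1 := congrFun (congrArg TrivialFlag.fib (congrFun (congrArg Prod.snd
      (hab (U.f n) (hU _ _ ⟨n⟩))) i)) t'
    change mapFlag ((U.f n).stalkMap t').hom _ = mapFlag ((U.f n).stalkMap t').hom _ at h1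
    have h2 := congrArg (mapFlag (inv ((U.f n).stalkMap t')).hom) h1
    rw [← mapFlag_comp, ← mapFlag_comp, ← CommRingCat.hom_comp, IsIso.hom_inv_id] at h2
    exact (mapFlag_id _).symm.trans (h2.trans (mapFlag_id _))

variable (f : S ⟶ Spec (.of k)) {H : VectorBundle S d} {P : Fin l → CompleteFlag H}

/-- Points of the frame bundle in a chart that map to a given point of the flag variety. -/
theorem FlagChart.flags_eq_iff (c : FlagChart P) (y : FramePoint H T) (hy : ⊤ ≤ y.base ⁻¹ᵁ c.U)
    (iB : CommRingCat.of k ⟶ B) (K : Fin l → Matrix (Fin d) (Fin d) B)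
    (hK : ∀ i, IsUnit (K i)) (z : T ⟶ Spec B) :
    ((y.base ≫ f, fun i => y.flag (P i)) : (T ⟶ Spec (.of k)) × (Fin l → TrivialFlag T d)) =
      (z ≫ Spec.map iB, fun i => TrivialFlag.ofMat ((K i).map (specFun z))
        (isUnit_map (specFun z) (hK i))) ↔
    IsCompatible (structureFun f c.U) iB.hom c.g (fun i => (K i)⁻¹) (pullFun y.base hy)
      (specFun z) (y.mat hy c.e) := by
  have h1 : y.base ≫ f = z ≫ Spec.map iB ↔
      (pullFun y.base hy).comp (structureFun f c.U) = (specFun z).comp iB.hom := by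
    rw [← specFun_comp_eq, ← specFun_comp_SpecMap]
    exact specFun_injective.eq_iff.symm
  have h2 : ∀ i, y.flag (P i) = TrivialFlag.ofMat ((K i).map (specFun z))
        (isUnit_map (specFun z) (hK i)) ↔ ((c.g i).map (pullFun y.base hy) * y.mat hy c.e *
          (K i)⁻¹.map (specFun z)).BlockTriangular id := by
    intro i
    rw [c.flag_eq y hy i, TrivialFlag.ofMat_eq_iff, map_nonsing_inv _ (hK i)]
  rw [Prod.ext_iff]
  constructor
  · rintro ⟨h3, h4⟩
    exact ⟨h1.mp h3, y.isUnit_mat hy c.frame, fun i => (h2 i).mp (congrFun h4 i)⟩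
  · intro h
    exact ⟨h1.mpr h.comp_eq, funext fun i => (h2 i).mpr (h.triangular i)⟩

theorem frameBundle_le {W : S.Opens} (y : (frameBundle H W).obj (op T)) : ⊤ ≤ y.1.base ⁻¹ᵁ W :=
  fun t _ => y.2 t

/-- The fibre product of the frame bundle over a chart with an affine scheme over the flag
variety. -/
theorem FlagChart.exists_isPullback (c : FlagChart P) (hA : (structureFun f c.U).FinitePresentation)
    (iB : CommRingCat.of k ⟶ B) (K : Fin l → Matrix (Fin d) (Fin d) B) (hK : ∀ i, IsUnit (K i)) :
    ∃ (Q : CommRingCat.{u}) (α₀ : Γ(S, c.U) →+* Q) (γ₀ : B ⟶ Q) (M₀ : Matrix (Fin d) (Fin d) Q),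
      IsCompatible (structureFun f c.U) iB.hom c.g (fun i => (K i)⁻¹) α₀ γ₀.hom M₀ ∧
      γ₀.hom.FinitePresentation ∧
      (∀ (C : Type u) [CommRing C] (α : Γ(S, c.U) →+* C) (γ : B →+* C)
        (M : Matrix (Fin d) (Fin d) C),
        IsCompatible (structureFun f c.U) iB.hom c.g (fun i => (K i)⁻¹) α γ M →
          ∃! ψ : Q →+* C, ψ.comp α₀ = α ∧ ψ.comp γ₀.hom = γ ∧ M₀.map ψ = M) ∧
      ∃ p : yoneda.obj (Spec Q) ⟶ frameBundle H c.U,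
        IsPullback p (yoneda.map (Spec.map γ₀)) (frameToFlags f P c.U) (specFlags iB K hK) := by
  obtain ⟨Q, α₀, γ₀, M₀, h₀, hfp, hQ⟩ := exists_universal_compatible (structureFun f c.U) iB.hom hA
    c.g (fun i => (K i)⁻¹)
  refine ⟨Q, α₀, CommRingCat.ofHom γ₀, M₀, h₀, hfp, hQ, ?_⟩
  obtain ⟨b, hb, hbα⟩ := exists_pullFun_eq (T := Spec Q) c.affine
    ((Scheme.ΓSpecIso Q).inv.hom.comp α₀)
  -- The universal triple read as a point of the frame bundle. Its pullback along w has the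
  -- coordinates obtained by applying `specFun w`, so the cartesian property of the square is the
  -- universal property of Q.
  let y₀ : FramePoint H (Spec Q) := FramePoint.ofMat b hb c.frame
    (M₀.map (Scheme.ΓSpecIso Q).inv.hom) (h₀.isUnit.map (Scheme.ΓSpecIso Q).inv.hom.mapMatrix)
  have hy₀ : ⊤ ≤ y₀.base ⁻¹ᵁ c.U := hb
  have hbase : ∀ {T : Scheme.{u}} (w : T ⟶ Spec Q), ⊤ ≤ (y₀.pullback w).base ⁻¹ᵁ c.U :=
    fun w t _ => hb (trivial : w t ∈ (⊤ : (Spec Q).Opens))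
  have hpull : ∀ {T : Scheme.{u}} (w : T ⟶ Spec Q),
      pullFun (y₀.pullback w).base (hbase w) = (specFun w).comp α₀ := by
    intro T w
    refine (pullFun_comp w b hb (hbase w)).trans ?_
    rw [hbα]
    rfl
  have hmat : ∀ {T : Scheme.{u}} (w : T ⟶ Spec Q),
      (y₀.pullback w).mat (hbase w) c.e = M₀.map (specFun w) := by
    intro T w
    rw [FramePoint.pullback_mat w y₀ hy₀ (hbase w)]
    have : y₀.mat hy₀ c.e = M₀.map (Scheme.ΓSpecIso Q).inv.hom := FramePoint.ofMat_mat b hb _ _ _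
    rw [this, Matrix.map_map]
    rfl
  have hγ : ∀ {T : Scheme.{u}} (w : T ⟶ Spec Q),
      specFun (w ≫ Spec.map (CommRingCat.ofHom γ₀)) = (specFun w).comp γ₀ :=
    fun w => specFun_comp_SpecMap _ w
  let p : yoneda.obj (Spec Q) ⟶ frameBundle H c.U := yonedaEquiv.symm ⟨y₀, fun t => hb trivial⟩
  have hp : ∀ {T : Scheme.{u}} (w : T ⟶ Spec Q), (p.app (op T) w).1 = y₀.pullback w :=
    fun w => rfl
  refine ⟨p, isPullback_presheaf_iff.mpr ⟨?_, fun T => ⟨fun w w' h1 h2 => ?_, fun y z h => ?_⟩⟩⟩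
  · ext T w
    refine (c.flags_eq_iff f (y₀.pullback w) (hbase w) iB K hK
      (w ≫ Spec.map (CommRingCat.ofHom γ₀))).mpr ?_
    rw [hpull, hmat, hγ]
    exact h₀.comp (specFun w)
  · have h3 : y₀.pullback w = y₀.pullback w' := congrArg Subtype.val h1
    apply specFun_injective
    have h4 := h₀.comp (specFun w)
    refine (hQ _ _ _ _ h4).unique ⟨rfl, rfl, rfl⟩ ⟨?_, ?_, ?_⟩
    · rw [← hpull, ← hpull]
      congr 2
      exact h3.symm
    · rw [← hγ, ← hγ]
      exact congrArg specFun h2.symm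
    · rw [← hmat, ← hmat]
      congr 1
      exact h3.symm
  · have hy := frameBundle_le y
    have h1 := (c.flags_eq_iff f y.1 hy iB K hK z).mp h
    obtain ⟨ψ, ⟨h2, h3, h4⟩, -⟩ := hQ _ _ _ _ h1
    obtain ⟨w, rfl⟩ := specFun_surjective ψ
    refine ⟨w, Subtype.ext ?_, ?_⟩
    · refine FramePoint.ext_mat (hbase w) hy c.frame ?_ ?_
      · exact hom_ext_pullFun c.affine (hbase w) hy ((hpull w).trans h2)
      · exact (hmat w).trans h4
    · exact specFun_injective ((hγ w).trans h3)

/-- The chart for the empty family of flags. -/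
def FlagChart.forget (c : FlagChart P) :
    FlagChart (H := H) (Fin.elim0 : Fin 0 → CompleteFlag H) where
  U := c.U
  affine := c.affine
  e := c.e
  frame := c.frame
  g := Fin.elim0
  isUnit i := i.elim0
  adapted i := i.elim0

/-- For the empty family of flags the target is Spec k. The fibre product with Spec k itself is then
the frame bundle over the chart, which is therefore representable and hence a sheaf. -/
theorem FlagChart.isSheaf_frameBundle (c : FlagChart P)
    (hA : (structureFun f c.U).FinitePresentation) :
    Presieve.IsSheaf Scheme.zariskiTopology (frameBundle H c.U) := by
  obtain ⟨Q, _, _, _, -, -, -, p, hp⟩ := c.forget.exists_isPullback f hA (𝟙 (CommRingCat.of k))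
    Fin.elim0 (fun i => i.elim0)
  -- With no flags, a point of the target is only a morphism to Spec k.
  have h1 : IsIso (specFlags (d := d) (𝟙 (CommRingCat.of k)) Fin.elim0 (fun i => i.elim0)) := by
    rw [NatTrans.isIso_iff_isIso_app]
    intro T
    rw [isIso_iff_bijective]
    refine ⟨fun z z' h => ?_, fun F => ⟨F.1, ?_⟩⟩
    · have h2 := congrArg Prod.fst h
      change z ≫ Spec.map (𝟙 _) = z' ≫ Spec.map (𝟙 _) at h2
      simpa using h2
    · refine Prod.ext ?_ (funext fun i => i.elim0)
      change F.1 ≫ Spec.map (𝟙 _) = _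
      simp
  have h2 : IsIso p := hp.isIso_fst_of_isIso
  exact Presieve.isSheaf_iso _ (@asIso _ _ _ _ p h2)
    (GrothendieckTopology.Subcanonical.isSheaf_of_isRepresentable _)

/-- The flags are versal on a chart that is smooth over the base and in which they are
transversal. -/
theorem FlagChart.isVersalOn (c : FlagChart P) (hA : (structureFun f c.U).Smooth)
    (hc : IsTransversal (structureFun f c.U) c.g) : IsVersalOn f P c.U := by
  rw [RingHom.smooth_def] at hA
  have : IsZariskiLocalAtTarget @Smooth.{u} :=
    HasRingHomProperty.instIsZariskiLocalAtTarget _ (Q := RingHom.Smooth)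
  refine presheaf_of_locally @Smooth.{u} _ (c.isSheaf_frameBundle f hA.2) isSeparated_flagVarietyPow ?_
  intro T g x
  obtain ⟨B, j, hj, hx, iB, K, hK, hg⟩ := exists_specFlags g x
  obtain ⟨Q, α₀, γ₀, M₀, h₀, hfp, hQ, p, hp⟩ := c.exists_isPullback f hA.2 iB K hK
  refine ⟨Spec B, j, hj, hx, Spec Q, p, Spec.map γ₀, hg ▸ hp, ?_⟩
  rw [HasRingHomProperty.Spec_iff (P := @Smooth), RingHom.smooth_def]
  exact ⟨hc.formallySmooth c.isUnit (fun i => (Matrix.isUnit_nonsing_inv_iff).mpr (hK i)) hA.1 h₀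
    hQ, hfp⟩

end LocalStructure

/-! ### Derivations along a ring homomorphism -/

section DerivationsAlong

variable {d l : ℕ}

/-- An additive map that satisfies the Leibniz rule with respect to a ring homomorphism. -/
def IsDerivationAlong {A C : Type*} [CommRing A] [CommRing C] (ρ : A →+* C) (δ : A →+ C) : Prop :=
  ∀ a b, δ (a * b) = ρ a * δ b + ρ b * δ a

theorem IsDerivationAlong.map_one {A C : Type*} [CommRing A] [CommRing C] {ρ : A →+* C}
    {δ : A →+ C} (h : IsDerivationAlong ρ δ) : δ 1 = 0 := by
  have := h 1 1
  simpa using this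

/-- The homomorphism to the dual numbers attached to a derivation. -/
def IsDerivationAlong.toDualNumber {A C : Type*} [CommRing A] [CommRing C] {ρ : A →+* C}
    {δ : A →+ C} (h : IsDerivationAlong ρ δ) : A →+* DualNumber C where
  toFun a := TrivSqZeroExt.inl (ρ a) + TrivSqZeroExt.inr (δ a)
  map_one' := by ext <;> simp [h.map_one]
  map_mul' a b := by
    ext
    · simp
    · simp [h a b, mul_comm]
  map_zero' := by ext <;> simp
  map_add' a b := by ext <;> simp

theorem isDerivationAlong_snd {A C : Type*} [CommRing A] [CommRing C] (φ : A →+* DualNumber C) :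
    IsDerivationAlong ((TrivSqZeroExt.fstHom C C C).toRingHom.comp φ)
      ((TrivSqZeroExt.sndHom C C).toAddMonoidHom.comp φ.toAddMonoidHom) := by
  intro a b
  change (φ (a * b)).snd = (φ a).fst * (φ b).snd + (φ b).fst * (φ a).snd
  rw [map_mul, TrivSqZeroExt.snd_mul]
  simp [mul_comm]

/-- A derivation along ρ is the ε-part of a ring homomorphism to C[ε]. An element of C[ε] is a unit
iff its constant term is, so this homomorphism extends to the localization as soon as ρ does. -/
theorem IsDerivationAlong.exists_extension {A A' C : Type*} [CommRing A] [CommRing A'] [CommRing C]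
    [Algebra A A'] (M : Submonoid A) [IsLocalization M A'] {ρ : A' →+* C} {δ : A →+ C}
    (h : IsDerivationAlong (ρ.comp (algebraMap A A')) δ) :
    ∃ δ' : A' →+ C, IsDerivationAlong ρ δ' ∧ ∀ a, δ' (algebraMap A A' a) = δ a := by
  have hu : ∀ y : M, IsUnit (h.toDualNumber y) := by
    intro y
    rw [TrivSqZeroExt.isUnit_iff_isUnit_fst]
    have : (h.toDualNumber y).fst = ρ (algebraMap A A' y) := by
      simp [IsDerivationAlong.toDualNumber]
    rw [this]
    exact (IsLocalization.map_units A' y).map ρ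
  let φ : A' →+* DualNumber C := IsLocalization.lift hu
  have h1 : (TrivSqZeroExt.fstHom C C C).toRingHom.comp φ = ρ := by
    refine IsLocalization.ringHom_ext M ?_
    ext a
    change (φ (algebraMap A A' a)).fst = _
    rw [IsLocalization.lift_eq]
    simp [IsDerivationAlong.toDualNumber]
  refine ⟨(TrivSqZeroExt.sndHom C C).toAddMonoidHom.comp φ.toAddMonoidHom, ?_, fun a => ?_⟩
  · have := isDerivationAlong_snd φ
    rwa [h1] at this
  · change (φ (algebraMap A A' a)).snd = _
    rw [IsLocalization.lift_eq]
    simp [IsDerivationAlong.toDualNumber]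

/-- Derivations of a smooth algebra lift along surjections. -/
theorem IsDerivationAlong.exists_lift {k A K : Type u} [CommRing k] [CommRing A] [CommRing K]
    {iA : k →+* A} (hA : iA.FormallySmooth) {ρ : A →+* K} (hρ : Function.Surjective ρ)
    {δ : A →+ K} (h : IsDerivationAlong ρ δ) (hk : ∀ c, δ (iA c) = 0) :
    ∃ D : Derivation ℤ A A, (∀ c, D (iA c) = 0) ∧ ∀ a, ρ (D a) = δ a := by
  let _ := iA.toAlgebra
  let _ := ρ.toAlgebra
  let _ := (ρ.comp iA).toAlgebra
  have : IsScalarTower k A K := IsScalarTower.of_algebraMap_eq fun _ => rfl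
  have : Algebra.FormallySmooth k A := hA
  have hsmul : ∀ (a : A) (b : K), a • b = ρ a * b := fun a b => Algebra.smul_def a b
  have hsmul' : ∀ (c : k) (b : K), c • b = ρ (iA c) * b := fun a b => Algebra.smul_def a b
  let D₀ : Derivation k A K := Derivation.mk'
    { toFun := δ
      map_add' := map_add δ
      map_smul' := fun c a => by
        rw [Algebra.smul_def, RingHom.id_apply, hsmul']
        change δ (iA c * a) = _
        rw [h, hk, mul_zero, add_zero] }
    (fun a b => by
      rw [hsmul, hsmul]
      exact h a b)
  -- The Kähler differentials of a formally smooth algebra are projective, so the linear map to K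
  -- corresponding to δ lifts through the surjection ρ.
  obtain ⟨L, hL⟩ := Module.projective_lifting_property (Algebra.linearMap A K)
    D₀.liftKaehlerDifferential hρ
  refine ⟨(L.compDer (KaehlerDifferential.D k A)).restrictScalars ℤ, fun c => ?_, fun a => ?_⟩
  · exact Derivation.map_algebraMap (L.compDer (KaehlerDifferential.D k A)) c
  · have h1 := LinearMap.congr_fun hL (KaehlerDifferential.D k A a)
    rw [Derivation.liftKaehlerDifferential_comp_D] at h1
    exact h1

/-- Transversality follows if enough deformations are induced by vector fields. -/
theorem isTransversal_of_isUnit_det {k A : Type u} [CommRing k] [CommRing A] {iA : k →+* A}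
    {g : Fin l → Matrix (Fin d) (Fin d) A} {ι : Type} [Fintype ι] [DecidableEq ι]
    (v : ι → Fin l × Fin d × Fin d)
    (hv : ∀ i p q, q < p → ∃ y, v y = (i, p, q))
    (D : ι → Derivation ℤ A A) (hD : ∀ x c, D x (iA c) = 0) (N : ι → Matrix (Fin d) (Fin d) A)
    (h : IsUnit (Matrix.of fun x y : ι => ((g (v y).1).map (D x) * (g (v y).1)⁻¹ +
      g (v y).1 * N x * (g (v y).1)⁻¹) (v y).2.1 (v y).2.2)) : IsTransversal iA g := by
  set R : ι → Fin l → Matrix (Fin d) (Fin d) A := fun x i =>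
    (g i).map (D x) * (g i)⁻¹ + g i * N x * (g i)⁻¹ with hR
  set Mat : Matrix ι ι A := Matrix.of fun x y : ι => R x (v y).1 (v y).2.1 (v y).2.2 with hMat
  intro E
  -- Only strictly lower triangular entries of E need to be matched, and v reaches all of them.
  -- Inverting the coefficient matrix gives weights w that match them.
  let w : ι → A := Matrix.vecMul (fun y => E (v y).1 (v y).2.1 (v y).2.2) Mat⁻¹
  have hw : ∀ y, ∑ x, w x * R x (v y).1 (v y).2.1 (v y).2.2 = E (v y).1 (v y).2.1 (v y).2.2 := by
    intro y
    have h1 : Matrix.vecMul w Mat = fun y => E (v y).1 (v y).2.1 (v y).2.2 := by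
      simp only [w]
      rw [Matrix.vecMul_vecMul, Matrix.nonsing_inv_mul _ ((Matrix.isUnit_iff_isUnit_det _).mp h),
        Matrix.vecMul_one]
    exact congrFun h1 y
  refine ⟨∑ x, w x • D x, fun c => ?_, ∑ x, w x • N x, fun i p q hqp => ?_⟩
  · rw [← Derivation.coeFnAddMonoidHom_apply, map_sum, Finset.sum_apply]
    refine Finset.sum_eq_zero fun x _ => ?_
    rw [Derivation.coeFnAddMonoidHom_apply, Derivation.smul_apply, hD, smul_zero]
  · obtain ⟨y, hy⟩ := hv i p q hqp
    have h2 := hw y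
    rw [hy] at h2
    have h3 : (g i).map ⇑(∑ x, w x • D x) = ∑ x, w x • (g i).map (D x) := by
      ext p q
      rw [Matrix.map_apply, ← Derivation.coeFnAddMonoidHom_apply, map_sum, Finset.sum_apply, Matrix.sum_apply]
      rfl
    have h4 : (g i).map ⇑(∑ x, w x • D x) * (g i)⁻¹ + g i * (∑ x, w x • N x) * (g i)⁻¹ =
        ∑ x, w x • R x i := by
      rw [h3, Finset.sum_mul, Finset.mul_sum, Finset.sum_mul, ← Finset.sum_add_distrib]
      refine Finset.sum_congr rfl fun x _ => ?_
      rw [hR, smul_add, Matrix.mul_smul, Matrix.smul_mul, Matrix.smul_mul]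
    rw [h4, Matrix.sub_apply, Matrix.sum_apply, ← h2, sub_eq_zero]
    rfl

/-- If every deformation of the flags at a point is induced by a tangent vector, then the flags
are transversal in a neighbourhood of the point. -/
theorem exists_isTransversal_away {k A K : Type u} [CommRing k] [CommRing A] [CommRing K]
    [Nontrivial K] {iA : k →+* A} (hA : iA.FormallySmooth) {g : Fin l → Matrix (Fin d) (Fin d) A}
    (hg : ∀ i, IsUnit (g i)) {ρ : A →+* K} (hρ : Function.Surjective ρ)
    (h : ∀ E : Fin l → Matrix (Fin d) (Fin d) K, ∃ δ : A →+ K, IsDerivationAlong ρ δ ∧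
      (∀ c, δ (iA c) = 0) ∧ ∃ N : Matrix (Fin d) (Fin d) K, ∀ i,
        ((g i).map δ * ((g i).map ρ)⁻¹ + (g i).map ρ * N * ((g i).map ρ)⁻¹ -
          E i).BlockTriangular id) :
    ∃ f : A, ρ f ≠ 0 ∧ ∀ (A' : Type u) [CommRing A'] [Algebra A A'] [IsLocalization.Away f A'],
      IsTransversal ((algebraMap A A').comp iA) fun i => (g i).map (algebraMap A A') := by
  classical
  -- The strictly lower triangular positions in the l matrices index a basis of the space of
  -- first-order deformations of the flags. Each basis vector is realized at the point, then its
  -- derivation and matrix are lifted to A.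
  let ι := {y : Fin l × Fin d × Fin d // y.2.2 < y.2.1}
  let E : ι → Fin l → Matrix (Fin d) (Fin d) K := fun x i =>
    if i = x.1.1 then Matrix.single x.1.2.1 x.1.2.2 1 else 0
  choose δ hδ hδk N hN using fun x => h (E x)
  choose D hDk hD using fun x => (hδ x).exists_lift hA hρ (hδk x)
  choose m hm using fun x p q => hρ (N x p q)
  let N' : ι → Matrix (Fin d) (Fin d) A := fun x => Matrix.of (m x)
  have hN' : ∀ x, (N' x).map ρ = N x := fun x => by ext p q; exact hm x p q
  let R : ι → Fin l → Matrix (Fin d) (Fin d) A := fun x i =>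
    (g i).map (D x) * (g i)⁻¹ + g i * N' x * (g i)⁻¹
  have hR : ∀ x i, ((R x i).map ρ - E x i).BlockTriangular id := by
    intro x i
    have h1 : (R x i).map ρ = (g i).map (δ x) * ((g i).map ρ)⁻¹ +
        (g i).map ρ * N x * ((g i).map ρ)⁻¹ := by
      simp only [R]
      rw [Matrix.map_add _ (map_add ρ), Matrix.map_mul, Matrix.map_mul, Matrix.map_mul, hN',
        map_nonsing_inv _ (hg i)]
      congr 2
      ext p q
      exact hD x _
    rw [h1]
    exact hN x i
  let Mat : Matrix ι ι A := Matrix.of fun x y => R x y.1.1 y.1.2.1 y.1.2.2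
  -- At the point the lifted data induce exactly the basis deformations, so the determinant of `Mat`
  -- is 1 there. Inverting this determinant gives the neighbourhood.
  have hMat : Mat.map ρ = 1 := by
    ext x y
    have h2 : ρ (R x y.1.1 y.1.2.1 y.1.2.2) - E x y.1.1 y.1.2.1 y.1.2.2 = 0 :=
      hR x y.1.1 y.2
    rw [sub_eq_zero] at h2
    refine h2.trans ?_
    simp only [E]
    by_cases hxy : x = y
    · subst hxy
      simp
    · rw [Matrix.one_apply_ne hxy]
      split_ifs with hi
      · rw [Matrix.single_apply, if_neg]
        rintro ⟨h3, h4⟩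
        exact hxy (Subtype.ext (Prod.ext hi.symm (Prod.ext h3 h4)))
      · rfl
  refine ⟨Mat.det, ?_, ?_⟩
  · have h5 : ρ Mat.det = (Mat.map ρ).det := RingHom.map_det ρ Mat
    rw [h5, hMat, Matrix.det_one]
    exact one_ne_zero
  · intro A' _ _ _
    have h6 : ∀ x, IsDerivationAlong ((RingHom.id A').comp (algebraMap A A'))
        ((algebraMap A A').toAddMonoidHom.comp (D x : A →+ A)) := by
      intro x a b
      change algebraMap A A' (D x (a * b)) = algebraMap A A' a * algebraMap A A' (D x b) +
        algebraMap A A' b * algebraMap A A' (D x a)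
      rw [Derivation.leibniz, map_add, smul_eq_mul, smul_eq_mul, map_mul, map_mul]
    -- The vector fields extend to the localization, where the coefficient matrix becomes
    -- invertible.
    choose δ' hδ' hδ'D using fun x => (h6 x).exists_extension (Submonoid.powers Mat.det)
    let D' : ι → Derivation ℤ A' A' := fun x => Derivation.mk' (δ' x).toIntLinearMap (hδ' x)
    have hD' : ∀ x a, D' x (algebraMap A A' a) = algebraMap A A' (D x a) := hδ'D
    refine isTransversal_of_isUnit_det Subtype.val (fun i p q hqp => ⟨⟨(i, p, q), hqp⟩, rfl⟩) D'
      (fun x c => ?_) (fun x => (N' x).map (algebraMap A A')) ?_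
    · rw [RingHom.comp_apply, hD', hDk, map_zero]
    · have h7 : IsUnit (Mat.map (algebraMap A A')) := by
        rw [Matrix.isUnit_iff_isUnit_det]
        have h8 : algebraMap A A' Mat.det = (Mat.map (algebraMap A A')).det :=
          RingHom.map_det (algebraMap A A') Mat
        rw [← h8]
        exact IsLocalization.Away.algebraMap_isUnit _
      refine cast (congrArg IsUnit ?_) h7
      ext x y
      have h9 : (R x y.1.1).map (algebraMap A A') =
          ((g y.1.1).map (algebraMap A A')).map (D' x) * ((g y.1.1).map (algebraMap A A'))⁻¹ +
          (g y.1.1).map (algebraMap A A') * (N' x).map (algebraMap A A') *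
            ((g y.1.1).map (algebraMap A A'))⁻¹ := by
        simp only [R]
        rw [Matrix.map_add _ (map_add (algebraMap A A')), Matrix.map_mul, Matrix.map_mul,
          Matrix.map_mul, map_nonsing_inv _ (hg _)]
        congr 2
        ext p q
        exact (hD' x _).symm
      exact congrFun (congrFun h9 y.1.2.1) y.1.2.2

end DerivationsAlong

/-! ### The relative deformation map in a chart -/

section RelativeDeformationChart

variable {k : Type u} [Field k] {S : Scheme.{u}} (f : S ⟶ Spec (.of k)) {d l : ℕ}
  {H : VectorBundle S d} {P : Fin l → CompleteFlag H}

/-- The evaluation of functions at a point. -/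
def evalFun {x : S} {U : S.Opens} (hx : x ∈ U) :
    Γ(S, U) →+* IsLocalRing.ResidueField (S.presheaf.stalk x) :=
  (IsLocalRing.residue _).comp (funGerm hx)

theorem fieldToStalk_eq {x : S} {U : S.Opens} (hx : x ∈ U) (c : k) :
    fieldToStalk f x c = funGerm hx (structureFun f U c) :=
  (funGerm_res le_top hx _).symm

theorem evalFun_eq_zero_iff {x : S} {U : S.Opens} (hx : x ∈ U) (r : Γ(S, U)) :
    evalFun hx r = 0 ↔ x ∉ S.basicOpen r := by
  rw [Scheme.mem_basicOpen S r x hx]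
  exact (IsLocalRing.residue_eq_zero_iff _).trans (IsLocalRing.mem_maximalIdeal _)

/-- A closed point of an affine open corresponds to a maximal ideal, whose quotient is already the
residue field. Surjectivity is needed to lift derivations and matrices from κ(x) to functions. -/
theorem evalFun_surjective {x : S} {U : S.Opens} (hU : IsAffineOpen U) (hx : x ∈ U)
    (hcl : IsClosed ({x} : Set S)) : Function.Surjective (evalFun hx) := by
  let _ := S.presheaf.algebra_section_stalk ⟨x, hx⟩
  have := hU.isLocalization_stalk ⟨x, hx⟩
  have := hU.primeIdealOf_isMaximal_of_isClosed ⟨x, hx⟩ hcl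
  intro r
  obtain ⟨q, hq⟩ := (IsLocalization.AtPrime.equivQuotMaximalIdeal
    (hU.primeIdealOf ⟨x, hx⟩).asIdeal (S.presheaf.stalk x)).surjective r
  obtain ⟨a, rfl⟩ := Ideal.Quotient.mk_surjective q
  exact ⟨a, hq⟩

/-- Replaces the stalk by the coordinate ring of the chart. Derivations of the stalk restrict to
derivations along evaluation, and conversely these extend since the stalk is a localization. -/
theorem FlagChart.relDeformation_surjective_iff (c : FlagChart P) {x : S} (hx : x ∈ c.U) :
    Function.Surjective (relDeformation f P x) ↔
      ∀ E : Fin l → Matrix (Fin d) (Fin d) (IsLocalRing.ResidueField (S.presheaf.stalk x)),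
        ∃ δ : Γ(S, c.U) →+ IsLocalRing.ResidueField (S.presheaf.stalk x),
          IsDerivationAlong (evalFun hx) δ ∧ (∀ r, δ (structureFun f c.U r) = 0) ∧
          ∃ N : Matrix (Fin d) (Fin d) (IsLocalRing.ResidueField (S.presheaf.stalk x)), ∀ i,
            ((c.g i).map δ * ((c.g i).map (evalFun hx))⁻¹ +
              (c.g i).map (evalFun hx) * N * ((c.g i).map (evalFun hx))⁻¹ -
                E i).BlockTriangular id := by
  -- The frame in the definition of the relative deformation map is an arbitrary choice;
  -- independence allows the frame of the chart instead.
  have h0 := relDeriv_eq (H.frameAt x) (c.frame.stalkBasis hx) fun i => (P i).isFlag_stalk x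
  have h1 : Function.Surjective (relDeformation f P x) ↔ Function.Surjective
      (relDeriv (c.frame.stalkBasis hx) (fun i => (P i).isFlag_stalk x) ∘ₗ
        (tangentSpace f x).subtype) :=
    iff_of_eq (congrArg (fun q => Function.Surjective (q ∘ₗ (tangentSpace f x).subtype)) h0)
  refine h1.trans <| (relDeriv_surjective_iff (c.frame.stalkBasis hx)
    (G := fun i => (c.g i).map (funGerm hx)) (fun i => isUnit_map (funGerm hx) (c.isUnit i))
    (t := fun i p => ∑ j, (c.g i).map (funGerm hx) p j • c.frame.stalkBasis hx j)
    (fun _ _ => rfl) (fun i => (P i).isFlag_stalk x) (fun i => c.stalk_eq hx i) _).trans ?_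
  have e1 : ∀ i, ((c.g i).map (funGerm hx)).map (IsLocalRing.residue _) =
      (c.g i).map (evalFun hx) := fun i => rfl
  simp only [e1]
  refine forall_congr' fun E => ⟨?_, ?_⟩
  · rintro ⟨D, hD, N, hN⟩
    refine ⟨(D : _ →+ _).comp (funGerm hx).toAddMonoidHom, ?_, ?_, N,
      fun i => cast (congrArg (fun M => Matrix.BlockTriangular M id) ?_) (hN i)⟩
    · intro a b
      change D (funGerm hx (a * b)) = _
      rw [map_mul, Derivation.leibniz, Algebra.smul_def, Algebra.smul_def]
      rfl
    · intro r
      have := hD r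
      rwa [fieldToStalk_eq f hx] at this
    · congr 3
  · rintro ⟨δ, hδ, hδk, N, hN⟩
    let _ := S.presheaf.algebra_section_stalk ⟨x, hx⟩
    have := c.affine.isLocalization_stalk ⟨x, hx⟩
    obtain ⟨δ', hδ', hδ'δ⟩ := IsDerivationAlong.exists_extension (A' := S.presheaf.stalk x)
      (c.affine.primeIdealOf ⟨x, hx⟩).asIdeal.primeCompl
      (ρ := IsLocalRing.residue (S.presheaf.stalk x)) hδ
    refine ⟨Derivation.mk' δ'.toIntLinearMap fun a b => ?_, fun r => ?_, N, fun i => ?_⟩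
    · rw [Algebra.smul_def, Algebra.smul_def]
      exact hδ' a b
    · rw [fieldToStalk_eq f hx]
      exact (hδ'δ _).trans (hδk r)
    · refine cast (congrArg (fun M => Matrix.BlockTriangular M id) ?_) (hN i)
      congr 3
      ext p q
      exact (hδ'δ _).symm

end RelativeDeformationChart

/-! ### Smoothness of the base in terms of rings -/

section SmoothBase

variable {k : Type u} [Field k] {S : Scheme.{u}} (f : S ⟶ Spec (.of k)) {V : S.Opens}

theorem fromSpec_comp_eq (hV : IsAffineOpen V) :
    hV.fromSpec ≫ f = Spec.map (CommRingCat.ofHom (structureFun f V)) := by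
  have h0 : ⊤ ≤ hV.fromSpec ⁻¹ᵁ V := hV.fromSpec_preimage_self.ge
  apply specFun_injective
  rw [specFun_comp_eq f hV.fromSpec h0, specFun_SpecMap]
  have h1 := pullFun_comp_fromSpec hV (𝟙 _) (top_le_preimage_fromSpec hV (𝟙 _))
  rw [specFun_id] at h1
  have h2 : pullFun hV.fromSpec h0 = (Scheme.ΓSpecIso Γ(S, V)).inv.hom := by
    rw [← h1]
    congr 1
  rw [h2]
  rfl

/-- Over a field, which is Noetherian, finite type and finite presentation coincide. -/
theorem finitePresentation_structureFun [LocallyOfFiniteType f] (hV : IsAffineOpen V) :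
    (structureFun f V).FinitePresentation := by
  have h : LocallyOfFiniteType (hV.fromSpec ≫ f) := inferInstance
  rw [fromSpec_comp_eq, HasRingHomProperty.Spec_iff (P := @LocallyOfFiniteType)] at h
  exact RingHom.FinitePresentation.of_finiteType.mp h

theorem smooth_structureFun {W : S.Opens} (hW : Smooth (W.ι ≫ f)) (hV : IsAffineOpen V)
    (h : V ≤ W) : (structureFun f V).Smooth := by
  have h1 : Set.range hV.fromSpec ⊆ Set.range W.ι := by
    rw [hV.range_fromSpec, Scheme.Opens.range_ι]
    exact h
  have h2 : Smooth (hV.fromSpec ≫ f) := by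
    rw [← IsOpenImmersion.lift_fac W.ι hV.fromSpec h1, Category.assoc]
    have : IsOpenImmersion (IsOpenImmersion.lift W.ι hV.fromSpec h1) := by
      refine @IsOpenImmersion.of_comp _ _ _ _ W.ι _ ?_
      rw [IsOpenImmersion.lift_fac]
      infer_instance
    infer_instance
  rw [fromSpec_comp_eq, HasRingHomProperty.Spec_iff (P := @Smooth)] at h2
  exact h2

theorem isSmoothAt_of_smooth (hV : IsAffineOpen V) {x : S} (hx : x ∈ V)
    (h : (structureFun f V).Smooth) : IsSmoothAt f x := by
  refine ⟨V, hx, ?_⟩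
  have h2 : Smooth (hV.fromSpec ≫ f) := by
    rw [fromSpec_comp_eq, HasRingHomProperty.Spec_iff (P := @Smooth)]
    exact h
  have h3 : IsIso V.toSpecΓ := by
    rw [← hV.isoSpec_hom]
    infer_instance
  rw [← hV.toSpecΓ_fromSpec, Category.assoc]
  infer_instance

variable {d l : ℕ} {H : VectorBundle S d} {P : Fin l → CompleteFlag H}

/-- Surjectivity at x yields a function r with r(x) ≠ 0 such that the flags are transversal where r
is invertible; the chart restricted to that basic open is still affine and smooth over k, so
`FlagChart.isVersalOn` applies. -/
theorem isVersalAt_of_isSmoothAt {x : S} (hcl : IsClosed ({x} : Set S)) (hf : IsSmoothAt f x)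
    (h : Function.Surjective (relDeformation f P x)) : IsVersalAt f P x := by
  obtain ⟨W, hxW, hW⟩ := hf
  obtain ⟨c, hx, hcW⟩ := exists_flagChart P W x hxW
  rw [c.relDeformation_surjective_iff f hx] at h
  obtain ⟨r, hr, hr'⟩ := exists_isTransversal_away
    ((RingHom.smooth_def.mp (smooth_structureFun f hW c.affine hcW)).1) c.isUnit
    (evalFun_surjective c.affine hx hcl) h
  have hle : S.basicOpen r ≤ c.U := S.basicOpen_le r
  have hV : IsAffineOpen (S.basicOpen r) := c.affine.basicOpen r
  have hxV : x ∈ S.basicOpen r := by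
    by_contra hn
    exact hr ((evalFun_eq_zero_iff hx r).mpr hn)
  have hloc := c.affine.isLocalization_basicOpen r
  refine ⟨(c.restrict hV hle).U, hxV, (c.restrict hV hle).isVersalOn f
    (smooth_structureFun f hW hV (hle.trans hcW)) ?_⟩
  have h1 := hr' Γ(S, S.basicOpen r)
  have h2 : structureFun f (S.basicOpen r) = (resFun hle).comp (structureFun f c.U) := by
    ext t
    exact (resFun_resFun _ _ _).symm
  change IsTransversal (structureFun f (S.basicOpen r)) _
  rw [h2]
  exact h1

end SmoothBase

/-! ### Coordinates of points of the frame bundle -/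

section Coordinates

variable {k : Type u} [Field k] {S : Scheme.{u}} {d l : ℕ}
  {H : VectorBundle S d} {P : Fin l → CompleteFlag H} {B C C' : CommRingCat.{u}}

/-- The coordinates in a chart of a point of the frame bundle with values in a ring. -/
def FlagChart.HasCoordinates (c : FlagChart P) (y : FramePoint H (Spec C)) (α : Γ(S, c.U) →+* C)
    (M : Matrix (Fin d) (Fin d) C) : Prop :=
  ∃ hy : ⊤ ≤ y.base ⁻¹ᵁ c.U, pullFun y.base hy = (Scheme.ΓSpecIso C).inv.hom.comp α ∧
    y.mat hy c.e = M.map (Scheme.ΓSpecIso C).inv.hom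

theorem ΓSpecIso_inv_injective : Function.Injective (Scheme.ΓSpecIso C).inv.hom :=
  ((Scheme.ΓSpecIso C).symm.commRingCatIsoToRingEquiv).injective

theorem FlagChart.HasCoordinates.unique {c : FlagChart P} {y : FramePoint H (Spec C)}
    {α α' : Γ(S, c.U) →+* C} {M M' : Matrix (Fin d) (Fin d) C} (h : c.HasCoordinates y α M)
    (h' : c.HasCoordinates y α' M') : α = α' ∧ M = M' := by
  obtain ⟨hy, h1, h2⟩ := h
  obtain ⟨_, h1', h2'⟩ := h'
  constructor
  · ext a
    exact ΓSpecIso_inv_injective (RingHom.congr_fun (h1.symm.trans h1') a)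
  · ext p q
    exact ΓSpecIso_inv_injective (congrFun (congrFun (h2.symm.trans h2') p) q)

theorem FlagChart.exists_coordinates (c : FlagChart P) (y : FramePoint H (Spec C))
    (hy : ⊤ ≤ y.base ⁻¹ᵁ c.U) : ∃ α M, c.HasCoordinates y α M := by
  refine ⟨(Scheme.ΓSpecIso C).hom.hom.comp (pullFun y.base hy),
    (y.mat hy c.e).map (Scheme.ΓSpecIso C).hom.hom, hy, ?_, ?_⟩
  · ext a
    exact (Iso.hom_inv_id_apply (Scheme.ΓSpecIso C) _).symm
  · ext p q
    exact (Iso.hom_inv_id_apply (Scheme.ΓSpecIso C) _).symm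

theorem FlagChart.exists_hasCoordinates (c : FlagChart P) (α : Γ(S, c.U) →+* C)
    {M : Matrix (Fin d) (Fin d) C} (hM : IsUnit M) : ∃ y, c.HasCoordinates y α M := by
  obtain ⟨b, hb, hbα⟩ := exists_pullFun_eq (T := Spec C) c.affine
    ((Scheme.ΓSpecIso C).inv.hom.comp α)
  exact ⟨FramePoint.ofMat b hb c.frame (M.map (Scheme.ΓSpecIso C).inv.hom)
    (isUnit_map (Scheme.ΓSpecIso C).inv.hom hM), hb, hbα, FramePoint.ofMat_mat b hb _ _ _⟩

theorem FlagChart.HasCoordinates.pullback {c : FlagChart P} {y : FramePoint H (Spec C)}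
    {α : Γ(S, c.U) →+* C} {M : Matrix (Fin d) (Fin d) C} (h : c.HasCoordinates y α M)
    (φ : C ⟶ C') : c.HasCoordinates (y.pullback (Spec.map φ)) (φ.hom.comp α) (M.map φ.hom) := by
  obtain ⟨hy, h1, h2⟩ := h
  have hy' : ⊤ ≤ (y.pullback (Spec.map φ)).base ⁻¹ᵁ c.U :=
    fun t _ => hy (trivial : Spec.map φ t ∈ (⊤ : (Spec C).Opens))
  have h3 : ∀ r : C, (Spec.map φ).appTop.hom ((Scheme.ΓSpecIso C).inv.hom r) =
      (Scheme.ΓSpecIso C').inv.hom (φ.hom r) := fun r =>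
    (congrArg (fun q => q.hom r) (Scheme.ΓSpecIso_inv_naturality φ)).symm
  refine ⟨hy', ?_, ?_⟩
  · refine (pullFun_comp (Spec.map φ) y.base hy hy').trans ?_
    rw [h1]
    ext r
    exact h3 _
  · rw [FramePoint.pullback_mat (Spec.map φ) y hy hy', h2]
    ext p q
    exact h3 _

/-- Used to pass between C and the isomorphic ring of global functions on Spec C. -/
theorem isCompatible_equiv_iff {k A B : Type u} {C C' : Type*} [CommRing k]
    [CommRing A] [CommRing B] [CommRing C] [CommRing C'] {iA : k →+* A} {iB : k →+* B} {g : Fin l → Matrix (Fin d) (Fin d) A}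
    {L : Fin l → Matrix (Fin d) (Fin d) B} {α : A →+* C} {γ : B →+* C}
    {M : Matrix (Fin d) (Fin d) C} (e : C ≃+* C') :
    IsCompatible iA iB g L ((e : C →+* C').comp α) ((e : C →+* C').comp γ) (M.map e) ↔
      IsCompatible iA iB g L α γ M := by
  refine ⟨fun h => ?_, fun h => h.comp (e : C →+* C')⟩
  have h1 := h.comp (e.symm : C' →+* C)
  have h2 : ∀ {D : Type u} [CommRing D] (β : D →+* C),
      (e.symm : C' →+* C).comp ((e : C →+* C').comp β) = β := by
    intro D _ β
    ext r
    exact e.symm_apply_apply _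
  have h3 : (M.map e).map (e.symm : C' →+* C) = M := by
    ext p q
    exact e.symm_apply_apply _
  rwa [h2, h2, h3] at h1

variable (f : S ⟶ Spec (.of k))

theorem FlagChart.HasCoordinates.flags_eq_iff {c : FlagChart P} {y : FramePoint H (Spec C)}
    {α : Γ(S, c.U) →+* C} {M : Matrix (Fin d) (Fin d) C} (h : c.HasCoordinates y α M)
    (iB : CommRingCat.of k ⟶ B) (K : Fin l → Matrix (Fin d) (Fin d) B)
    (hK : ∀ i, IsUnit (K i)) (γ : B ⟶ C) :
    ((y.base ≫ f, fun i => y.flag (P i)) :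
      (Spec C ⟶ Spec (.of k)) × (Fin l → TrivialFlag (Spec C) d)) =
      (specFlags iB K hK).app (op (Spec C)) (Spec.map γ) ↔
    IsCompatible (structureFun f c.U) iB.hom c.g (fun i => (K i)⁻¹) α γ.hom M := by
  obtain ⟨hy, h1, h2⟩ := h
  refine (c.flags_eq_iff f y hy iB K hK (Spec.map γ)).trans ?_
  rw [h1, h2, specFun_SpecMap]
  exact isCompatible_equiv_iff (Scheme.ΓSpecIso C).symm.commRingCatIsoToRingEquiv

variable {f} {W : S.Opens} {X : Scheme.{u}} {p : yoneda.obj X ⟶ frameBundle H W} {q : X ⟶ Spec B}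
  {iB : CommRingCat.of k ⟶ B} {K : Fin l → Matrix (Fin d) (Fin d) B} {hK : ∀ i, IsUnit (K i)}

theorem app_comp (p : yoneda.obj X ⟶ frameBundle H W) {T T' : Scheme.{u}} (h : T' ⟶ T)
    (w : T ⟶ X) : (p.app (op T') (h ≫ w)).1 = (p.app (op T) w).1.pullback h :=
  congrArg Subtype.val (NatTrans.naturality_apply p h.op w)

/-- Compatible coordinates define points of the fibre product. -/
theorem FlagChart.exists_point (c : FlagChart P) (hc : c.U ≤ W)
    (h : IsPullback p (yoneda.map q) (frameToFlags f P W) (specFlags iB K hK))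
    {α : Γ(S, c.U) →+* C} {γ : B ⟶ C} {M : Matrix (Fin d) (Fin d) C}
    (hα : IsCompatible (structureFun f c.U) iB.hom c.g (fun i => (K i)⁻¹) α γ.hom M) :
    ∃ w : Spec C ⟶ X, w ≫ q = Spec.map γ ∧ c.HasCoordinates (p.app (op (Spec C)) w).1 α M := by
  obtain ⟨y, hy⟩ := c.exists_hasCoordinates α hα.isUnit
  obtain ⟨w, h1, h2⟩ := ((isPullback_presheaf_iff.mp h).2 (op (Spec C))).2
    ⟨y, fun t => hc (hy.1 trivial)⟩ (Spec.map γ) ((hy.flags_eq_iff f iB K hK γ).mpr hα)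
  exact ⟨w, h2, h1.symm ▸ hy⟩

/-- The fibre product is covered by spectra of rings with compatible coordinates. -/
theorem FlagChart.exists_affine_nhds (c : FlagChart P)
    (h : IsPullback p (yoneda.map q) (frameToFlags f P W) (specFlags iB K hK)) (hq : Smooth q)
    (x : X) (hx : (p.app (op X) (𝟙 X)).1.base x ∈ c.U) :
    ∃ (R : CommRingCat.{u}) (j : Spec R ⟶ X), IsOpenImmersion j ∧ x ∈ Set.range j ∧
      ∃ (θ : B ⟶ R) (α : Γ(S, c.U) →+* R) (M : Matrix (Fin d) (Fin d) R),
        j ≫ q = Spec.map θ ∧ θ.hom.Smooth ∧ c.HasCoordinates (p.app (op (Spec R)) j).1 α M ∧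
        IsCompatible (structureFun f c.U) iB.hom c.g (fun i => (K i)⁻¹) α θ.hom M := by
  set y := (p.app (op X) (𝟙 X)).1
  obtain ⟨R, j, hj, hxj, hjU⟩ := Scheme.exists_affine_mem_range_and_range_subset
    (U := y.base ⁻¹ᵁ c.U) hx
  have h1 : (p.app (op (Spec R)) j).1 = y.pullback j := by
    have := app_comp p j (𝟙 X)
    rwa [Category.comp_id] at this
  have hy : ⊤ ≤ (p.app (op (Spec R)) j).1.base ⁻¹ᵁ c.U := by
    rw [h1]
    exact fun t _ => hjU ⟨t, rfl⟩
  obtain ⟨α, M, hαM⟩ := c.exists_coordinates _ hy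
  obtain ⟨θ, hθ⟩ := Spec.map_surjective (j ≫ q)
  refine ⟨R, j, hj, hxj, θ, α, M, hθ.symm, ?_, hαM, ?_⟩
  · have h2 : Smooth (j ≫ q) := inferInstance
    rwa [← hθ, HasRingHomProperty.Spec_iff (P := @Smooth)] at h2
  · refine (hαM.flags_eq_iff f iB K hK θ).mp ?_
    rw [hθ]
    exact congrArg (fun η => η.app (op (Spec R)) j) h.w

end Coordinates

/-! ### Consequences of versality -/

section Versal

variable {k : Type u} [Field k] {S : Scheme.{u}} {f : S ⟶ Spec (.of k)} {d l : ℕ}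
  {H : VectorBundle S d} {P : Fin l → CompleteFlag H} {W : S.Opens}

theorem IsVersalOn.exists_isPullback (h : IsVersalOn f P W) {B : CommRingCat.{u}}
    (g : yoneda.obj (Spec B) ⟶ flagVarietyPow k d l) :
    ∃ (X : Scheme.{u}) (p : yoneda.obj X ⟶ frameBundle H W) (q : X ⟶ Spec B),
      IsPullback p (yoneda.map q) (frameToFlags f P W) g ∧ Smooth q :=
  ⟨_, _, _, h.rep.isPullback g, h.property _ _ _ (h.rep.isPullback g)⟩

theorem FlagChart.HasCoordinates.base_mem {c : FlagChart P} {C : CommRingCat.{u}}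
    {y : FramePoint H (Spec C)} {α : Γ(S, c.U) →+* C} {M : Matrix (Fin d) (Fin d) C}
    (h : c.HasCoordinates y α M) (t : Spec C) : y.base t ∈ c.U :=
  h.1 trivial

/-! ### Surjectivity of the relative deformation map from versality -/

/-- Points of a formally smooth algebra over the dual numbers lift to sections. -/
theorem exists_lift_dualNumber {K : Type u} [Field K] {R : Type u} [CommRing R]
    {θ : DualNumber K →+* R} (hθ : θ.FormallySmooth) {φ : R →+* K}
    (h : φ.comp θ = (TrivSqZeroExt.fstHom K K K).toRingHom) :
    ∃ ψ : R →+* DualNumber K, ψ.comp θ = RingHom.id _ ∧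
      (TrivSqZeroExt.fstHom K K K).toRingHom.comp ψ = φ := by
  let _ := θ.toAlgebra
  have : Algebra.FormallySmooth (DualNumber K) R := hθ
  -- K is an algebra over the dual numbers through ε ↦ 0. The kernel of this map has square zero, so
  -- φ lifts by formal smoothness.
  let _ : Algebra (DualNumber K) K := (TrivSqZeroExt.fstHom K K K).toRingHom.toAlgebra
  let π : DualNumber K →ₐ[DualNumber K] K := Algebra.ofId _ _
  have hπ : Function.Surjective π := fun r =>
    ⟨(TrivSqZeroExt.inl r : DualNumber K), TrivSqZeroExt.fst_inl K r⟩
  have hker : IsNilpotent (RingHom.ker (π : DualNumber K →+* K)) := by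
    refine ⟨2, (Submodule.pow_succ (n := 1) _).trans ?_⟩
    rw [Submodule.pow_one]
    refine le_bot_iff.mp (Ideal.mul_le.mpr fun r hr s hs => ?_)
    have hr' : r.fst = 0 := hr
    have hs' : s.fst = 0 := hs
    rw [Ideal.mem_bot]
    ext <;> simp [hr', hs']
  let φ' : R →ₐ[DualNumber K] K := ⟨φ, fun r => RingHom.congr_fun h r⟩
  refine ⟨Algebra.FormallySmooth.liftOfSurjective φ' π hπ hker, ?_, ?_⟩
  · refine RingHom.ext fun r => ?_
    exact (Algebra.FormallySmooth.liftOfSurjective φ' π hπ hker).commutes r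
  · refine RingHom.ext fun r => ?_
    exact Algebra.FormallySmooth.liftOfSurjective_apply φ' π hπ hker r

theorem SpecMap_factors {X : Scheme.{u}} {R C : CommRingCat.{u}} (j : Spec R ⟶ X)
    [IsOpenImmersion j] (w : Spec C ⟶ X) (h : Set.range w ⊆ Set.range j) :
    ∃ φ : R ⟶ C, Spec.map φ ≫ j = w := by
  obtain ⟨φ, hφ⟩ := Spec.map_surjective (IsOpenImmersion.lift j w h)
  exact ⟨φ, by rw [hφ, IsOpenImmersion.lift_fac]⟩

/-- First order comparison of two flags over the dual numbers. -/
theorem blockTriangular_snd {K : Type*} [CommRing K] {G : Matrix (Fin d) (Fin d) K}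
    (hG : IsUnit G) (G' N E : Matrix (Fin d) (Fin d) K)
    {A M L : Matrix (Fin d) (Fin d) (DualNumber K)} (hA : A.map TrivSqZeroExt.fst = G)
    (hA' : A.map TrivSqZeroExt.snd = G') (hM : M.map TrivSqZeroExt.fst = 1)
    (hM' : M.map TrivSqZeroExt.snd = N) (hL : IsUnit L)
    (hL1 : L.map TrivSqZeroExt.fst = G) (hL2 : L.map TrivSqZeroExt.snd = E * G)
    (h : (A * M * L⁻¹).BlockTriangular id) :
    (G' * G⁻¹ + G * N * G⁻¹ - E).BlockTriangular id := by
  have hfst : ∀ X Y : Matrix (Fin d) (Fin d) (DualNumber K), (X * Y).map TrivSqZeroExt.fst =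
      X.map TrivSqZeroExt.fst * Y.map TrivSqZeroExt.fst := fun X Y =>
    Matrix.map_mul (f := (TrivSqZeroExt.fstHom K K K).toRingHom)
  have hsnd : ∀ X Y : Matrix (Fin d) (Fin d) (DualNumber K), (X * Y).map TrivSqZeroExt.snd =
      X.map TrivSqZeroExt.fst * Y.map TrivSqZeroExt.snd +
        X.map TrivSqZeroExt.snd * Y.map TrivSqZeroExt.fst := by
    intro X Y
    ext p q
    rw [Matrix.map_apply, Matrix.mul_apply, Matrix.add_apply, Matrix.mul_apply, Matrix.mul_apply,
      TrivSqZeroExt.snd_sum, ← Finset.sum_add_distrib]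
    refine Finset.sum_congr rfl fun j _ => ?_
    rw [TrivSqZeroExt.snd_mul]
    simp [mul_comm]
  have hGd := (Matrix.isUnit_iff_isUnit_det _).mp hG
  -- Comparing Z L = A M term by term gives constant term 1 for Z and then Z' G + E G = G' + G N for
  -- its ε-part Z', which is thus the displayed matrix.
  set Z := A * M * L⁻¹ with hZ
  have h1 : Z * L = A * M := by
    rw [hZ, mul_assoc, Matrix.nonsing_inv_mul _ ((Matrix.isUnit_iff_isUnit_det _).mp hL), mul_one]
  have h2 : Z.map TrivSqZeroExt.fst = 1 := by
    have := congrArg (fun X => X.map TrivSqZeroExt.fst) h1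
    simp only [hfst, hL1, hA, hM, mul_one] at this
    have h3 := congrArg (· * G⁻¹) this
    simpa only [mul_assoc, Matrix.mul_nonsing_inv _ hGd, mul_one] using h3
  have h4 : Z.map TrivSqZeroExt.snd = G' * G⁻¹ + G * N * G⁻¹ - E := by
    have := congrArg (fun X => X.map TrivSqZeroExt.snd) h1
    simp only [hsnd, hL1, hL2, hA, hA', hM, hM', h2, one_mul, mul_one] at this
    have h5 := congrArg (· * G⁻¹) this
    simp only [add_mul, mul_assoc, Matrix.mul_nonsing_inv _ hGd, mul_one] at h5
    rw [← add_sub_cancel_left E (Z.map _), h5, mul_assoc]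
    abel
  rw [← h4]
  intro p q hpq
  rw [Matrix.map_apply, h hpq, TrivSqZeroExt.snd_zero]

/-- The deformation E is turned into a κ(x)[ε]-point of the flag variety. Smoothness of p lifts it
to the frame bundle, starting from the point given by x and the frame of the chart. -/
theorem relDeformation_surjective_of_isVersalOn (h : IsVersalOn f P W) {x : S} (hx : x ∈ W) :
    Function.Surjective (relDeformation f P x) := by
  obtain ⟨c, hxc, hcW⟩ := exists_flagChart P W x hx
  rw [c.relDeformation_surjective_iff f hxc]
  intro E
  let K := IsLocalRing.ResidueField (S.presheaf.stalk x)
  let B : CommRingCat.{u} := .of (DualNumber K)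
  let ρ : Γ(S, c.U) →+* K := evalFun hxc
  let inl : K →+* DualNumber K := TrivSqZeroExt.inlHom K K
  let fst : DualNumber K →+* K := (TrivSqZeroExt.fstHom K K K).toRingHom
  -- The dual numbers are a k-algebra through constants, which is what later forces the derivation
  -- to vanish on k.
  let iB : CommRingCat.of k ⟶ B := CommRingCat.ofHom (inl.comp (ρ.comp (structureFun f c.U)))
  -- This is (1 + εE_i) g_i(x), invertible because its constant term is.
  let L : Fin l → Matrix (Fin d) (Fin d) B := fun i =>
    Matrix.of fun p q => (TrivSqZeroExt.inl ((c.g i).map ρ p q) +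
      TrivSqZeroExt.inr ((E i * (c.g i).map ρ) p q) : DualNumber K)
  have hL1 : ∀ i, (L i).map fst = (c.g i).map ρ := by
    intro i
    ext p q
    change (TrivSqZeroExt.inl ((c.g i).map ρ p q) +
      TrivSqZeroExt.inr ((E i * (c.g i).map ρ) p q) : DualNumber K).fst = _
    simp
  have hL2 : ∀ i, (L i).map TrivSqZeroExt.snd = E i * (c.g i).map ρ := by
    intro i
    ext p q
    change (TrivSqZeroExt.inl ((c.g i).map ρ p q) +
      TrivSqZeroExt.inr ((E i * (c.g i).map ρ) p q) : DualNumber K).snd = _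
    simp
  have hL : ∀ i, IsUnit (L i) := by
    intro i
    rw [Matrix.isUnit_iff_isUnit_det]
    refine TrivSqZeroExt.isUnit_iff_isUnit_fst.mpr ?_
    have h1 : fst (L i).det = ((L i).map fst).det := RingHom.map_det fst (L i)
    change IsUnit (fst (L i).det)
    rw [h1, hL1]
    exact (Matrix.isUnit_iff_isUnit_det _).mp (isUnit_map ρ (c.isUnit i))
  obtain ⟨X, p, q, hpq, hq⟩ := h.exists_isPullback (specFlags iB L hL)
  -- The reduction modulo ε has an obvious lift: the point x with its frame, that is, the identity
  -- matrix.
  have h0 : IsCompatible (structureFun f c.U) iB.hom c.g (fun i => (L i)⁻¹) ρ fst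
      (1 : Matrix (Fin d) (Fin d) K) := by
    refine ⟨rfl, isUnit_one, fun i => ?_⟩
    rw [mul_one, ← map_nonsing_inv fst (hL i), hL1, Matrix.mul_nonsing_inv _
      ((Matrix.isUnit_iff_isUnit_det _).mp (isUnit_map ρ (c.isUnit i)))]
    exact Matrix.blockTriangular_one
  obtain ⟨w, hwq, hw⟩ := c.exists_point (C := .of K) (γ := CommRingCat.ofHom fst) hcW hpq h0
  let t : Spec (.of K) := IsLocalRing.closedPoint K
  have h1 : (p.app (op X) (𝟙 X)).1.base (w t) ∈ c.U := by
    have h2 := app_comp p w (𝟙 X)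
    rw [Category.comp_id] at h2
    have h3 := hw.base_mem t
    rw [h2] at h3
    exact h3
  obtain ⟨R, j, hj, hxj, θ, α, M, hθ, hθs, hα, hcomp⟩ := c.exists_affine_nhds hpq hq (w t) h1
  obtain ⟨φ, hφ⟩ := SpecMap_factors j w (by
    rintro _ ⟨t', rfl⟩
    rwa [Subsingleton.elim t' t])
  have h4 := hα.pullback φ
  rw [← app_comp, hφ] at h4
  obtain ⟨h5, h6⟩ := h4.unique hw
  have h7 : φ.hom.comp θ.hom = fst := by
    have : Spec.map (θ ≫ φ) = Spec.map (CommRingCat.ofHom fst) := by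
      rw [Spec.map_comp, ← hθ, ← Category.assoc, hφ, hwq]
    exact congrArg CommRingCat.Hom.hom (Spec.map_injective this)
  -- The κ(x)-point of the affine piece Spec R extends to a section over the dual numbers. The
  -- ε-parts of ψ ∘ α and ψ(M) are the sought derivation and matrix.
  obtain ⟨ψ, hψθ, hψ⟩ := exists_lift_dualNumber (RingHom.smooth_def.mp hθs).1 h7
  have h8 := hcomp.comp ψ
  rw [hψθ] at h8
  have h9 := isDerivationAlong_snd (ψ.comp α)
  have h10 : fst.comp (ψ.comp α) = ρ := by
    rw [← RingHom.comp_assoc, hψ, h5]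
  rw [h10] at h9
  refine ⟨_, h9, fun r => ?_, (M.map ψ).map TrivSqZeroExt.snd, fun i => ?_⟩
  · have h11 := RingHom.congr_fun h8.comp_eq r
    change ((ψ.comp α) (structureFun f c.U r)).snd = 0
    exact (congrArg TrivSqZeroExt.snd h11).trans (TrivSqZeroExt.snd_inl _ _)
  · refine blockTriangular_snd (A := (c.g i).map (ψ.comp α)) (M := M.map ψ) (L := L i)
      (isUnit_map ρ (c.isUnit i)) _ _ (E i) ?_ rfl ?_ rfl (hL i) (hL1 i) (hL2 i) ?_
    · rw [← h10]
      rfl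
    · rw [← h6, ← hψ]
      rfl
    · exact h8.triangular i

/-! #### Smoothness of the base -/

/-- The universal tuple of invertible matrices exists over a smooth algebra. -/
theorem exists_universal_matrices (k : Type u) [Field k] (d l : ℕ) :
    ∃ (B : CommRingCat.{u}) (iB : CommRingCat.of k ⟶ B) (K : Fin l → Matrix (Fin d) (Fin d) B),
      iB.hom.Smooth ∧ (∀ i, IsUnit (K i)) ∧ ∀ (A : Type u) [CommRing A] (iA : k →+* A)
        (g : Fin l → Matrix (Fin d) (Fin d) A), (∀ i, IsUnit (g i)) →
          ∃ γ : B →+* A, γ.comp iB.hom = iA ∧ ∀ i, (K i).map γ = g i := by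
  let Poly := MvPolynomial (Fin l × Fin d × Fin d) k
  let Y : Fin l → Matrix (Fin d) (Fin d) Poly := fun i =>
    Matrix.of fun p q => MvPolynomial.X (i, p, q)
  -- Inverting the product of the determinants makes all l generic matrices invertible at once, and
  -- a localization of a polynomial ring stays smooth.
  let r : Poly := ∏ i, (Y i).det
  let B := Localization.Away r
  let K : Fin l → Matrix (Fin d) (Fin d) B := fun i => (Y i).map (algebraMap Poly B)
  refine ⟨.of B, CommRingCat.ofHom (algebraMap k B), K, ?_, fun i => ?_, ?_⟩
  · have h1 : Algebra.Smooth k Poly := ⟨inferInstance, inferInstance⟩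
    have h2 : Algebra.Smooth Poly B := Algebra.Smooth.of_isLocalization_Away r
    have h3 : Algebra.Smooth k B := Algebra.Smooth.comp k Poly B
    exact (RingHom.smooth_algebraMap).mpr h3
  · rw [Matrix.isUnit_iff_isUnit_det]
    have h1 : algebraMap Poly B (Y i).det = (K i).det := RingHom.map_det _ _
    rw [← h1]
    refine isUnit_of_dvd_unit ?_ (IsLocalization.Away.algebraMap_isUnit (S := B) r)
    exact map_dvd _ (Finset.dvd_prod_of_mem _ (Finset.mem_univ i))
  · intro A _ iA g hg
    let e : Poly →+* A := MvPolynomial.eval₂Hom iA fun v => g v.1 v.2.1 v.2.2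
    have h1 : ∀ i, (Y i).map e = g i := by
      intro i
      ext p q
      exact MvPolynomial.eval₂Hom_X' _ _ _
    have h2 : IsUnit (e r) := by
      rw [map_prod]
      refine IsUnit.prod_univ_iff.mpr fun i => ?_
      have h3 : e (Y i).det = ((Y i).map e).det := RingHom.map_det _ _
      rw [h3, h1]
      exact (Matrix.isUnit_iff_isUnit_det _).mp (hg i)
    refine ⟨IsLocalization.Away.lift r h2, ?_, fun i => ?_⟩
    · ext a
      change IsLocalization.Away.lift r h2 (algebraMap k B a) = _
      rw [IsScalarTower.algebraMap_apply k Poly B, IsLocalization.Away.lift_eq]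
      exact MvPolynomial.eval₂Hom_C _ _ _
    · rw [← h1]
      ext p q
      exact IsLocalization.Away.lift_eq r h2 _

/-- A localization that factors through a formally smooth algebra is formally smooth. -/
theorem formallySmooth_of_retract {k A A' R : Type u} [CommRing k] [CommRing A] [CommRing A']
    [CommRing R] [Algebra A A'] (a : A) [IsLocalization.Away a A'] {iA : k →+* A} {α : A →+* R}
    {r : R →+* A'} (h : r.comp α = algebraMap A A') (hR : (α.comp iA).FormallySmooth) :
    ((algebraMap A A').comp iA).FormallySmooth := by
  let _ := (α.comp iA).toAlgebra
  let _ := ((algebraMap A A').comp iA).toAlgebra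
  have : Algebra.FormallySmooth k R := hR
  change Algebra.FormallySmooth k A'
  rw [Algebra.FormallySmooth.iff_comp_surjective]
  intro C _ _ I hI φ
  -- Lift φ ∘ r from R, then compose with α to get a map A → C. It reduces to φ modulo I, so it
  -- sends a to a unit and extends to the localization.
  obtain ⟨ψ, hψ⟩ := Algebra.FormallySmooth.comp_surjective k R I hI
    ⟨(φ : A' →+* C ⧸ I).comp r, fun c => by
      refine Eq.trans ?_ (φ.commutes c)
      exact congrArg φ (RingHom.congr_fun h (iA c))⟩
  have h1 : ∀ b : R, Ideal.Quotient.mk I (ψ b) = φ (r b) := fun b => DFunLike.congr_fun hψ b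
  have h2 : IsUnit (((ψ : R →+* C).comp α) a) := by
    rw [← IsNilpotent.isUnit_quotient_mk_iff (I := I) ⟨2, hI⟩]
    have h3 : Ideal.Quotient.mk I (((ψ : R →+* C).comp α) a) = φ (algebraMap A A' a) := by
      rw [← h]
      exact h1 _
    rw [h3]
    exact (IsLocalization.Away.algebraMap_isUnit a).map φ
  let Φ : A' →+* C := IsLocalization.Away.lift a h2
  have hΦ : ∀ b, Φ (algebraMap A A' b) = ψ (α b) := fun b => IsLocalization.Away.lift_eq a h2 b
  refine ⟨⟨Φ, fun c => ?_⟩, ?_⟩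
  · exact (hΦ (iA c)).trans (ψ.commutes c)
  · have h4 : (Ideal.Quotient.mk I).comp Φ = (φ : A' →+* C ⧸ I) := by
      refine IsLocalization.ringHom_ext (Submonoid.powers a) ?_
      ext b
      change Ideal.Quotient.mk I (Φ (algebraMap A A' b)) = φ (algebraMap A A' b)
      rw [hΦ, h1, ← h]
      rfl
    exact AlgHom.ext fun b => RingHom.congr_fun h4 b

/-- Pulling p back along the universal tuple of matrices gives a scheme X smooth over a smooth
k-algebra. The matrices of the chart together with its frame define a morphism w from the chart to X
that is a section of the projection to S, so the smoothness of X descends to S. -/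
theorem isSmoothAt_of_isVersalOn [LocallyOfFiniteType f] (h : IsVersalOn f P W) {x : S}
    (hx : x ∈ W) : IsSmoothAt f x := by
  obtain ⟨c, hxc, hcW⟩ := exists_flagChart P W x hx
  obtain ⟨B, iB, K, hB, hK, hBK⟩ := exists_universal_matrices k d l
  obtain ⟨γ, hγ, hγK⟩ := hBK Γ(S, c.U) (structureFun f c.U) c.g c.isUnit
  obtain ⟨X, p, q, hpq, hq⟩ := h.exists_isPullback (specFlags iB K hK)
  -- The tautological compatible triple: identity on A, the classifying map γ of the matrices of the
  -- chart, and the identity matrix as frame.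
  have h0 : IsCompatible (structureFun f c.U) iB.hom c.g (fun i => (K i)⁻¹) (RingHom.id _) γ
      (1 : Matrix (Fin d) (Fin d) Γ(S, c.U)) := by
    refine ⟨hγ.symm, isUnit_one, fun i => ?_⟩
    have h1 : (c.g i).map (RingHom.id Γ(S, c.U)) = c.g i := by
      ext
      rfl
    rw [mul_one, ← map_nonsing_inv γ (hK i), hγK, h1, Matrix.mul_nonsing_inv _
      ((Matrix.isUnit_iff_isUnit_det _).mp (c.isUnit i))]
    exact Matrix.blockTriangular_one
  obtain ⟨w, hwq, hw⟩ := c.exists_point (C := Γ(S, c.U)) (γ := CommRingCat.ofHom γ) hcW hpq h0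
  let t : Spec Γ(S, c.U) := c.affine.primeIdealOf ⟨x, hxc⟩
  have h1 : (p.app (op X) (𝟙 X)).1.base (w t) ∈ c.U := by
    have h2 := app_comp p w (𝟙 X)
    rw [Category.comp_id] at h2
    have h3 := hw.base_mem t
    rw [h2] at h3
    exact h3
  obtain ⟨R, j, hj, hxj, θ, α, M, hθ, hθs, hα, hcomp⟩ := c.exists_affine_nhds hpq hq (w t) h1
  -- Coordinates on X are available only on the affine piece Spec R, so the chart is shrunk to a
  -- basic open around x that w maps into this piece.
  obtain ⟨_, ⟨_, ⟨a, rfl⟩, rfl⟩, hta, haj⟩ := PrimeSpectrum.isBasis_basic_opens.exists_subset_of_mem_open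
    (show t ∈ ((w ⁻¹ᵁ j.opensRange : (Spec Γ(S, c.U)).Opens) : Set _) from hxj)
    (w ⁻¹ᵁ j.opensRange).isOpen
  have hle : S.basicOpen a ≤ c.U := S.basicOpen_le a
  have hV : IsAffineOpen (S.basicOpen a) := c.affine.basicOpen a
  have hxV : x ∈ S.basicOpen a := by
    have h2 : t ∈ c.affine.fromSpec ⁻¹ᵁ S.basicOpen a := by
      rw [c.affine.fromSpec_preimage_basicOpen]
      exact hta
    have h3 : c.affine.fromSpec t = x := c.affine.fromSpec_primeIdealOf ⟨x, hxc⟩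
    exact h3 ▸ (h2 : c.affine.fromSpec t ∈ S.basicOpen a)
  have hloc := c.affine.isLocalization_basicOpen a
  let res : Γ(S, c.U) ⟶ Γ(S, S.basicOpen a) := CommRingCat.ofHom (resFun hle)
  obtain ⟨r, hr⟩ := SpecMap_factors j (Spec.map res ≫ w) (by
    rintro _ ⟨s, rfl⟩
    refine haj (show Spec.map res s ∈ PrimeSpectrum.basicOpen a from fun hs => ?_)
    exact s.2.ne_top (Ideal.eq_top_of_isUnit_mem _ hs
      (IsLocalization.Away.algebraMap_isUnit (S := Γ(S, S.basicOpen a)) a)))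
  have h4 := hα.pullback r
  rw [← app_comp, hr, app_comp] at h4
  obtain ⟨h5, -⟩ := h4.unique (hw.pullback res)
  -- Uniqueness of coordinates identifies A → R → A_a with the restriction map; this is the
  -- retraction needed.
  have h6 : r.hom.comp α = resFun hle := h5
  have h7 : structureFun f (S.basicOpen a) = (resFun hle).comp (structureFun f c.U) := by
    ext t
    exact (resFun_resFun _ _ _).symm
  refine isSmoothAt_of_smooth f hV hxV (RingHom.smooth_def.mpr ⟨?_,
    finitePresentation_structureFun f hV⟩)
  rw [h7]
  refine formallySmooth_of_retract a h6 ?_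
  -- Compatibility says that k → A → R equals k → B → R, a composite of smooth homomorphisms.
  rw [hcomp.comp_eq]
  exact (RingHom.smooth_def.mp (hB.comp hθs)).1

end Versal

end RelFlag

end

theorem mainTheorem10 {k : Type u} [Field k] [IsAlgClosed k] {S : Scheme.{u}}
    (f : S ⟶ Spec (.of k)) [LocallyOfFiniteType f] [QuasiCompact f] {d l : ℕ}
    (H : RelFlag.VectorBundle S d) (P : Fin l → RelFlag.CompleteFlag H)
    (x : S) (hx : IsClosed ({x} : Set S)) :
    RelFlag.IsVersalAt f P x ↔
      RelFlag.IsSmoothAt f x ∧ Function.Surjective (RelFlag.relDeformation f P x) := by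
  refine ⟨?_, fun h => RelFlag.isVersalAt_of_isSmoothAt f hx h.1 h.2⟩
  rintro ⟨W, hxW, hW⟩
  exact ⟨RelFlag.isSmoothAt_of_isVersalOn hW hxW,
    RelFlag.relDeformation_surjective_of_isVersalOn hW hxW⟩
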